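/- Let $M$ be a smooth manifold. A *bundle gerbe* $(P,X,M)$ on $M$ consists of a manifold $X$, a smooth surjection $\pi\colon X\to M$ admitting smooth local sections (every point of $M$ has an open neighbourhood over which $\pi$ has a smooth section), a principal $\mathbb C^\times$-bundle $P\to X^{[2]}=X\times_M X$, and an isomorphism of $\mathbb C^\times$-bundles over $X^{[3]}$, given fibrewise by $P_{(x_2,x_3)}\otimes P_{(x_1,x_2)}\to P_{(x_1,x_3)}$ (the *product*), which is associative over $X^{[4]}$. Here $\otimes$ is the contracted product, $*$ denotes the inverse bundle, and fibre products carry the smooth structure induced from the product manifolds. Let $(P,X,M)$, $(Q,Y,M)$ be bundle gerbes. A *stable morphism* $f\colon P\to Q$ is a trivialisation $(L_f,\phi_f)$ of $P^*\otimes Q$: a $\mathbb C^\times$-bundle $L_f$ on $X\times_M Y$ with an isomorphism $\phi_f\colon\delta(L_f)\to P^*\otimes Q$ over $(X\times_M Y)^{[2]}$, fibrewise $L_f(x_2,y_2)\otimes L_f(x_1,y_1)^*\to P_{(x_1,x_2)}^*\otimes Q_{(y_1,y_2)}$, commuting with the products $(l_3\otimes l_2^*)\otimes(l_2\otimes l_1^*)\mapsto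 l_3\otimes l_1^*$ and $(p^*\otimes q)\otimes(p'^*\otimes q')\mapsto(pp')^*\otimes qq'$. A *transformation* $\theta\colon f\Rightarrow g$ of stable morphisms $P\to Q$ is a smooth section $\theta$ of $L_f^*\otimes L_g$ such that $\delta(\theta)$ is the section of $\delta(L_f^*\otimes L_g)$ corresponding to the isomorphism $\phi_g^{-1}\circ\phi_f\colon\delta(L_f)\to\delta(L_g)$. Transformations compose by the contraction $L_f^*\otimes L_g\otimes L_g^*\otimes L_h\to L_f^*\otimes L_h$; this gives a category $\mathrm{Hom}_s(P,Q)$. **Proposition.** There is a bicategory $\mathcal B_s$ whose objects are the bundle gerbes on $M$ and whose category of 1-arrows and 2-arrows from $P$ to $Q$ is $\mathrm{Hom}_s(P,Q)$, with the following operations. * For $f\colon P\to Q$ and $g\colon Q\to R$, with $R=(R,Z,M)$, the bundle $L_{g\circ f}$ on $X\times_M Z$ is obtained by descent from the bundle on $X\times_M Z\times_M Y^{[2]}$ with fibre $L_f(x,y_1)\otimes L_g(y_2,z)\otimes Q_{(y_1,y_2)}$, and $\phi_{g\circ f}$ is induced by $\phi_f$, $\phi_g$ and the product of $Q$. That is,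 there is an isomorphism $\kappa$ from this bundle to the pullback of $L_{g\circ f}$ such that $\phi_{g\circ f}\bigl(\kappa(a'\otimes b'\otimes q')\otimes\kappa(a\otimes b\otimes q)^*\bigr)=p^*\otimes r$ whenever $\phi_f(a'\otimes a^*)=p^*\otimes s$, $\phi_g(b'\otimes b^*)=t^*\otimes r$ and $q's=tq$. * The identity 1-arrow of $P$ is (up to isomorphism) the bundle $P$ on $X\times_M X$ with $\phi(u_2\otimes u_1^*)=p^*\otimes q$ whenever $u_2p=qu_1$. * In terms of the isomorphisms $\kappa$, the horizontal composite of $\theta\colon f\Rightarrow f'$ and $\rho\colon g\Rightarrow g'$ is $a\otimes b\otimes q\mapsto\theta(a)\otimes\rho(b)\otimes q$, and the associativity isomorphism identifies $(a\otimes b\otimes q)\otimes c\otimes r$ with $a\otimes(b\otimes c\otimes r)\otimes q$ (for a third 1-arrow $h\colon R\to S$, with $c\in L_h(z_2,w)$ and $r\in R_{(z_1,z_2)}$); the identity isomorphisms $f\circ 1_P\cong f$ and $1_Q\circ f\cong f$ are induced by the products and by the actions $L_f(x_2,y)\otimes P_{(x,x_2)}\simeq L_f(x,y)$ and $Q_{(y_1,y)}\otimes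 L_f(x,y_1)\simeq L_f(x,y)$ that $\phi_f$ defines. This bicategory is a bigroupoid: all 2-arrows are invertible, and every 1-arrow $\alpha\colon P\to Q$ is coherently invertible, i.e. there are a 1-arrow $\beta\colon Q\to P$ and 2-arrows $\varphi\colon\beta\circ\alpha\Rightarrow 1_P$, $\psi\colon\alpha\circ\beta\Rightarrow 1_Q$ such that the two 2-arrows $(\alpha\circ\beta)\circ\alpha\Rightarrow\alpha$, one through $\alpha\circ(\beta\circ\alpha)$ and $1_\alpha\circ\varphi$, the other through $\psi\circ 1_\alpha$, are equal. -/

import Mathlib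

open CategoryTheory

universe u v w

/-! ## Bicategories and bigroupoids -/

/-- A bicategory with prescribed objects `Ob` and prescribed categories `Hom A B` of 1-arrows and
2-arrows. The fields are those of Mathlib's `Bicategory`, see `toBicategory`; in particular
`comp f g` is the composite "first `f`, then `g`". -/
structure BicategoryOn {Ob : Type u} (Hom : Ob → Ob → Type v) [∀ A B, Category.{w} (Hom A B)] where
  id (a : Ob) : Hom a a
  comp {a b c : Ob} (f : Hom a b) (g : Hom b c) : Hom a c
  whiskerLeft {a b c : Ob} (f : Hom a b) {g h : Hom b c} (η : g ⟶ h) : comp f g ⟶ comp f h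
  whiskerRight {a b c : Ob} {f g : Hom a b} (η : f ⟶ g) (h : Hom b c) : comp f h ⟶ comp g h
  associator {a b c d : Ob} (f : Hom a b) (g : Hom b c) (h : Hom c d) :
    comp (comp f g) h ≅ comp f (comp g h)
  leftUnitor {a b : Ob} (f : Hom a b) : comp (id a) f ≅ f
  rightUnitor {a b : Ob} (f : Hom a b) : comp f (id b) ≅ f
  whiskerLeft_id {a b c : Ob} (f : Hom a b) (g : Hom b c) : whiskerLeft f (𝟙 g) = 𝟙 (comp f g)
  whiskerLeft_comp {a b c : Ob} (f : Hom a b) {g h i : Hom b c} (η : g ⟶ h) (θ : h ⟶ i) :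
    whiskerLeft f (η ≫ θ) = whiskerLeft f η ≫ whiskerLeft f θ
  id_whiskerLeft {a b : Ob} {f g : Hom a b} (η : f ⟶ g) :
    whiskerLeft (id a) η = (leftUnitor f).hom ≫ η ≫ (leftUnitor g).inv
  comp_whiskerLeft {a b c d : Ob} (f : Hom a b) (g : Hom b c) {h h' : Hom c d} (η : h ⟶ h') :
    whiskerLeft (comp f g) η =
      (associator f g h).hom ≫ whiskerLeft f (whiskerLeft g η) ≫ (associator f g h').inv
  id_whiskerRight {a b c : Ob} (f : Hom a b) (g : Hom b c) : whiskerRight (𝟙 f) g = 𝟙 (comp f g)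
  comp_whiskerRight {a b c : Ob} {f g h : Hom a b} (η : f ⟶ g) (θ : g ⟶ h) (i : Hom b c) :
    whiskerRight (η ≫ θ) i = whiskerRight η i ≫ whiskerRight θ i
  whiskerRight_id {a b : Ob} {f g : Hom a b} (η : f ⟶ g) :
    whiskerRight η (id b) = (rightUnitor f).hom ≫ η ≫ (rightUnitor g).inv
  whiskerRight_comp {a b c d : Ob} {f f' : Hom a b} (η : f ⟶ f') (g : Hom b c) (h : Hom c d) :
    whiskerRight η (comp g h) =
      (associator f g h).inv ≫ whiskerRight (whiskerRight η g) h ≫ (associator f' g h).hom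
  whisker_assoc {a b c d : Ob} (f : Hom a b) {g g' : Hom b c} (η : g ⟶ g') (h : Hom c d) :
    whiskerRight (whiskerLeft f η) h =
      (associator f g h).hom ≫ whiskerLeft f (whiskerRight η h) ≫ (associator f g' h).inv
  whisker_exchange {a b c : Ob} {f g : Hom a b} {h i : Hom b c} (η : f ⟶ g) (θ : h ⟶ i) :
    whiskerLeft f θ ≫ whiskerRight η i = whiskerRight η h ≫ whiskerLeft g θ
  pentagon {a b c d e : Ob} (f : Hom a b) (g : Hom b c) (h : Hom c d) (i : Hom d e) :
    whiskerRight (associator f g h).hom i ≫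
        (associator f (comp g h) i).hom ≫ whiskerLeft f (associator g h i).hom =
      (associator (comp f g) h i).hom ≫ (associator f g (comp h i)).hom
  triangle {a b c : Ob} (f : Hom a b) (g : Hom b c) :
    (associator f (id b) g).hom ≫ whiskerLeft f (leftUnitor g).hom =
      whiskerRight (rightUnitor f).hom g

/-- The underlying bicategory in Mathlib's sense. -/
abbrev BicategoryOn.toBicategory {Ob : Type u} {Hom : Ob → Ob → Type v}
    [inst : ∀ A B, Category.{w} (Hom A B)] (𝔅 : BicategoryOn Hom) : Bicategory Ob where
  Hom := Hom
  id := 𝔅.id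
  comp := 𝔅.comp
  homCategory := inst
  whiskerLeft := 𝔅.whiskerLeft
  whiskerRight := 𝔅.whiskerRight
  associator := 𝔅.associator
  leftUnitor := 𝔅.leftUnitor
  rightUnitor := 𝔅.rightUnitor
  whiskerLeft_id := 𝔅.whiskerLeft_id
  whiskerLeft_comp := 𝔅.whiskerLeft_comp
  id_whiskerLeft := 𝔅.id_whiskerLeft
  comp_whiskerLeft := 𝔅.comp_whiskerLeft
  id_whiskerRight := 𝔅.id_whiskerRight
  comp_whiskerRight := 𝔅.comp_whiskerRight
  whiskerRight_id := 𝔅.whiskerRight_id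
  whiskerRight_comp := 𝔅.whiskerRight_comp
  whisker_assoc := 𝔅.whisker_assoc
  whisker_exchange := 𝔅.whisker_exchange
  pentagon := 𝔅.pentagon
  triangle := 𝔅.triangle

open Bicategory in
/-- A bicategory is a bigroupoid if its 2-arrows are invertible and its 1-arrows are coherently
invertible. -/
def IsBigroupoid (Ob : Type u) [Bicategory.{w, v} Ob] : Prop :=
  (∀ (a b : Ob) (f g : a ⟶ b) (η : f ⟶ g), IsIso η) ∧
  ∀ (a b : Ob) (f : a ⟶ b), ∃ (g : b ⟶ a) (φ : f ≫ g ⟶ 𝟙 a) (ψ : g ≫ f ⟶ 𝟙 b),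
    (α_ f g f).inv ≫ φ ▷ f ≫ (λ_ f).hom = f ◁ ψ ≫ (ρ_ f).hom

open scoped Manifold ContDiff Topology

/-! ## `ℂˣ`-torsors: inverse and contracted product -/

/-- The inverse `A*` of a `ℂˣ`-torsor `A`: the same set, whose points are written `dstar a`, on which
`ℂˣ` acts through `z ↦ z⁻¹`. -/
structure DualTorsor (A : Type u) : Type u where
  /-- the point `a*` of `A*` given by a point `a` of `A` -/
  dstar ::
  /-- the point of `A` underlying a point of `A*` -/
  undstar : A

namespace DualTorsor

variable {A : Type u} [Torsor ℂˣ A]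

instance : MulAction ℂˣ (DualTorsor A) where
  smul c a := dstar (c⁻¹ • a.undstar)
  one_smul a := by
    change dstar ((1 : ℂˣ)⁻¹ • a.undstar) = a
    rw [inv_one, one_smul]
  mul_smul c d a := by
    change dstar ((c * d)⁻¹ • a.undstar) = dstar (c⁻¹ • (d⁻¹ • a.undstar))
    rw [mul_inv, mul_smul]

instance : Torsor ℂˣ (DualTorsor A) where
  sdiv a b := b.undstar /ₛ a.undstar
  nonempty := ⟨dstar (Classical.arbitrary A)⟩
  sdiv_smul' a b := by
    change dstar ((b.undstar /ₛ a.undstar)⁻¹ • b.undstar) = a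
    rw [inv_sdiv_eq_sdiv_rev, sdiv_smul]
  smul_sdiv' c a := by
    change a.undstar /ₛ (c⁻¹ • a.undstar) = c
    rw [sdiv_smul_eq_sdiv_div, sdiv_self, one_div, inv_inv]

theorem smul_dstar (c : ℂˣ) (a : A) : c • dstar a = dstar (c⁻¹ • a) := rfl

theorem dstar_sdiv_dstar (a b : A) : dstar a /ₛ dstar b = b /ₛ a := rfl

end DualTorsor

/-- `(a, b)` and `(a', b')` are identified in the contracted product when they differ by an
antidiagonal element `(c, c⁻¹)` of `ℂˣ × ℂˣ`. -/
def tensorSetoid (A B : Type u) [Torsor ℂˣ A] [Torsor ℂˣ B] : Setoid (A × B) where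
  r p q := ∃ c : ℂˣ, q.1 = c • p.1 ∧ q.2 = c⁻¹ • p.2
  iseqv :=
    { refl := fun p => ⟨1, by simp⟩
      symm := by
        rintro p q ⟨c, h1, h2⟩
        exact ⟨c⁻¹, by rw [h1, inv_smul_smul], by rw [h2, inv_inv, smul_inv_smul]⟩
      trans := by
        rintro p q r ⟨c, h1, h2⟩ ⟨d, h3, h4⟩
        exact ⟨d * c, by rw [h3, h1, mul_smul], by rw [h4, h2, mul_inv, mul_smul]⟩ }

/-- The contracted product `A ⊗ B` of two `ℂˣ`-torsors. -/
def TensorTorsor (A B : Type u) [Torsor ℂˣ A] [Torsor ℂˣ B] : Type u :=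
  Quotient (tensorSetoid A B)

namespace TensorTorsor

variable {A B C : Type u} [Torsor ℂˣ A] [Torsor ℂˣ B] [Torsor ℂˣ C]

/-- The element `a ⊗ b` of the contracted product. -/
def tmul (a : A) (b : B) : TensorTorsor A B := Quotient.mk (tensorSetoid A B) (a, b)

theorem exists_tmul (t : TensorTorsor A B) : ∃ a b, t = tmul a b :=
  Quotient.inductionOn t fun p => ⟨p.1, p.2, rfl⟩

theorem tmul_eq_iff {a a' : A} {b b' : B} :
    tmul a b = tmul a' b' ↔ ∃ c : ℂˣ, a' = c • a ∧ b' = c⁻¹ • b :=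
  @Quotient.eq _ (tensorSetoid A B) _ _

theorem smul_tmul_inv_smul (c : ℂˣ) (a : A) (b : B) : tmul (c • a) (c⁻¹ • b) = tmul a b :=
  (tmul_eq_iff.2 ⟨c, rfl, rfl⟩).symm

theorem smul_tmul_eq (c : ℂˣ) (a : A) (b : B) : tmul (c • a) b = tmul a (c • b) :=
  tmul_eq_iff.2 ⟨c⁻¹, by simp, by simp⟩

instance : MulAction ℂˣ (TensorTorsor A B) where
  smul c := Quotient.map (sa := tensorSetoid A B) (sb := tensorSetoid A B)
    (fun p => (c • p.1, p.2)) (by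
      rintro p q ⟨d, h1, h2⟩
      exact ⟨d, by simp only [h1]; exact smul_comm _ _ _, h2⟩)
  one_smul t := by
    obtain ⟨a, b, rfl⟩ := exists_tmul t
    exact congrArg (fun x => tmul x b) (one_smul ℂˣ a)
  mul_smul c d t := by
    obtain ⟨a, b, rfl⟩ := exists_tmul t
    exact congrArg (fun x => tmul x b) (mul_smul c d a)

theorem smul_tmul (c : ℂˣ) (a : A) (b : B) : c • tmul a b = tmul (c • a) b := rfl

instance : Torsor ℂˣ (TensorTorsor A B) where
  sdiv s t := Quotient.liftOn₂ (s₁ := tensorSetoid A B) (s₂ := tensorSetoid A B) s t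
    (fun p q => (p.1 /ₛ q.1) * (p.2 /ₛ q.2)) (by
      rintro p q p' q' ⟨c, h1, h2⟩ ⟨d, h3, h4⟩
      rw [h1, h2, h3, h4]
      simp only [smul_sdiv_assoc, sdiv_smul_eq_sdiv_div, div_eq_mul_inv, inv_inv]
      rw [show c * (p.1 /ₛ q.1) * d⁻¹ * (c⁻¹ * (p.2 /ₛ q.2) * d) =
        (c * c⁻¹) * (d * d⁻¹) * ((p.1 /ₛ q.1) * (p.2 /ₛ q.2)) by ac_rfl]
      simp)
  nonempty := ⟨tmul (Classical.arbitrary A) (Classical.arbitrary B)⟩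
  sdiv_smul' s t := by
    obtain ⟨a, b, rfl⟩ := exists_tmul s
    obtain ⟨a', b', rfl⟩ := exists_tmul t
    change tmul (((a /ₛ a') * (b /ₛ b')) • a') b' = tmul a b
    rw [mul_comm, mul_smul, sdiv_smul, smul_tmul_eq, sdiv_smul]
  smul_sdiv' c t := by
    obtain ⟨a, b, rfl⟩ := exists_tmul t
    change ((c • a) /ₛ a) * (b /ₛ b) = c
    rw [smul_sdiv, sdiv_self, mul_one]

theorem tmul_sdiv_tmul (a a' : A) (b b' : B) :
    tmul a b /ₛ tmul a' b' = (a /ₛ a') * (b /ₛ b') := rfl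

theorem tmul_left_cancel {a : A} {b b' : B} (h : tmul a b = tmul a b') : b = b' := by
  have := congrArg (fun t => t /ₛ tmul a b') h
  simpa [tmul_sdiv_tmul] using this

theorem exists_right (t : TensorTorsor A B) (a : A) : ∃ b, t = tmul a b := by
  obtain ⟨a', b, rfl⟩ := exists_tmul t
  exact ⟨(a' /ₛ a) • b, by rw [← smul_tmul_eq, sdiv_smul]⟩

/-- The canonical element `a* ⊗ a` of `A* ⊗ A`, which does not depend on `a`. -/
noncomputable def coev (A : Type u) [Torsor ℂˣ A] : TensorTorsor (DualTorsor A) A :=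
  tmul (.dstar (Classical.arbitrary A)) (Classical.arbitrary A)

theorem coev_eq (a : A) : coev A = tmul (.dstar a) a :=
  tmul_eq_iff.2 ⟨Classical.arbitrary A /ₛ a, by
    rw [DualTorsor.smul_dstar, inv_sdiv_eq_sdiv_rev, sdiv_smul], by
    rw [inv_sdiv_eq_sdiv_rev, sdiv_smul]⟩

/-- The contraction `(A* ⊗ B) ⊗ (B* ⊗ C) → A* ⊗ C`, which sends `(a ⊗ b) ⊗ (b'* ⊗ c)` to
`(b / b') • (a ⊗ c)`. -/
def contract (s : TensorTorsor A B) (t : TensorTorsor (DualTorsor B) C) : TensorTorsor A C :=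
  Quotient.liftOn₂ (s₁ := tensorSetoid A B) (s₂ := tensorSetoid (DualTorsor B) C) s t
    (fun p q => (p.2 /ₛ q.1.undstar) • tmul p.1 q.2) (by
      rintro ⟨a, b⟩ ⟨⟨b'⟩, c⟩ ⟨a₁, b₁⟩ ⟨⟨b₁'⟩, c₁⟩ ⟨x, h1, h2⟩ ⟨y, h3, h4⟩
      rw [DualTorsor.smul_dstar, DualTorsor.dstar.injEq] at h3
      simp only at h1 h2 h3 h4 ⊢
      subst h1 h2 h3 h4
      rw [smul_sdiv_assoc, sdiv_smul_eq_sdiv_div, smul_tmul, smul_tmul, ← smul_tmul_eq,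
        ← mul_smul, ← mul_smul]
      congr 2
      rw [div_inv_eq_mul, show y⁻¹ * (x⁻¹ * ((b /ₛ b') * y)) * x =
        (y * y⁻¹) * (x * x⁻¹) * (b /ₛ b') by ac_rfl]
      simp)

theorem contract_tmul (a : A) (b : B) (c : C) :
    contract (tmul a b) (tmul (.dstar b) c) = tmul a c := by
  change (b /ₛ b) • tmul a c = _
  rw [sdiv_self, one_smul]

end TensorTorsor

open DualTorsor TensorTorsor

/-! ## Smooth functions on subsets of manifolds -/

section Bundles

variable {E H N : Type u} [NormedAddCommGroup E] [NormedSpace ℝ E] [TopologicalSpace H]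
  (I : ModelWithCorners ℝ E H) [TopologicalSpace N] [ChartedSpace H N]

/-- A `ℂˣ`-valued function on a subset `S` of a manifold `N` is smooth at `p` if near `p` it is the
restriction of a smooth function on `N`. If `S` is an embedded submanifold of `N` this is
smoothness for the manifold structure of `S`. -/
def SmoothAtOn (S : Set N) (f : S → ℂˣ) (p : S) : Prop :=
  ∃ g : N → ℂ, (∀ᶠ q in 𝓝 (p : N), ContMDiffAt I 𝓘(ℝ, ℂ) ∞ g q) ∧
    ∀ᶠ q in 𝓝 p, (f q : ℂ) = g q

variable {I}

theorem SmoothAtOn.mul {S : Set N} {f f' : S → ℂˣ} {p : S} (h : SmoothAtOn I S f p)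
    (h' : SmoothAtOn I S f' p) : SmoothAtOn I S (fun q => f q * f' q) p := by
  obtain ⟨g, hg, hfg⟩ := h
  obtain ⟨g', hg', hfg'⟩ := h'
  refine ⟨fun q => g q * g' q, ?_, ?_⟩
  · filter_upwards [hg, hg'] with q h1 h2
    exact (contDiff_mul (𝕜 := ℝ) (𝔸 := ℂ)).contMDiff.contMDiffAt.comp q (h1.prodMk_space h2)
  · filter_upwards [hfg, hfg'] with q h1 h2
    rw [Units.val_mul, h1, h2]

theorem SmoothAtOn.congr {S : Set N} {f f' : S → ℂˣ} {p : S} (h : SmoothAtOn I S f p)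
    (e : ∀ q, f q = f' q) : SmoothAtOn I S f' p :=
  (funext e : f = f') ▸ h

/-! ## Principal `ℂˣ`-bundles -/

variable (I)

/-- A smooth principal `ℂˣ`-bundle over a subset `S` of a manifold: a family of `ℂˣ`-torsors with an
open cover `U` of `S` and, for each member of the cover, a section of the family over it, any two of
which differ by a smooth transition function. The section `sec i` is written as a family on all
of `S`; its values outside `U i` play no role. The total space carries the unique smooth structure
for which the maps `U i × ℂˣ → Fib`, `(b, z) ↦ z • sec i b`, are local trivialisations. -/
structure CBundle (S : Set N) where
  /-- the fibres -/
  Fib : S → Type u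
  [torsor : ∀ b, Torsor ℂˣ (Fib b)]
  /-- the index set of the trivialising cover -/
  Idx : Type u
  /-- the trivialising cover -/
  U : Idx → Set S
  isOpen_U : ∀ i, IsOpen (U i)
  cover : ∀ b, ∃ i, b ∈ U i
  /-- the trivialising local sections -/
  sec : Idx → ∀ b, Fib b
  smooth_transition : ∀ i j b, b ∈ U i → b ∈ U j →
    SmoothAtOn I S (fun q => sec i q /ₛ sec j q) b

attribute [instance] CBundle.torsor

namespace CBundle

variable {I} {S : Set N}

/-- A smooth section of a `ℂˣ`-bundle. -/
@[ext]
structure Sect (L : CBundle I S) where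
  val : ∀ b, L.Fib b
  smooth : ∀ i b, b ∈ L.U i → SmoothAtOn I S (fun q => val q /ₛ L.sec i q) b

/-- A smooth isomorphism of `ℂˣ`-bundles covering the identity: a smooth `ℂˣ`-equivariant map. It is
bijective because the fibres are torsors. -/
@[ext]
structure Iso (L L' : CBundle I S) where
  map : ∀ b, L.Fib b → L'.Fib b
  map_smul : ∀ b (c : ℂˣ) l, map b (c • l) = c • map b l
  smooth : ∀ i j b, b ∈ L.U i → b ∈ L'.U j →
    SmoothAtOn I S (fun q => map q (L.sec i q) /ₛ L'.sec j q) b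

/-- The inverse bundle `L*`. -/
abbrev dual (L : CBundle I S) : CBundle I S where
  Fib b := DualTorsor (L.Fib b)
  Idx := L.Idx
  U := L.U
  isOpen_U := L.isOpen_U
  cover := L.cover
  sec i b := dstar (L.sec i b)
  smooth_transition i j b hi hj := L.smooth_transition j i b hj hi

/-- The contracted product `L ⊗ L'`. -/
abbrev tensor (L L' : CBundle I S) : CBundle I S where
  Fib b := TensorTorsor (L.Fib b) (L'.Fib b)
  Idx := L.Idx × L'.Idx
  U i := L.U i.1 ∩ L'.U i.2
  isOpen_U i := (L.isOpen_U i.1).inter (L'.isOpen_U i.2)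
  cover b := by
    obtain ⟨i, hi⟩ := L.cover b
    obtain ⟨j, hj⟩ := L'.cover b
    exact ⟨(i, j), hi, hj⟩
  sec i b := tmul (L.sec i.1 b) (L'.sec i.2 b)
  smooth_transition i j b hi hj :=
    (L.smooth_transition i.1 j.1 b hi.1 hj.1).mul (L'.smooth_transition i.2 j.2 b hi.2 hj.2)

variable {E' H' N' : Type u} [NormedAddCommGroup E'] [NormedSpace ℝ E'] [TopologicalSpace H']
  {I' : ModelWithCorners ℝ E' H'} [TopologicalSpace N'] [ChartedSpace H' N']

/-- The pullback of a `ℂˣ`-bundle along the map `S' → S` that is the restriction of a smooth map `K`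
of the ambient manifolds. -/
abbrev pullback (L : CBundle I S) (S' : Set N') (K : N' → N) (hK : ContMDiff I' I ∞ K)
    (hS : ∀ p ∈ S', K p ∈ S) : CBundle I' S' where
  Fib p := L.Fib ⟨K p, hS p p.2⟩
  Idx := L.Idx
  U i := {p | (⟨K p, hS p p.2⟩ : S) ∈ L.U i}
  isOpen_U i := (L.isOpen_U i).preimage (f := fun p : S' => (⟨K p, hS p p.2⟩ : S))
    ((hK.continuous.comp continuous_subtype_val).subtype_mk fun p => hS p p.2)
  cover p := L.cover ⟨K p, hS p p.2⟩
  sec i p := L.sec i ⟨K p, hS p p.2⟩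
  smooth_transition i j p hi hj := by
    obtain ⟨g, hg, hfg⟩ := L.smooth_transition i j _ hi hj
    have hc : Continuous fun q : S' => (⟨K q, hS q q.2⟩ : S) :=
      (hK.continuous.comp continuous_subtype_val).subtype_mk fun p => hS p p.2
    refine ⟨fun q => g (K q), ?_, ?_⟩
    · filter_upwards [hK.continuous.continuousAt.eventually hg] with q hq
      exact hq.comp q hK.contMDiffAt
    · exact hc.continuousAt.eventually hfg

end CBundle

end Bundles

/-! ## Bundle gerbes -/

noncomputable section Gerbes

variable (E M : Type u) [NormedAddCommGroup E] [NormedSpace ℝ E] [TopologicalSpace M]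
  [ChartedSpace E M]

/-- A smooth (Hausdorff, paracompact, possibly infinite-dimensional) manifold `X` with a smooth
surjection `π : X → M` that admits smooth local sections. -/
structure LocallySplit where
  X : Type u
  V : Type u
  [normedAddCommGroup : NormedAddCommGroup V]
  [normedSpace : NormedSpace ℝ V]
  [completeSpace : CompleteSpace V]
  [topologicalSpace : TopologicalSpace X]
  [t2Space : T2Space X]
  [paracompactSpace : ParacompactSpace X]
  [chartedSpace : ChartedSpace V X]
  [isManifold : IsManifold 𝓘(ℝ, V) ∞ X]
  π : X → M
  smooth_π : ContMDiff 𝓘(ℝ, V) 𝓘(ℝ, E) ∞ π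
  surjective_π : Function.Surjective π
  exists_localSection : ∀ m : M, ∃ (U : Set M) (σ : M → X), IsOpen U ∧ m ∈ U ∧
    ContMDiffOn 𝓘(ℝ, E) 𝓘(ℝ, V) ∞ σ U ∧ ∀ m' ∈ U, π (σ m') = m'

attribute [instance] LocallySplit.normedAddCommGroup LocallySplit.normedSpace
  LocallySplit.completeSpace LocallySplit.topologicalSpace LocallySplit.t2Space
  LocallySplit.paracompactSpace LocallySplit.chartedSpace LocallySplit.isManifold

variable {E M}

namespace LocallySplit

/-- The model with corners of `X`. -/
abbrev I (A : LocallySplit E M) : ModelWithCorners ℝ A.V A.V := 𝓘(ℝ, A.V)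

/-- The fibre product `X ×_M Y`. -/
def fp (A B : LocallySplit E M) : Set (A.X × B.X) := {p | A.π p.1 = B.π p.2}

/-- The triple fibre product `X^[3]`. -/
def fp3 (A : LocallySplit E M) : Set (A.X × A.X × A.X) :=
  {p | A.π p.1 = A.π p.2.1 ∧ A.π p.2.1 = A.π p.2.2}

/-- `(X ×_M Y)^[2]`, the set of pairs `((x₁, y₁), (x₂, y₂))` over one point of `M`. -/
def fpSq (A B : LocallySplit E M) : Set ((A.X × B.X) × (A.X × B.X)) :=
  {p | A.π p.1.1 = B.π p.1.2 ∧ A.π p.2.1 = B.π p.2.2 ∧ A.π p.1.1 = A.π p.2.1}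

/-- `X ×_M Z ×_M Y^[2]`, the set of quadruples `(x, z, y₁, y₂)` over one point of `M`. -/
def fpComp (A B C : LocallySplit E M) : Set (A.X × C.X × B.X × B.X) :=
  {p | A.π p.1 = B.π p.2.2.1 ∧ B.π p.2.2.1 = B.π p.2.2.2 ∧ B.π p.2.2.2 = C.π p.2.1}

end LocallySplit

variable (E M) in
/-- A bundle gerbe `(P, X, M)`: a `ℂˣ`-bundle `P` on `X^[2]` with an associative product
`P_(x₂, x₃) ⊗ P_(x₁, x₂) → P_(x₁, x₃)`. -/
structure BundleGerbe extends LocallySplit E M where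
  P : CBundle (toLocallySplit.I.prod toLocallySplit.I) (toLocallySplit.fp toLocallySplit)
  /-- the isomorphism `π₁⁻¹ P ⊗ π₃⁻¹ P → π₂⁻¹ P` over `X^[3]`, where `πᵢ` omits the `i`-th factor -/
  product : CBundle.Iso (I := toLocallySplit.I.prod (toLocallySplit.I.prod toLocallySplit.I))
    ((P.pullback toLocallySplit.fp3 (fun p => p.2) contMDiff_snd fun _ h => h.2).tensor
      (P.pullback toLocallySplit.fp3 (fun p => (p.1, p.2.1))
        (contMDiff_fst.prodMk (contMDiff_fst.comp contMDiff_snd)) fun _ h => h.1))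
    (P.pullback toLocallySplit.fp3 (fun p => (p.1, p.2.2))
        (contMDiff_fst.prodMk (contMDiff_snd.comp contMDiff_snd)) fun _ h => h.1.trans h.2)
  product_assoc : ∀ (x₁ x₂ x₃ x₄ : X) (h₁₂ : π x₁ = π x₂) (h₂₃ : π x₂ = π x₃) (h₃₄ : π x₃ = π x₄)
    (s : P.Fib ⟨(x₃, x₄), h₃₄⟩) (t : P.Fib ⟨(x₂, x₃), h₂₃⟩) (r : P.Fib ⟨(x₁, x₂), h₁₂⟩),
    product.map ⟨(x₁, x₂, x₄), h₁₂, h₂₃.trans h₃₄⟩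
        (tmul (product.map ⟨(x₂, x₃, x₄), h₂₃, h₃₄⟩ (tmul s t)) r) =
      product.map ⟨(x₁, x₃, x₄), h₁₂.trans h₂₃, h₃₄⟩
        (tmul s (product.map ⟨(x₁, x₂, x₃), h₁₂, h₂₃⟩ (tmul t r)))

namespace BundleGerbe

/-- The fibre `P_(x₁, x₂)`. -/
abbrev fib (G : BundleGerbe E M) {x₁ x₂ : G.X} (h : G.π x₁ = G.π x₂) : Type u :=
  G.P.Fib ⟨(x₁, x₂), h⟩

/-- The product `P_(x₂, x₃) ⊗ P_(x₁, x₂) → P_(x₁, x₃)` on elements. -/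
def mul (G : BundleGerbe E M) {x₁ x₂ x₃ : G.X} {h₁₂ : G.π x₁ = G.π x₂} {h₂₃ : G.π x₂ = G.π x₃}
    (s : G.fib h₂₃) (t : G.fib h₁₂) : G.fib (h₁₂.trans h₂₃) :=
  G.product.map ⟨(x₁, x₂, x₃), h₁₂, h₂₃⟩ (tmul s t)

end BundleGerbe

/-! ## Stable morphisms and transformations -/

/-- `δ(L)` over `(X ×_M Y)^[2]`, with fibre `L_(x₂, y₂) ⊗ L_(x₁, y₁)*` at
`((x₁, y₁), (x₂, y₂))`. -/
abbrev delta {A B : LocallySplit E M} (L : CBundle (A.I.prod B.I) (A.fp B)) :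
    CBundle ((A.I.prod B.I).prod (A.I.prod B.I)) (A.fpSq B) :=
  (L.pullback (A.fpSq B) (fun p => p.2) contMDiff_snd fun _ h => h.2.1).tensor
    (L.pullback (A.fpSq B) (fun p => p.1) contMDiff_fst fun _ h => h.1).dual

/-- The `ℂˣ`-bundle `P* ⊗ Q` over `(X ×_M Y)^[2]`, with fibre `P_(x₁, x₂)* ⊗ Q_(y₁, y₂)` at
`((x₁, y₁), (x₂, y₂))`. -/
abbrev dualTensor (G K : BundleGerbe E M) :
    CBundle ((G.I.prod K.I).prod (G.I.prod K.I)) (G.fpSq K.toLocallySplit) :=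
  (G.P.pullback (G.fpSq K.toLocallySplit) (fun p => (p.1.1, p.2.1))
      ((contMDiff_fst.comp contMDiff_fst).prodMk (contMDiff_fst.comp contMDiff_snd))
      fun _ h => h.2.2).dual.tensor
    (K.P.pullback (G.fpSq K.toLocallySplit) (fun p => (p.1.2, p.2.2))
      ((contMDiff_snd.comp contMDiff_fst).prodMk (contMDiff_snd.comp contMDiff_snd))
      fun _ h => h.1.symm.trans (h.2.2.trans h.2.1))

/-- A stable morphism `P → Q`: a trivialisation `(L, φ)` of the bundle gerbe `P* ⊗ Q`, that is, a
`ℂˣ`-bundle `L` on `X ×_M Y` with an isomorphism `φ : δ(L) → P* ⊗ Q` that commutes with the bundle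
gerbe products. The product of `δ(L)` sends `(l₃ ⊗ l₂*) ⊗ (l₂ ⊗ l₁*)` to `l₃ ⊗ l₁*`; the product of
`P* ⊗ Q` sends `(p* ⊗ q) ⊗ (p'* ⊗ q')` to `(p p')* ⊗ (q q')`. -/
structure StableMorphism (G K : BundleGerbe E M) where
  L : CBundle (G.I.prod K.I) (G.fp K.toLocallySplit)
  φ : CBundle.Iso (delta L) (dualTensor G K)
  φ_mul : ∀ (x₁ x₂ x₃ : G.X) (y₁ y₂ y₃ : K.X) (h₁ : G.π x₁ = K.π y₁) (h₂ : G.π x₂ = K.π y₂)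
    (h₃ : G.π x₃ = K.π y₃) (hx₁₂ : G.π x₁ = G.π x₂) (hx₂₃ : G.π x₂ = G.π x₃)
    (hy₁₂ : K.π y₁ = K.π y₂) (hy₂₃ : K.π y₂ = K.π y₃)
    (l₁ : L.Fib ⟨(x₁, y₁), h₁⟩) (l₂ : L.Fib ⟨(x₂, y₂), h₂⟩) (l₃ : L.Fib ⟨(x₃, y₃), h₃⟩)
    (p : G.fib hx₂₃) (p' : G.fib hx₁₂) (q : K.fib hy₂₃) (q' : K.fib hy₁₂),
    φ.map ⟨((x₂, y₂), (x₃, y₃)), h₂, h₃, hx₂₃⟩ (tmul l₃ (dstar l₂)) = tmul (dstar p) q →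
    φ.map ⟨((x₁, y₁), (x₂, y₂)), h₁, h₂, hx₁₂⟩ (tmul l₂ (dstar l₁)) = tmul (dstar p') q' →
    φ.map ⟨((x₁, y₁), (x₃, y₃)), h₁, h₃, hx₁₂.trans hx₂₃⟩ (tmul l₃ (dstar l₁)) =
      tmul (dstar (G.mul p p')) (K.mul q q')

namespace StableMorphism

variable {G K : BundleGerbe E M}

/-- The fibre `L_(x, y)`. -/
abbrev fib (f : StableMorphism G K) {x : G.X} {y : K.X} (h : G.π x = K.π y) : Type u :=
  f.L.Fib ⟨(x, y), h⟩

/-- The value `φ(l₂ ⊗ l₁*)` in `P_(x₁, x₂)* ⊗ Q_(y₁, y₂)`. -/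
def phi (f : StableMorphism G K) {x₁ x₂ : G.X} {y₁ y₂ : K.X} {h₁ : G.π x₁ = K.π y₁}
    {h₂ : G.π x₂ = K.π y₂} (hx : G.π x₁ = G.π x₂) (l₂ : f.fib h₂) (l₁ : f.fib h₁) :
    TensorTorsor (DualTorsor (G.fib hx)) (K.fib (h₁.symm.trans (hx.trans h₂))) :=
  f.φ.map ⟨((x₁, y₁), (x₂, y₂)), h₁, h₂, hx⟩ (tmul l₂ (dstar l₁))

/-- A transformation `f ⇒ g`: a smooth section `θ` of `L_f* ⊗ L_g` with `δ(θ) = φ̂_(f,g)`, where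
`φ̂_(f,g)` is the section of `δ(L_f* ⊗ L_g)` that corresponds to the isomorphism
`φ_g⁻¹ ∘ φ_f : δ(L_f) → δ(L_g)`. If `θ = l₁* ⊗ k₁` at the first point and `θ = l₂* ⊗ k₂` at the
second, the equation says that this isomorphism sends `l₂ ⊗ l₁*` to `k₂ ⊗ k₁*`. -/
@[ext]
structure Transformation (f g : StableMorphism G K) where
  θ : (f.L.dual.tensor g.L).Sect
  compat : ∀ (x₁ x₂ : G.X) (y₁ y₂ : K.X) (h₁ : G.π x₁ = K.π y₁) (h₂ : G.π x₂ = K.π y₂)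
    (hx : G.π x₁ = G.π x₂) (l₁ : f.fib h₁) (l₂ : f.fib h₂) (k₁ : g.fib h₁) (k₂ : g.fib h₂),
    θ.val ⟨(x₁, y₁), h₁⟩ = tmul (dstar l₁) k₁ → θ.val ⟨(x₂, y₂), h₂⟩ = tmul (dstar l₂) k₂ →
    f.phi hx l₂ l₁ = g.phi hx k₂ k₁

/-- The identity transformation, with value `l* ⊗ l`. -/
def Transformation.id (f : StableMorphism G K) : Transformation f f where
  θ :=
    { val := fun b => coev (f.L.Fib b)
      smooth := by
        rintro ⟨i, j⟩ b ⟨hi, hj⟩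
        refine (f.L.smooth_transition i j b hi hj).congr fun q => ?_
        change _ = coev (f.L.Fib q) /ₛ tmul (dstar (f.L.sec i q)) (f.L.sec j q)
        rw [coev_eq (f.L.sec i q), tmul_sdiv_tmul, sdiv_self, one_mul] }
  compat x₁ x₂ y₁ y₂ h₁ h₂ hx l₁ l₂ k₁ k₂ e₁ e₂ := by
    replace e₁ : coev (f.fib h₁) = tmul (dstar l₁) k₁ := e₁
    replace e₂ : coev (f.fib h₂) = tmul (dstar l₂) k₂ := e₂
    rw [coev_eq l₁] at e₁
    rw [coev_eq l₂] at e₂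
    rw [tmul_left_cancel e₁, tmul_left_cancel e₂]

/-- The composite transformation, given by contraction
`L_f* ⊗ L_g ⊗ L_g* ⊗ L_h → L_f* ⊗ L_h`. -/
def Transformation.comp {f g h : StableMorphism G K} (s : Transformation f g)
    (t : Transformation g h) : Transformation f h where
  θ :=
    { val := fun b => contract (s.θ.val b) (t.θ.val b)
      smooth := by
        rintro ⟨i, j⟩ b ⟨hi, hj⟩
        obtain ⟨k, hk⟩ := g.L.cover b
        refine ((s.θ.smooth (i, k) b ⟨hi, hk⟩).mul (t.θ.smooth (k, j) b ⟨hk, hj⟩)).congr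
          fun q => ?_
        obtain ⟨a, ha⟩ := exists_right (s.θ.val q) (dstar (f.L.sec i q))
        obtain ⟨c, hc⟩ := exists_right (t.θ.val q) (dstar a)
        rw [ha, hc, contract_tmul]
        change (dstar (f.L.sec i q) /ₛ dstar (f.L.sec i q)) * (a /ₛ g.L.sec k q) *
            ((dstar a /ₛ dstar (g.L.sec k q)) * (c /ₛ h.L.sec j q)) =
          (dstar (f.L.sec i q) /ₛ dstar (f.L.sec i q)) * (c /ₛ h.L.sec j q)
        rw [sdiv_self, one_mul, one_mul, dstar_sdiv_dstar, ← mul_assoc, sdiv_mul_sdiv_cancel,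
          sdiv_self, one_mul] }
  compat x₁ x₂ y₁ y₂ h₁ h₂ hx l₁ l₂ k₁ k₂ e₁ e₂ := by
    obtain ⟨a₁, ha₁⟩ := exists_right (s.θ.val ⟨(x₁, y₁), h₁⟩) (dstar l₁)
    obtain ⟨c₁, hc₁⟩ := exists_right (t.θ.val ⟨(x₁, y₁), h₁⟩) (dstar a₁)
    obtain ⟨a₂, ha₂⟩ := exists_right (s.θ.val ⟨(x₂, y₂), h₂⟩) (dstar l₂)
    obtain ⟨c₂, hc₂⟩ := exists_right (t.θ.val ⟨(x₂, y₂), h₂⟩) (dstar a₂)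
    replace e₁ : contract (s.θ.val ⟨(x₁, y₁), h₁⟩) (t.θ.val ⟨(x₁, y₁), h₁⟩) = _ := e₁
    replace e₂ : contract (s.θ.val ⟨(x₂, y₂), h₂⟩) (t.θ.val ⟨(x₂, y₂), h₂⟩) = _ := e₂
    rw [ha₁, hc₁, contract_tmul] at e₁
    rw [ha₂, hc₂, contract_tmul] at e₂
    obtain rfl := tmul_left_cancel e₁
    obtain rfl := tmul_left_cancel e₂
    exact (s.compat _ _ _ _ _ _ hx _ _ _ _ ha₁ ha₂).trans
      (t.compat _ _ _ _ _ _ hx _ _ _ _ hc₁ hc₂)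

/-- The category `Hom_s(P, Q)` of stable morphisms and transformations. -/
instance : Category (StableMorphism G K) where
  Hom := Transformation
  id := Transformation.id
  comp := Transformation.comp
  id_comp {f g} s := by
    refine Transformation.ext (CBundle.Sect.ext (funext fun b => ?_))
    obtain ⟨l, k, h⟩ := exists_tmul (s.θ.val b)
    change contract (coev (f.L.Fib b)) (s.θ.val b) = s.θ.val b
    rw [h, coev_eq l.undstar]
    exact contract_tmul l l.undstar k
  comp_id {f g} s := by
    refine Transformation.ext (CBundle.Sect.ext (funext fun b => ?_))
    obtain ⟨l, k, h⟩ := exists_tmul (s.θ.val b)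
    change contract (s.θ.val b) (coev (g.L.Fib b)) = s.θ.val b
    rw [h, coev_eq k]
    exact contract_tmul l k k
  assoc {f g h k} s t r := by
    refine Transformation.ext (CBundle.Sect.ext (funext fun b => ?_))
    obtain ⟨l, a, ha⟩ := exists_tmul (s.θ.val b)
    obtain ⟨c, hc⟩ := exists_right (t.θ.val b) (dstar a)
    obtain ⟨d, hd⟩ := exists_right (r.θ.val b) (dstar c)
    change contract (contract (s.θ.val b) (t.θ.val b)) (r.θ.val b) =
      contract (s.θ.val b) (contract (t.θ.val b) (r.θ.val b))
    rw [ha, hc, hd, contract_tmul, contract_tmul, contract_tmul, contract_tmul]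

/-- The value of a transformation `f ⇒ g` in `L_f(x, y)* ⊗ L_g(x, y)`. -/
def value {f g : StableMorphism G K} (s : f ⟶ g) {x : G.X} {y : K.X} (h : G.π x = K.π y) :
    TensorTorsor (DualTorsor (f.fib h)) (g.fib h) :=
  Transformation.θ s |>.val ⟨(x, y), h⟩

end StableMorphism

/-! ## Composites of stable morphisms and identity stable morphisms -/

section Composition

variable {G K R : BundleGerbe E M}

/-- The `ℂˣ`-bundle on `X ×_M Z ×_M Y^[2]` with fibre `L_f(x, y₁) ⊗ L_g(y₂, z) ⊗ Q(y₁, y₂)` at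
`(x, z, y₁, y₂)`. -/
abbrev compBundle (f : StableMorphism G K) (g : StableMorphism K R) :
    CBundle (G.I.prod (R.I.prod (K.I.prod K.I))) (G.fpComp K.toLocallySplit R.toLocallySplit) :=
  ((f.L.pullback (G.fpComp K.toLocallySplit R.toLocallySplit) (fun p => (p.1, p.2.2.1))
      (contMDiff_fst.prodMk (contMDiff_fst.comp (contMDiff_snd.comp contMDiff_snd)))
      fun _ h => h.1).tensor
    (g.L.pullback (G.fpComp K.toLocallySplit R.toLocallySplit) (fun p => (p.2.2.2, p.2.1))
      ((contMDiff_snd.comp (contMDiff_snd.comp contMDiff_snd)).prodMk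
        (contMDiff_fst.comp contMDiff_snd))
      fun _ h => h.2.2)).tensor
    (K.P.pullback (G.fpComp K.toLocallySplit R.toLocallySplit) (fun p => (p.2.2.1, p.2.2.2))
      ((contMDiff_fst.comp (contMDiff_snd.comp contMDiff_snd)).prodMk
        (contMDiff_snd.comp (contMDiff_snd.comp contMDiff_snd)))
      fun _ h => h.2.1)

/-- The pullback to `X ×_M Z ×_M Y^[2]` of the bundle `L_k` on `X ×_M Z`. -/
abbrev compTarget (K : BundleGerbe E M) (k : StableMorphism G R) :
    CBundle (G.I.prod (R.I.prod (K.I.prod K.I))) (G.fpComp K.toLocallySplit R.toLocallySplit) :=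
  k.L.pullback (G.fpComp K.toLocallySplit R.toLocallySplit) (fun p => (p.1, p.2.1))
    (contMDiff_fst.prodMk (contMDiff_fst.comp contMDiff_snd))
    fun _ h => h.1.trans (h.2.1.trans h.2.2)

/-- The image in `L_k(x, z)` of the element `a ⊗ b ⊗ q` of
`L_f(x, y₁) ⊗ L_g(y₂, z) ⊗ Q(y₁, y₂)`. -/
def glue {f : StableMorphism G K} {g : StableMorphism K R} {k : StableMorphism G R}
    (κ : CBundle.Iso (compBundle f g) (compTarget K k)) {x : G.X} {y₁ y₂ : K.X} {z : R.X}
    {h₁ : G.π x = K.π y₁} {h₂ : K.π y₁ = K.π y₂} {h₃ : K.π y₂ = R.π z}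
    (a : f.fib h₁) (b : g.fib h₃) (q : K.fib h₂) : k.fib (h₁.trans (h₂.trans h₃)) :=
  κ.map ⟨(x, z, y₁, y₂), h₁, h₂, h₃⟩ (tmul (tmul a b) q)

/-- `Composite f g k` exhibits the stable morphism `k : P → R` as the composite `g ∘ f` of
`f : P → Q` and `g : Q → R`: an isomorphism `κ` from `L_f(x, y₁) ⊗ L_g(y₂, z) ⊗ Q(y₁, y₂)` to the
pullback of `L_k`, such that `φ_k` is the isomorphism induced on `δ(L_k)` by
`L_f(x', y₁') ⊗ L_g(y₂', z') ⊗ Q(y₁', y₂') ⊗ (L_f(x, y₁) ⊗ L_g(y₂, z) ⊗ Q(y₁, y₂))*`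
`≃ P(x, x')* ⊗ Q(y₁, y₁') ⊗ Q(y₂, y₂')* ⊗ R(z, z') ⊗ Q(y₁', y₂') ⊗ Q(y₁, y₂)*`
`≃ P(x, x')* ⊗ R(z, z')`,
where the first step is `φ_f ⊗ φ_g` and the second one is the bundle gerbe product of `Q`. The case
`x = x'`, `z = z'` says that `κ` is compatible with the descent isomorphism
`L_f(x, y₁) ⊗ L_g(y₂, z) ⊗ Q(y₁, y₂) → L_f(x, y₁') ⊗ L_g(y₂', z) ⊗ Q(y₁', y₂')`, so that `L_k` is
the descended bundle. -/
structure Composite (f : StableMorphism G K) (g : StableMorphism K R)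
    (k : StableMorphism G R) where
  κ : CBundle.Iso (compBundle f g) (compTarget K k)
  phi_glue : ∀ (x x' : G.X) (y₁ y₂ y₁' y₂' : K.X) (z z' : R.X)
    (h₁ : G.π x = K.π y₁) (h₂ : K.π y₁ = K.π y₂) (h₃ : K.π y₂ = R.π z)
    (h₁' : G.π x' = K.π y₁') (h₂' : K.π y₁' = K.π y₂') (h₃' : K.π y₂' = R.π z')
    (hx : G.π x = G.π x') (hy₁ : K.π y₁ = K.π y₁') (hy₂ : K.π y₂ = K.π y₂') (hz : R.π z = R.π z')
    (a : f.fib h₁) (b : g.fib h₃) (q : K.fib h₂)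
    (a' : f.fib h₁') (b' : g.fib h₃') (q' : K.fib h₂')
    (p : G.fib hx) (s : K.fib hy₁) (t : K.fib hy₂) (r : R.fib hz),
    f.phi hx a' a = tmul (dstar p) s → g.phi hy₂ b' b = tmul (dstar t) r →
    K.mul q' s = K.mul t q →
    k.phi hx (glue κ a' b' q') (glue κ a b q) = tmul (dstar p) r

/-- `IdentityOn G k` exhibits the stable morphism `k : P → P` as the one induced by the identity of
`P`, whose bundle on `X ×_M X = X^[2]` is `P` itself with the isomorphism
`P(x₂, y₂) ⊗ P(x₁, y₁)* ≃ P(x₁, x₂)* ⊗ P(y₁, y₂)` given by the bundle gerbe product. -/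
structure IdentityOn (G : BundleGerbe E M) (k : StableMorphism G G) where
  ι : CBundle.Iso G.P k.L
  phi_ι : ∀ (x₁ x₂ y₁ y₂ : G.X) (h₁ : G.π x₁ = G.π y₁) (h₂ : G.π x₂ = G.π y₂)
    (hx : G.π x₁ = G.π x₂) (hy : G.π y₁ = G.π y₂)
    (u₁ : G.fib h₁) (u₂ : G.fib h₂) (p : G.fib hx) (q : G.fib hy),
    G.mul u₂ p = G.mul q u₁ →
    k.phi hx (ι.map ⟨(x₂, y₂), h₂⟩ u₂) (ι.map ⟨(x₁, y₁), h₁⟩ u₁) = tmul (dstar p) q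

end Composition

end Gerbes

/-! ## The bicategory structure on bundle gerbes and stable morphisms -/

section StableBicategory

variable {E M : Type u} [NormedAddCommGroup E] [NormedSpace ℝ E] [TopologicalSpace M]
  [ChartedSpace E M]

/-- The operations of a bicategory on bundle gerbes, stable morphisms and transformations are the
ones of the theory of bundle gerbes: composites and identities of stable morphisms are as in
`Composite` and `IdentityOn`, and under the isomorphisms given there the horizontal compositions
and the structural 2-arrows are the evident ones. -/
structure StableOperations (𝔅 : BicategoryOn (StableMorphism (E := E) (M := M))) where
  composite {G K R : BundleGerbe E M} (f : StableMorphism G K) (g : StableMorphism K R) :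
    Composite f g (𝔅.comp f g)
  identity (G : BundleGerbe E M) : IdentityOn G (𝔅.id G)
  /-- `a ⊗ b ⊗ q ↦ a ⊗ ρ(b) ⊗ q` -/
  whiskerLeft_value {G K R : BundleGerbe E M} (f : StableMorphism G K) (g g' : StableMorphism K R)
    (ρ : g ⟶ g') (x : G.X) (y₁ y₂ : K.X) (z : R.X)
    (h₁ : G.π x = K.π y₁) (h₂ : K.π y₁ = K.π y₂) (h₃ : K.π y₂ = R.π z)
    (a : f.fib h₁) (b : g.fib h₃) (b' : g'.fib h₃) (q : K.fib h₂) :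
    StableMorphism.value ρ h₃ = tmul (dstar b) b' →
    StableMorphism.value (𝔅.whiskerLeft f ρ) (h₁.trans (h₂.trans h₃)) =
      tmul (dstar (glue (composite f g).κ a b q)) (glue (composite f g').κ a b' q)
  /-- `a ⊗ b ⊗ q ↦ θ(a) ⊗ b ⊗ q` -/
  whiskerRight_value {G K R : BundleGerbe E M} (f f' : StableMorphism G K) (g : StableMorphism K R)
    (θ : f ⟶ f') (x : G.X) (y₁ y₂ : K.X) (z : R.X)
    (h₁ : G.π x = K.π y₁) (h₂ : K.π y₁ = K.π y₂) (h₃ : K.π y₂ = R.π z)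
    (a : f.fib h₁) (a' : f'.fib h₁) (b : g.fib h₃) (q : K.fib h₂) :
    StableMorphism.value θ h₁ = tmul (dstar a) a' →
    StableMorphism.value (𝔅.whiskerRight θ g) (h₁.trans (h₂.trans h₃)) =
      tmul (dstar (glue (composite f g).κ a b q)) (glue (composite f' g).κ a' b q)
  /-- `(a ⊗ b ⊗ q) ⊗ c ⊗ r ↦ a ⊗ (b ⊗ c ⊗ r) ⊗ q` -/
  associator_value {G K R T : BundleGerbe E M} (f : StableMorphism G K) (g : StableMorphism K R)
    (h : StableMorphism R T) (x : G.X) (y₁ y₂ : K.X) (z₁ z₂ : R.X) (t : T.X)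
    (h₁ : G.π x = K.π y₁) (h₂ : K.π y₁ = K.π y₂) (h₃ : K.π y₂ = R.π z₁) (h₄ : R.π z₁ = R.π z₂)
    (h₅ : R.π z₂ = T.π t)
    (a : f.fib h₁) (b : g.fib h₃) (c : h.fib h₅) (q : K.fib h₂) (r : R.fib h₄) :
    StableMorphism.value (𝔅.associator f g h).hom
        (h₁.trans (h₂.trans (h₃.trans (h₄.trans h₅)))) =
      tmul (dstar (glue (composite (𝔅.comp f g) h).κ (glue (composite f g).κ a b q) c r))
        (glue (composite f (𝔅.comp g h)).κ a (glue (composite g h).κ b c r) q)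
  /-- `u ⊗ b ⊗ q ↦ a`, where `a ∈ L_f(x, y)` is the image of `b ∈ L_f(x₂, y)` and of
  `q u ∈ P(x, x₂)` under `L_f(x₂, y) ⊗ P(x, x₂) ≃ Q(y, y) ⊗ L_f(x, y) ≃ L_f(x, y)` -/
  leftUnitor_value {G K : BundleGerbe E M} (f : StableMorphism G K) (x x₁ x₂ : G.X) (y : K.X)
    (h₁ : G.π x = G.π x₁) (h₂ : G.π x₁ = G.π x₂) (h₃ : G.π x₂ = K.π y)
    (u : G.fib h₁) (b : f.fib h₃) (q : G.fib h₂) (a : f.fib (h₁.trans (h₂.trans h₃)))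
    (e : K.fib (rfl : K.π y = K.π y)) :
    K.mul e e = e → f.phi (h₁.trans h₂) b a = tmul (dstar (G.mul q u)) e →
    StableMorphism.value (𝔅.leftUnitor f).hom (h₁.trans (h₂.trans h₃)) =
      tmul (dstar (glue (composite (𝔅.id G) f).κ ((identity G).ι.map ⟨(x, x₁), h₁⟩ u) b q)) a
  /-- `a ⊗ v ⊗ q ↦ a'`, where `a' ∈ L_f(x, y)` is the image of `a ∈ L_f(x, y₁)` and of
  `v q ∈ Q(y₁, y)` under `Q(y₁, y) ⊗ L_f(x, y₁) ≃ L_f(x, y) ⊗ P(x, x) ≃ L_f(x, y)` -/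
  rightUnitor_value {G K : BundleGerbe E M} (f : StableMorphism G K) (x : G.X) (y₁ y₂ y : K.X)
    (h₁ : G.π x = K.π y₁) (h₂ : K.π y₁ = K.π y₂) (h₃ : K.π y₂ = K.π y)
    (a : f.fib h₁) (v : K.fib h₃) (q : K.fib h₂) (a' : f.fib (h₁.trans (h₂.trans h₃)))
    (e : G.fib (rfl : G.π x = G.π x)) :
    G.mul e e = e → f.phi rfl a' a = tmul (dstar e) (K.mul v q) →
    StableMorphism.value (𝔅.rightUnitor f).hom (h₁.trans (h₂.trans h₃)) =
      tmul (dstar (glue (composite f (𝔅.id K)).κ a ((identity K).ι.map ⟨(y₂, y), h₃⟩ v) q)) a'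

end StableBicategory

/-! ## Torsors and maps out of a contracted product -/

/-! A bundle gerbe `P` is a groupoid with objects the points of `X` and a `ℂˣ`-torsor of arrows
between any two points over the same point of `M`: associativity and the torsor property already
force units and inverses. A stable morphism `P → Q` is then a bundle on `X ×_M Y` with commuting
actions of `Q` from the left and of `P` from the right, because `φ(l₂ ⊗ l₁*) = p* ⊗ q` says exactly
that `l₂ p = q l₁` (`phi_eq_iff`; `Bimodule.toStableMorphism` goes back). Transformations are the
smooth bundle maps that commute with both actions (`app_lact`, `app_ract`, `ofIso`). Such maps are
bijective on the fibres, which are torsors, so all 2-arrows are invertible (`isIso`).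

The composite is the balanced tensor product of `L_f` and `L_g` over `Q`, generated by `a ⊗ c` with
`a ∈ L_f(x, y)` and `c ∈ L_g(y, z)`, subject to `(q a) ⊗ c = a ⊗ (c q)`. A single middle point `y`
suffices for the fibre at `(x, z)`, since the arrows of `Q` transport between middle points
(`pair_lact`); local sections of `Y → M` make these fibres a smooth bundle (`compL`). A
transformation out of the composite is constructed from a balanced map (`Balanced.desc`) and
determined by its values on the `a ⊗ c` (`comp_hom_ext`). The bicategory axioms thus become
computations with elements, in which the associator rebrackets and the unitors are the actions.

The inverse of `f` is the dual bundle with the actions turned around by inversion. The 2-arrows to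
the identities are `a ⊗ l* ↦ p` with `l p = a` and `l* ⊗ c ↦ q` with `q l = c`; they are coherent
because `c p = q l p = q a` (`inverse_coherence`).

Most operations are characterised by equations, and their smoothness follows from two facts on
equivariant maps of torsors: one that preserves smooth sections also reflects them
(`SmoothAlong.of_map`), and one that preserves a single smooth section preserves all
(`SmoothAlong.map_of_exists`). -/

theorem eq_one_of_smul_eq_self {A : Type u} [Torsor ℂˣ A] {c : ℂˣ} {a : A} (h : c • a = a) :
    c = 1 := by
  rw [← smul_sdiv c a, h, sdiv_self]

/-- An equivariant map of torsors is injective. -/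
theorem eq_of_equivariant {A B : Type u} [Torsor ℂˣ A] [Torsor ℂˣ B] {Φ : A → B}
    (hΦ : ∀ (c : ℂˣ) a, Φ (c • a) = c • Φ a) {a a' : A} (h : Φ a = Φ a') : a = a' := by
  rw [← sdiv_smul a a', hΦ] at h
  rw [← sdiv_smul a a', eq_one_of_smul_eq_self h, one_smul]

/-- An equivariant map of torsors is surjective. -/
theorem exists_of_equivariant {A B : Type u} [Torsor ℂˣ A] [Torsor ℂˣ B] {Φ : A → B}
    (hΦ : ∀ (c : ℂˣ) a, Φ (c • a) = c • Φ a) (t : B) : ∃ a, Φ a = t :=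
  ⟨(t /ₛ Φ (Classical.arbitrary A)) • Classical.arbitrary A, by rw [hΦ, sdiv_smul]⟩

namespace TensorTorsor

variable {A B : Type u} [Torsor ℂˣ A] [Torsor ℂˣ B] {C : Type v}

/-- The map out of `A ⊗ B` given by a balanced map on `A × B`. -/
def lift (F : A → B → C) (hF : ∀ (c : ℂˣ) a b, F (c • a) b = F a (c • b)) :
    TensorTorsor A B → C :=
  Quotient.lift (s := tensorSetoid A B) (fun p => F p.1 p.2) (by
    rintro ⟨a, b⟩ ⟨a', b'⟩ ⟨c, h1, h2⟩
    simp only at h1 h2 ⊢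
    rw [h1, h2, hF, smul_inv_smul])

theorem lift_tmul (F : A → B → C) (hF : ∀ (c : ℂˣ) a b, F (c • a) b = F a (c • b))
    (a : A) (b : B) : lift F hF (tmul a b) = F a b := rfl

theorem smul_tmul_right (c : ℂˣ) (a : A) (b : B) : c • tmul a b = tmul a (c • b) := by
  rw [smul_tmul, smul_tmul_eq]

end TensorTorsor

/-! ## Smooth maps and smooth sections along maps -/

noncomputable section SmoothSections

variable {E H N E' H' N' E'' H'' N'' : Type u}
  [NormedAddCommGroup E] [NormedSpace ℝ E] [TopologicalSpace H]
  {I : ModelWithCorners ℝ E H} [TopologicalSpace N] [ChartedSpace H N]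
  [NormedAddCommGroup E'] [NormedSpace ℝ E'] [TopologicalSpace H']
  {J : ModelWithCorners ℝ E' H'} [TopologicalSpace N'] [ChartedSpace H' N']
  [NormedAddCommGroup E''] [NormedSpace ℝ E''] [TopologicalSpace H'']
  {I' : ModelWithCorners ℝ E'' H''} [TopologicalSpace N''] [ChartedSpace H'' N'']
  {T : Set N'} {p : T}

/-- A map from a subset `T` of a manifold to a manifold is smooth at `p` if near `p` it is the
restriction of a smooth map of the ambient manifold. -/
def SmoothMapAt (J : ModelWithCorners ℝ E' H') (I : ModelWithCorners ℝ E H) (k : T → N) (p : T) :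
    Prop :=
  ∃ K : N' → N, (∀ᶠ q in 𝓝 (p : N'), ContMDiffAt J I ∞ K q) ∧ ∀ᶠ q in 𝓝 p, k q = K q

theorem SmoothMapAt.val : SmoothMapAt J J (fun q : T => (q : N')) p :=
  ⟨id, .of_forall fun _ => contMDiffAt_id, .of_forall fun _ => rfl⟩

theorem SmoothMapAt.continuousAt {k : T → N} (hk : SmoothMapAt J I k p) : ContinuousAt k p := by
  obtain ⟨K, hK, e⟩ := hk
  exact (hK.self_of_nhds.continuousAt.comp (f := ((↑) : T → N'))
    continuousAt_subtype_val).congr (e.mono fun _ h => h.symm)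

theorem SmoothMapAt.comp {k : T → N} {F : N → N''}
    (hF : ∀ᶠ q in 𝓝 (k p), ContMDiffAt I I' ∞ F q) (hk : SmoothMapAt J I k p) :
    SmoothMapAt J I' (fun q => F (k q)) p := by
  obtain ⟨K, hK, e⟩ := hk
  refine ⟨fun q => F (K q), ?_, e.mono fun q h => congrArg F h⟩
  rw [e.self_of_nhds] at hF
  filter_upwards [hK, hK.self_of_nhds.continuousAt.eventually hF] with q h1 h2
  exact h2.comp q h1

theorem SmoothMapAt.comp_contMDiff {k : T → N} {F : N → N''} (hF : ContMDiff I I' ∞ F)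
    (hk : SmoothMapAt J I k p) : SmoothMapAt J I' (fun q => F (k q)) p :=
  hk.comp (.of_forall fun _ => hF.contMDiffAt)

theorem SmoothMapAt.prodMk {k : T → N} {k' : T → N''} (hk : SmoothMapAt J I k p)
    (hk' : SmoothMapAt J I' k' p) : SmoothMapAt J (I.prod I') (fun q => (k q, k' q)) p := by
  obtain ⟨K, hK, e⟩ := hk
  obtain ⟨K', hK', e'⟩ := hk'
  refine ⟨fun q => (K q, K' q), ?_, ?_⟩
  · filter_upwards [hK, hK'] with q h1 h2 using h1.prodMk h2
  · filter_upwards [e, e'] with q h1 h2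
    rw [h1, h2]

theorem SmoothMapAt.fst {k : T → N × N''} (hk : SmoothMapAt J (I.prod I') k p) :
    SmoothMapAt J I (fun q => (k q).1) p :=
  hk.comp_contMDiff contMDiff_fst

theorem SmoothMapAt.snd {k : T → N × N''} (hk : SmoothMapAt J (I.prod I') k p) :
    SmoothMapAt J I' (fun q => (k q).2) p :=
  hk.comp_contMDiff contMDiff_snd

/-- The ambient extensions compose. Since `f` agrees with its extension only on `S` near `k p`,
continuity of `k` into the subspace `S` is needed as well. -/
theorem SmoothAtOn.comp {S : Set N} {k : T → S} {f : S → ℂˣ} (hf : SmoothAtOn I S f (k p))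
    (hk : SmoothMapAt J I (fun q => (k q : N)) p) : SmoothAtOn J T (fun q => f (k q)) p := by
  have hc : ContinuousAt k p := Topology.IsInducing.subtypeVal.continuousAt_iff.2 hk.continuousAt
  obtain ⟨g, hg, hfg⟩ := hf
  obtain ⟨K, hK, e⟩ := hk
  refine ⟨fun q => g (K q), ?_, ?_⟩
  · replace hg : ∀ᶠ q in 𝓝 (K p), ContMDiffAt I 𝓘(ℝ, ℂ) ∞ g q := e.self_of_nhds ▸ hg
    filter_upwards [hK, hK.self_of_nhds.continuousAt.eventually hg] with q h1 h2
    exact h2.comp q h1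
  · filter_upwards [e, hc.eventually hfg] with q h1 h2
    rw [h2, ← h1]

theorem SmoothAtOn.inv {f : T → ℂˣ} (hf : SmoothAtOn J T f p) :
    SmoothAtOn J T (fun q => (f q)⁻¹) p := by
  obtain ⟨g, hg, hfg⟩ := hf
  have h0 : g p ≠ 0 := hfg.self_of_nhds ▸ (f p).ne_zero
  refine ⟨fun q => (g q)⁻¹, ?_, hfg.mono fun q h => by rw [Units.val_inv_eq_inv_val, h]⟩
  filter_upwards [hg, hg.self_of_nhds.continuousAt.eventually_ne h0] with q h1 h2
  exact (contDiffAt_inv ℝ h2).contMDiffAt.comp q h1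

theorem SmoothAtOn.div {f f' : T → ℂˣ} (hf : SmoothAtOn J T f p) (hf' : SmoothAtOn J T f' p) :
    SmoothAtOn J T (fun q => f q / f' q) p :=
  (hf.mul hf'.inv).congr fun _ => (div_eq_mul_inv _ _).symm

/-- The section `s` of the bundle `L` along the map `k`, which is smooth at `p`, is smooth at `p`. -/
structure SmoothAlong {S : Set N} (J : ModelWithCorners ℝ E' H') (L : CBundle I S) (k : T → S)
    (s : ∀ q, L.Fib (k q)) (p : T) : Prop where
  map : SmoothMapAt J I (fun q => (k q : N)) p
  sdiv_sec : ∀ i, k p ∈ L.U i → SmoothAtOn J T (fun q => s q /ₛ L.sec i (k q)) p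

namespace SmoothAlong

variable {S : Set N} {L : CBundle I S} {k : T → S} {s t : ∀ q, L.Fib (k q)}

theorem sec (hk : SmoothMapAt J I (fun q => (k q : N)) p) {i : L.Idx} (hi : k p ∈ L.U i) :
    SmoothAlong J L k (fun q => L.sec i (k q)) p :=
  ⟨hk, fun j hj => (L.smooth_transition i j (k p) hi hj).comp hk⟩

/-- Smoothness is asked at the point `p` only, and trivialising sections are families over the whole
base, so no restriction of `T` is necessary. -/
theorem exists_along (L : CBundle I S) {k : T → S}
    (hk : SmoothMapAt J I (fun q => (k q : N)) p) : ∃ s, SmoothAlong J L k s p :=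
  let ⟨_, hi⟩ := L.cover (k p)
  ⟨_, sec hk hi⟩

theorem sdiv (hs : SmoothAlong J L k s p) (ht : SmoothAlong J L k t p) :
    SmoothAtOn J T (fun q => s q /ₛ t q) p := by
  obtain ⟨i, hi⟩ := L.cover (k p)
  exact ((hs.sdiv_sec i hi).div (ht.sdiv_sec i hi)).congr fun _ => sdiv_div_sdiv_cancel_right _ _ _

/-- Together with `sdiv`, this lets any smooth section serve as the reference for testing
smoothness, in place of the trivialising ones. -/
theorem of_sdiv (ht : SmoothAlong J L k t p) (h : SmoothAtOn J T (fun q => s q /ₛ t q) p) :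
    SmoothAlong J L k s p :=
  ⟨ht.map, fun i hi => (h.mul (ht.sdiv_sec i hi)).congr fun _ => sdiv_mul_sdiv_cancel _ _ _⟩

theorem congr (hs : SmoothAlong J L k s p) (e : ∀ q, s q = t q) : SmoothAlong J L k t p :=
  (funext e : s = t) ▸ hs

variable {S' : Set N''} {L' : CBundle I' S'} {k' : T → S'}

/-- An equivariant operation that preserves smooth sections reflects them. -/
theorem of_map {Φ : ∀ q, L.Fib (k q) → L'.Fib (k' q)}
    (hΦ : ∀ q (c : ℂˣ) l, Φ q (c • l) = c • Φ q l)
    (hΦs : ∀ t, SmoothAlong J L k t p → SmoothAlong J L' k' (fun q => Φ q (t q)) p)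
    (hk : SmoothMapAt J I (fun q => (k q : N)) p)
    (hs : SmoothAlong J L' k' (fun q => Φ q (s q)) p) : SmoothAlong J L k s p := by
  obtain ⟨t, ht⟩ := exists_along L hk
  refine of_sdiv ht ((hs.sdiv (hΦs t ht)).congr fun q => ?_)
  -- An equivariant map preserves quotients: `Φ s / Φ t = s / t`.
  conv_lhs => rw [← sdiv_smul (s q) (t q), hΦ, smul_sdiv]

/-- An equivariant operation preserves smooth sections if it preserves one. -/
theorem map_of_exists {Φ : ∀ q, L.Fib (k q) → L'.Fib (k' q)}
    (hΦ : ∀ q (c : ℂˣ) l, Φ q (c • l) = c • Φ q l)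
    (ht : SmoothAlong J L k t p) (ht' : SmoothAlong J L' k' (fun q => Φ q (t q)) p)
    (hs : SmoothAlong J L k s p) : SmoothAlong J L' k' (fun q => Φ q (s q)) p := by
  refine of_sdiv ht' ((hs.sdiv ht).congr fun q => ?_)
  conv_rhs => rw [← sdiv_smul (s q) (t q), hΦ, smul_sdiv]

theorem dstar (hs : SmoothAlong J L k s p) :
    SmoothAlong J L.dual k (fun q => DualTorsor.dstar (s q)) p := by
  refine ⟨hs.map, fun i hi => (hs.sdiv_sec i hi).inv.congr fun q => ?_⟩
  rw [inv_sdiv_eq_sdiv_rev]; rfl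

theorem of_dstar (hs : SmoothAlong J L.dual k (fun q => DualTorsor.dstar (s q)) p) :
    SmoothAlong J L k s p := by
  refine ⟨hs.map, fun i hi => (hs.sdiv_sec i hi).inv.congr fun q => ?_⟩
  rw [inv_sdiv_eq_sdiv_rev]; rfl

theorem tmul {L' : CBundle I S} {s' : ∀ q, L'.Fib (k q)} (hs : SmoothAlong J L k s p)
    (hs' : SmoothAlong J L' k s' p) :
    SmoothAlong J (L.tensor L') k (fun q => TensorTorsor.tmul (s q) (s' q)) p :=
  ⟨hs.map, fun i hi => (hs.sdiv_sec i.1 hi.1).mul (hs'.sdiv_sec i.2 hi.2)⟩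

theorem of_tmul_left {L' : CBundle I S} {s' : ∀ q, L'.Fib (k q)} (hs : SmoothAlong J L k s p)
    (h : SmoothAlong J (L.tensor L') k (fun q => TensorTorsor.tmul (s q) (s' q)) p) :
    SmoothAlong J L' k s' p :=
  of_map (L := L') (L' := L.tensor L')
    (Φ := fun q l => TensorTorsor.tmul (s q) l)
    (fun _ _ _ => (smul_tmul_right _ _ _).symm) (fun _ ht => hs.tmul ht) hs.map h

/-- Smoothness of `F` is postulated on the trivialising sections; equivariance extends it to all
smooth sections. -/
theorem iso_map {L' : CBundle I S} (F : CBundle.Iso L L') (hs : SmoothAlong J L k s p) :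
    SmoothAlong J L' k (fun q => F.map (k q) (s q)) p := by
  obtain ⟨i, hi⟩ := L.cover (k p)
  refine map_of_exists (t := fun q => L.sec i (k q)) (fun q => F.map_smul _) (sec hs.map hi)
    ⟨hs.map, fun j hj => ?_⟩ hs
  exact (F.smooth i j (k p) hi hj).comp hs.map

theorem pullback {S' : Set N''} {k : T → S'} {K : N'' → N} {hK : ContMDiff I' I ∞ K}
    {hS : ∀ q ∈ S', K q ∈ S} {s : ∀ q, L.Fib ⟨K (k q), hS _ (k q).2⟩}
    (hk : SmoothMapAt J I' (fun q => (k q : N'')) p)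
    (hs : SmoothAlong J L (fun q => ⟨K (k q), hS _ (k q).2⟩) s p) :
    SmoothAlong J (L.pullback S' K hK hS) k s p :=
  ⟨hk, hs.sdiv_sec⟩

/-- The trivialising sections of the pullback are those of `L` composed with `K`, so both sides test
the same quotients. -/
theorem of_pullback {S' : Set N''} {k : T → S'} {K : N'' → N} {hK : ContMDiff I' I ∞ K}
    {hS : ∀ q ∈ S', K q ∈ S} {s : ∀ q, L.Fib ⟨K (k q), hS _ (k q).2⟩}
    (hs : SmoothAlong J (L.pullback S' K hK hS) k s p) :
    SmoothAlong J L (fun q => ⟨K (k q), hS _ (k q).2⟩) s p :=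
  ⟨SmoothMapAt.comp_contMDiff (F := K) hK hs.map, hs.sdiv_sec⟩

end SmoothAlong

namespace CBundle

variable {S : Set N} {L L' : CBundle I S}

/-- A fibrewise equivariant map is an isomorphism of bundles if near each point it sends some
smooth section to a smooth section. -/
def Iso.ofExists (m : ∀ b, L.Fib b → L'.Fib b) (hm : ∀ b (c : ℂˣ) l, m b (c • l) = c • m b l)
    (h : ∀ b, ∃ s, SmoothAlong I L (fun q : S => q) s b ∧
      SmoothAlong I L' (fun q : S => q) (fun q => m q (s q)) b) : Iso L L' where
  map := m
  map_smul := hm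
  smooth i j b hi hj := by
    obtain ⟨s, hs, hs'⟩ := h b
    exact (SmoothAlong.map_of_exists (Φ := fun q l => m q l) hm hs hs'
      (SmoothAlong.sec .val hi)).sdiv_sec j hj

/-- The section of `L* ⊗ L'` that corresponds to an isomorphism `L → L'`. -/
def Iso.toSect (F : Iso L L') : (L.dual.tensor L').Sect where
  val b := tmul (dstar (Classical.arbitrary (L.Fib b))) (F.map b (Classical.arbitrary (L.Fib b)))
  smooth := by
    rintro ⟨i, j⟩ b ⟨hi, hj⟩
    refine (F.smooth i j b hi hj).congr fun q => ?_
    generalize Classical.arbitrary (L.Fib q) = l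
    rw [tmul_sdiv_tmul, dstar_sdiv_dstar, ← sdiv_smul l (L.sec i q), F.map_smul, smul_sdiv_assoc,
      sdiv_smul_eq_sdiv_div, sdiv_self, ← mul_assoc, one_div, inv_mul_cancel, one_mul]

/-- Rescaling `l` scales `l*` and `F l` by inverse factors, so the element chosen in the definition
does not matter. -/
theorem Iso.toSect_val (F : Iso L L') (b : S) (l : L.Fib b) :
    F.toSect.val b = tmul (dstar l) (F.map b l) := by
  change tmul (dstar (Classical.arbitrary (L.Fib b)))
    (F.map b (Classical.arbitrary (L.Fib b))) = _
  generalize Classical.arbitrary (L.Fib b) = l'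
  rw [← sdiv_smul l' l, F.map_smul, ← smul_tmul_eq, smul_dstar, inv_smul_smul]

end CBundle

end SmoothSections

noncomputable section

variable {E M : Type u} [NormedAddCommGroup E] [NormedSpace ℝ E] [TopologicalSpace M]
  [ChartedSpace E M]
variable {E' H' N' : Type u} [NormedAddCommGroup E'] [NormedSpace ℝ E'] [TopologicalSpace H']
  {J : ModelWithCorners ℝ E' H'} [TopologicalSpace N'] [ChartedSpace H' N'] {T : Set N'} {b : T}

/-! ## The groupoid of a bundle gerbe -/

namespace BundleGerbe

variable (G : BundleGerbe E M)

section Algebra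

variable {x₁ x₂ x₃ x₄ : G.X} {h₁₂ : G.π x₁ = G.π x₂} {h₂₃ : G.π x₂ = G.π x₃}
  {h₃₄ : G.π x₃ = G.π x₄}

theorem smul_mul (c : ℂˣ) (s : G.fib h₂₃) (t : G.fib h₁₂) :
    G.mul (c • s) t = c • G.mul s t :=
  G.product.map_smul ⟨(x₁, x₂, x₃), h₁₂, h₂₃⟩ c (tmul s t)

theorem mul_smul (c : ℂˣ) (s : G.fib h₂₃) (t : G.fib h₁₂) :
    G.mul s (c • t) = c • G.mul s t := by
  rw [← smul_mul, mul, mul, smul_tmul_eq]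

theorem mul_assoc (s : G.fib h₃₄) (t : G.fib h₂₃) (r : G.fib h₁₂) :
    G.mul (G.mul s t) r = G.mul s (G.mul t r) :=
  G.product_assoc _ _ _ _ _ _ _ s t r

/-- For any `u` in `P_(x, x)` put `c = u / u²`. Then `c u² = u`, and hence `(c u)² = c u`. -/
theorem exists_one (x : G.X) : ∃ e : G.fib (rfl : G.π x = G.π x), G.mul e e = e := by
  let u : G.fib (rfl : G.π x = G.π x) := Classical.arbitrary _
  refine ⟨(u /ₛ G.mul u u) • u, ?_⟩
  rw [smul_mul, mul_smul, sdiv_smul]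

/-- The unit of `P_(x, x)`. -/
def one (x : G.X) : G.fib (rfl : G.π x = G.π x) := Classical.choose (G.exists_one x)

theorem one_mul_one (x : G.X) : G.mul (G.one x) (G.one x) = G.one x :=
  Classical.choose_spec (G.exists_one x)

/-- Write `1 t = c t`. Associativity of `1 1 t` gives `c t = c² t`, and `c` cancels. -/
theorem one_mul (t : G.fib h₁₂) : G.mul (G.one x₂) t = t := by
  have h := G.mul_assoc (G.one x₂) (G.one x₂) t
  obtain ⟨c, hc⟩ : ∃ c : ℂˣ, G.mul (G.one x₂) t = c • t := ⟨_, (sdiv_smul _ t).symm⟩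
  rw [one_mul_one, hc, mul_smul, hc] at h
  rw [hc, ← smul_left_cancel c h]

theorem mul_one (t : G.fib h₁₂) : G.mul t (G.one x₁) = t := by
  have h := G.mul_assoc t (G.one x₁) (G.one x₁)
  obtain ⟨c, hc⟩ : ∃ c : ℂˣ, G.mul t (G.one x₁) = c • t := ⟨_, (sdiv_smul _ t).symm⟩
  rw [one_mul_one, hc, smul_mul, hc] at h
  rw [hc, smul_left_cancel c h]

theorem eq_one {x : G.X} {e : G.fib (rfl : G.π x = G.π x)} (h : G.mul e e = e) :
    e = G.one x := by
  obtain ⟨c, rfl⟩ : ∃ c : ℂˣ, e = c • G.one x := ⟨_, (sdiv_smul _ _).symm⟩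
  rw [smul_mul, one_mul] at h
  exact smul_left_cancel c h

/-- The inverse `P_(x₁, x₂) → P_(x₂, x₁)`. -/
def inv (t : G.fib h₁₂) : G.fib h₁₂.symm :=
  (G.one x₁ /ₛ G.mul (Classical.arbitrary (G.fib h₁₂.symm)) t) • Classical.arbitrary _

theorem inv_mul (t : G.fib h₁₂) : G.mul (G.inv t) t = G.one x₁ := by
  rw [inv, smul_mul]
  exact sdiv_smul _ _

/-- `t t⁻¹` is idempotent because `t⁻¹ t = 1`, and the unit is the only idempotent. -/
theorem mul_inv (t : G.fib h₁₂) : G.mul t (G.inv t) = G.one x₂ := by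
  refine G.eq_one ?_
  rw [mul_assoc, ← G.mul_assoc (G.inv t) t, inv_mul, one_mul]

theorem inv_mul_cancel_left (t : G.fib h₁₂) {x₀ : G.X} {h₀ : G.π x₀ = G.π x₁} (r : G.fib h₀) :
    G.mul (G.inv t) (G.mul t r) = r := by
  rw [← mul_assoc, inv_mul, one_mul]

theorem eq_inv {t : G.fib h₁₂} {s : G.fib h₁₂.symm} (h : G.mul s t = G.one x₁) :
    s = G.inv t := by
  rw [← G.mul_one s, ← G.mul_inv t, ← G.mul_assoc s, h, one_mul]

theorem inv_smul (c : ℂˣ) (t : G.fib h₁₂) : G.inv (c • t) = c⁻¹ • G.inv t :=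
  (G.eq_inv (by rw [smul_mul, mul_smul, inv_mul, inv_smul_smul])).symm

theorem inv_one (x : G.X) : G.inv (G.one x) = G.one x :=
  (G.eq_inv (G.one_mul _)).symm

theorem inv_mul_rev (s : G.fib h₂₃) (t : G.fib h₁₂) :
    G.inv (G.mul s t) = G.mul (G.inv t) (G.inv s) :=
  (G.eq_inv (by rw [mul_assoc, inv_mul_cancel_left, inv_mul])).symm

end Algebra

/-! ### Smoothness -/

variable (J) in
/-- Smoothness at `b` of a section `s` of `P` along a map `(x₁, x₂) : T → X^[2]`. -/
abbrev Smooth {x₁ x₂ : T → G.X} {h : ∀ q, G.π (x₁ q) = G.π (x₂ q)} (s : ∀ q, G.fib (h q))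
    (b : T) : Prop :=
  SmoothAlong J G.P (fun q => ⟨(x₁ q, x₂ q), h q⟩) s b

variable {G}

section

variable {x₁ x₂ x₃ : T → G.X} {h₁₂ : ∀ q, G.π (x₁ q) = G.π (x₂ q)}
  {h₂₃ : ∀ q, G.π (x₂ q) = G.π (x₃ q)}

variable (G) in
theorem exists_smooth (hx₁ : SmoothMapAt J G.I x₁ b) (hx₂ : SmoothMapAt J G.I x₂ b)
    (h₁₂ : ∀ q, G.π (x₁ q) = G.π (x₂ q)) : ∃ s : ∀ q, G.fib (h₁₂ q), G.Smooth J s b :=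
  SmoothAlong.exists_along G.P (k := fun q => ⟨(x₁ q, x₂ q), h₁₂ q⟩) (hx₁.prodMk hx₂)

theorem Smooth.mul {s : ∀ q, G.fib (h₂₃ q)} {t : ∀ q, G.fib (h₁₂ q)} (hs : G.Smooth J s b)
    (ht : G.Smooth J t b) : G.Smooth J (fun q => G.mul (s q) (t q)) b := by
  have hk : SmoothMapAt J (G.I.prod (G.I.prod G.I)) (fun q => (x₁ q, x₂ q, x₃ q)) b :=
    ht.map.fst.prodMk hs.map
  exact (SmoothAlong.iso_map G.product
    (k := fun q => (⟨(x₁ q, x₂ q, x₃ q), h₁₂ q, h₂₃ q⟩ : G.fp3))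
    (SmoothAlong.tmul (SmoothAlong.pullback hk hs) (SmoothAlong.pullback hk ht))).of_pullback

/-- Right multiplication by a smooth `u` preserves, hence reflects, smoothness, and it sends the
unit to `u`. -/
theorem smooth_one (hx₁ : SmoothMapAt J G.I x₁ b) :
    G.Smooth J (fun q => G.one (x₁ q)) b := by
  obtain ⟨u, hu⟩ := G.exists_smooth hx₁ hx₁ fun _ => rfl
  refine SmoothAlong.of_map (L' := G.P) (Φ := fun q l => G.mul l (u q))
    (fun q c l => G.smul_mul c l (u q)) (fun t ht => Smooth.mul ht hu) hu.map ?_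
  exact hu.congr fun q => (G.one_mul _).symm

/-- Right multiplication by `t` reflects smoothness and sends the inverse to the unit. -/
theorem Smooth.inv {t : ∀ q, G.fib (h₁₂ q)} (ht : G.Smooth J t b) :
    G.Smooth J (fun q => G.inv (t q)) b := by
  refine SmoothAlong.of_map (L' := G.P) (Φ := fun q l => G.mul l (t q))
    (fun q c l => G.smul_mul c l (t q)) (fun s hs => Smooth.mul hs ht)
    (ht.map.snd.prodMk ht.map.fst) ?_
  exact (smooth_one ht.map.fst).congr fun q => (G.inv_mul _).symm

end

end BundleGerbe

/-! ### Local sections of the surjections onto `M` -/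

namespace LocallySplit

/-- A smooth local section is extended by arbitrary choices of preimages. The result is a section on
all of `M` that is smooth only near `m`, which spares later constructions from carrying its domain.
-/
theorem exists_section (A : LocallySplit E M) (m : M) : ∃ σ : M → A.X, (∀ m', A.π (σ m') = m') ∧
    ∀ᶠ m' in 𝓝 m, ContMDiffAt 𝓘(ℝ, E) A.I ∞ σ m' := by
  classical
  obtain ⟨U, σ, hU, hm, hσ, e⟩ := A.exists_localSection m
  refine ⟨fun m' => if m' ∈ U then σ m' else Function.surjInv A.surjective_π m', fun m' => ?_, ?_⟩
  · change A.π (if m' ∈ U then σ m' else Function.surjInv A.surjective_π m') = m'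
    split_ifs with h
    · exact e m' h
    · exact Function.surjInv_eq _ _
  · filter_upwards [hU.mem_nhds hm] with m' hm'
    refine (hσ.contMDiffAt (hU.mem_nhds hm')).congr_of_eventuallyEq ?_
    filter_upwards [hU.mem_nhds hm'] with m'' h
    exact if_pos h

end LocallySplit

/-! ## The actions on the bundle of a stable morphism -/

namespace StableMorphism

variable {G K : BundleGerbe E M} (f : StableMorphism G K)

section Algebra

variable {x x₁ x₂ x₃ : G.X} {y y₁ y₂ y₃ : K.X}

theorem phi_smul_left {h₁ : G.π x₁ = K.π y₁} {h₂ : G.π x₂ = K.π y₂} (hx : G.π x₁ = G.π x₂)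
    (c : ℂˣ) (l₂ : f.fib h₂) (l₁ : f.fib h₁) : f.phi hx (c • l₂) l₁ = c • f.phi hx l₂ l₁ :=
  f.φ.map_smul ⟨((x₁, y₁), (x₂, y₂)), h₁, h₂, hx⟩ c (tmul l₂ (dstar l₁))

theorem phi_smul_right {h₁ : G.π x₁ = K.π y₁} {h₂ : G.π x₂ = K.π y₂} (hx : G.π x₁ = G.π x₂)
    (c : ℂˣ) (l₂ : f.fib h₂) (l₁ : f.fib h₁) : f.phi hx l₂ (c • l₁) = c⁻¹ • f.phi hx l₂ l₁ := by
  rw [← phi_smul_left, phi, phi, smul_tmul_eq, smul_dstar, _root_.inv_inv]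

theorem phi_mul {h₁ : G.π x₁ = K.π y₁} {h₂ : G.π x₂ = K.π y₂} {h₃ : G.π x₃ = K.π y₃}
    {hx₁₂ : G.π x₁ = G.π x₂} {hx₂₃ : G.π x₂ = G.π x₃} {hy₁₂ : K.π y₁ = K.π y₂}
    {hy₂₃ : K.π y₂ = K.π y₃} {l₁ : f.fib h₁} {l₂ : f.fib h₂} {l₃ : f.fib h₃} {p : G.fib hx₂₃}
    {p' : G.fib hx₁₂} {q : K.fib hy₂₃} {q' : K.fib hy₁₂}
    (e : f.phi hx₂₃ l₃ l₂ = tmul (dstar p) q) (e' : f.phi hx₁₂ l₂ l₁ = tmul (dstar p') q') :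
    f.phi (hx₁₂.trans hx₂₃) l₃ l₁ = tmul (dstar (G.mul p p')) (K.mul q q') :=
  f.φ_mul _ _ _ _ _ _ _ _ _ _ _ _ _ _ _ _ _ _ _ _ e e'

theorem phi_left_cancel {h₁ : G.π x₁ = K.π y₁} {h₂ : G.π x₂ = K.π y₂} {hx : G.π x₁ = G.π x₂}
    {l l' : f.fib h₂} {l₁ : f.fib h₁} (e : f.phi hx l l₁ = f.phi hx l' l₁) : l = l' :=
  eq_of_equivariant (Φ := fun l => f.phi hx l l₁) (fun c l => f.phi_smul_left hx c l l₁) e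

theorem phi_right_cancel {h₁ : G.π x₁ = K.π y₁} {h₂ : G.π x₂ = K.π y₂} {hx : G.π x₁ = G.π x₂}
    {l l' : f.fib h₁} {l₂ : f.fib h₂} (e : f.phi hx l₂ l = f.phi hx l₂ l') : l = l' := by
  rw [← sdiv_smul l l', phi_smul_right] at e
  rw [← sdiv_smul l l', inv_eq_one.1 (eq_one_of_smul_eq_self e), one_smul]

/-- The left action is read off from `φ`: the map `l ↦ φ(l ⊗ a*)` is equivariant between torsors,
hence takes the value `1* ⊗ q`. -/
theorem exists_lact {h : G.π x = K.π y₁} {hy : K.π y₁ = K.π y₂} (q : K.fib hy) (a : f.fib h) :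
    ∃ a' : f.fib (h.trans hy), f.phi rfl a' a = tmul (dstar (G.one x)) q :=
  exists_of_equivariant (fun c l => f.phi_smul_left rfl c l a) _

theorem exists_ract {h : G.π x₂ = K.π y} {hx : G.π x₁ = G.π x₂} (a : f.fib h) (p : G.fib hx) :
    ∃ a' : f.fib (hx.trans h), f.phi hx a a' = tmul (dstar p) (K.one y) := by
  let a₀ : f.fib (hx.trans h) := Classical.arbitrary _
  -- The factor is inverted because the second argument of `φ` enters through the dual.
  refine ⟨(tmul (dstar p) (K.one y) /ₛ f.phi hx a a₀)⁻¹ • a₀, ?_⟩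
  rw [phi_smul_right, _root_.inv_inv]
  exact sdiv_smul _ _

/-- The left action `Q(y₁, y₂) ⊗ L_f(x, y₁) → L_f(x, y₂)`. -/
def lact {h : G.π x = K.π y₁} {hy : K.π y₁ = K.π y₂} (q : K.fib hy) (a : f.fib h) :
    f.fib (h.trans hy) :=
  Classical.choose (f.exists_lact q a)

/-- The right action `L_f(x₂, y) ⊗ P(x₁, x₂) → L_f(x₁, y)`. -/
def ract {h : G.π x₂ = K.π y} {hx : G.π x₁ = G.π x₂} (a : f.fib h) (p : G.fib hx) :
    f.fib (hx.trans h) :=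
  Classical.choose (f.exists_ract a p)

theorem phi_lact {h : G.π x = K.π y₁} {hy : K.π y₁ = K.π y₂} (q : K.fib hy) (a : f.fib h) :
    f.phi rfl (f.lact q a) a = tmul (dstar (G.one x)) q :=
  Classical.choose_spec (f.exists_lact q a)

theorem phi_ract {h : G.π x₂ = K.π y} {hx : G.π x₁ = G.π x₂} (a : f.fib h) (p : G.fib hx) :
    f.phi hx a (f.ract a p) = tmul (dstar p) (K.one y) :=
  Classical.choose_spec (f.exists_ract a p)

theorem eq_lact {h : G.π x = K.π y₁} {hy : K.π y₁ = K.π y₂} {q : K.fib hy} {a : f.fib h}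
    {a' : f.fib (h.trans hy)} (e : f.phi rfl a' a = tmul (dstar (G.one x)) q) :
    a' = f.lact q a :=
  f.phi_left_cancel (e.trans (f.phi_lact q a).symm)

theorem eq_ract {h : G.π x₂ = K.π y} {hx : G.π x₁ = G.π x₂} {a : f.fib h} {p : G.fib hx}
    {a' : f.fib (hx.trans h)} (e : f.phi hx a a' = tmul (dstar p) (K.one y)) :
    a' = f.ract a p :=
  f.phi_right_cancel (e.trans (f.phi_ract a p).symm)

theorem lact_smul {h : G.π x = K.π y₁} {hy : K.π y₁ = K.π y₂} (c : ℂˣ) (q : K.fib hy)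
    (a : f.fib h) : f.lact q (c • a) = c • f.lact q a :=
  (f.eq_lact (by rw [phi_smul_left, phi_smul_right, phi_lact, smul_inv_smul])).symm

theorem smul_lact {h : G.π x = K.π y₁} {hy : K.π y₁ = K.π y₂} (c : ℂˣ) (q : K.fib hy)
    (a : f.fib h) : f.lact (c • q) a = c • f.lact q a :=
  (f.eq_lact (by rw [phi_smul_left, phi_lact, smul_tmul_right])).symm

theorem smul_ract {h : G.π x₂ = K.π y} {hx : G.π x₁ = G.π x₂} (c : ℂˣ) (a : f.fib h)
    (p : G.fib hx) : f.ract (c • a) p = c • f.ract a p :=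
  (f.eq_ract (by rw [phi_smul_left, phi_smul_right, phi_ract, smul_inv_smul])).symm

theorem ract_smul {h : G.π x₂ = K.π y} {hx : G.π x₁ = G.π x₂} (c : ℂˣ) (a : f.fib h)
    (p : G.fib hx) : f.ract a (c • p) = c • f.ract a p :=
  (f.eq_ract (by rw [phi_smul_right, phi_ract, smul_tmul, smul_dstar, _root_.inv_inv])).symm

/-- Multiplicativity of `φ` along `a`, `q a`, `q' (q a)`: the components in `P` are units and those
in `Q` multiply to `q' q`. -/
theorem lact_lact {h : G.π x = K.π y₁} {hy : K.π y₁ = K.π y₂} {hy' : K.π y₂ = K.π y₃}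
    (q' : K.fib hy') (q : K.fib hy) (a : f.fib h) :
    f.lact q' (f.lact q a) = f.lact (K.mul q' q) a :=
  f.eq_lact (by
    have := f.phi_mul (f.phi_lact q' (f.lact q a)) (f.phi_lact q a)
    rwa [G.one_mul] at this)

theorem ract_ract {h : G.π x₃ = K.π y} {hx : G.π x₁ = G.π x₂} {hx' : G.π x₂ = G.π x₃}
    (a : f.fib h) (p' : G.fib hx') (p : G.fib hx) :
    f.ract (f.ract a p') p = f.ract a (G.mul p' p) :=
  f.eq_ract (by
    have := f.phi_mul (f.phi_ract a p') (f.phi_ract (f.ract a p') p)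
    rwa [K.one_mul] at this)

/-- As for the units of the gerbe: if `1 a = c a`, acting twice gives `c² a = c a`. -/
theorem one_lact {h : G.π x = K.π y} (a : f.fib h) : f.lact (K.one y) a = a := by
  obtain ⟨c, hc⟩ : ∃ c : ℂˣ, f.lact (K.one y) a = c • a := ⟨_, (sdiv_smul _ a).symm⟩
  have := f.lact_lact (K.one y) (K.one y) a
  rw [K.one_mul, hc, lact_smul, hc] at this
  rw [hc, smul_left_cancel c this]

theorem ract_one {h : G.π x = K.π y} (a : f.fib h) : f.ract a (G.one x) = a := by
  obtain ⟨c, hc⟩ : ∃ c : ℂˣ, f.ract a (G.one x) = c • a := ⟨_, (sdiv_smul _ a).symm⟩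
  have := f.ract_ract a (G.one x) (G.one x)
  rw [G.one_mul, hc, smul_ract, hc] at this
  rw [hc, smul_left_cancel c this]

/-- Factor through the common element `l₂ p = q l₁` over `(x₁, y₂)`: it contributes `p* ⊗ 1` on the
side of `l₂` and `1* ⊗ q` on the side of `l₁`. -/
theorem phi_eq_of_ract_eq {h₁ : G.π x₁ = K.π y₁} {h₂ : G.π x₂ = K.π y₂} {hx : G.π x₁ = G.π x₂}
    {hy : K.π y₁ = K.π y₂} {l₁ : f.fib h₁} {l₂ : f.fib h₂} {p : G.fib hx} {q : K.fib hy}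
    (e : f.ract l₂ p = f.lact q l₁) : f.phi hx l₂ l₁ = tmul (dstar p) q := by
  have h := f.phi_mul (f.phi_ract l₂ p) (by rw [e]; exact f.phi_lact q l₁)
  rwa [G.mul_one, K.one_mul] at h

theorem exists_lact_eq {h₁ : G.π x = K.π y₁} {h₂ : G.π x = K.π y₂} (hy : K.π y₁ = K.π y₂)
    (l₁ : f.fib h₁) (l₂ : f.fib h₂) : ∃ q : K.fib hy, f.lact q l₁ = l₂ :=
  exists_of_equivariant (fun c q => f.smul_lact c q l₁) l₂

theorem exists_ract_eq {h₁ : G.π x₁ = K.π y} {h₂ : G.π x₂ = K.π y} (hx : G.π x₁ = G.π x₂)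
    (l₁ : f.fib h₁) (l₂ : f.fib h₂) : ∃ p : G.fib hx, f.ract l₂ p = l₁ :=
  exists_of_equivariant (fun c p => f.ract_smul c l₂ p) l₁

/-- The dictionary between `φ` and the two actions. For the forward direction, `l₂ p = q' l₁` holds
for some `q'`, and comparing the values of `φ` gives `q' = q`. -/
theorem phi_eq_iff {h₁ : G.π x₁ = K.π y₁} {h₂ : G.π x₂ = K.π y₂} {hx : G.π x₁ = G.π x₂}
    {hy : K.π y₁ = K.π y₂} {l₁ : f.fib h₁} {l₂ : f.fib h₂} {p : G.fib hx} {q : K.fib hy} :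
    f.phi hx l₂ l₁ = tmul (dstar p) q ↔ f.ract l₂ p = f.lact q l₁ := by
  refine ⟨fun h => ?_, f.phi_eq_of_ract_eq⟩
  obtain ⟨q', hq'⟩ := f.exists_lact_eq hy l₁ (f.ract l₂ p)
  rw [tmul_left_cancel (h.symm.trans (f.phi_eq_of_ract_eq hq'.symm)), hq']

/-- Passing from `a p` through `a` to `q a`, multiplicativity yields `φ(q a ⊗ (a p)*) = p* ⊗ q`,
which the dictionary turns into `(q a) p = q (a p)`. -/
theorem lact_ract {h : G.π x₂ = K.π y₁} {hx : G.π x₁ = G.π x₂} {hy : K.π y₁ = K.π y₂}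
    (q : K.fib hy) (a : f.fib h) (p : G.fib hx) :
    f.lact q (f.ract a p) = f.ract (f.lact q a) p := by
  refine (f.phi_eq_iff.1 ?_).symm
  have := f.phi_mul (f.phi_lact q a) (f.phi_ract a p)
  rwa [G.one_mul, K.mul_one] at this

theorem lact_right_cancel {h : G.π x = K.π y₁} {hy : K.π y₁ = K.π y₂} {q q' : K.fib hy}
    {a : f.fib h} (e : f.lact q a = f.lact q' a) : q = q' :=
  eq_of_equivariant (Φ := fun q => f.lact q a) (fun c q => f.smul_lact c q a) e

theorem ract_left_cancel {h : G.π x₂ = K.π y} {hx : G.π x₁ = G.π x₂} {p p' : G.fib hx}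
    {a : f.fib h} (e : f.ract a p = f.ract a p') : p = p' :=
  eq_of_equivariant (Φ := fun p => f.ract a p) (fun c p => f.ract_smul c a p) e

end Algebra

end StableMorphism
end

noncomputable section

variable {E M : Type u} [NormedAddCommGroup E] [NormedSpace ℝ E] [TopologicalSpace M]
  [ChartedSpace E M]
variable {E' H' N' : Type u} [NormedAddCommGroup E'] [NormedSpace ℝ E'] [TopologicalSpace H']
  {J : ModelWithCorners ℝ E' H'} [TopologicalSpace N'] [ChartedSpace H' N'] {T : Set N'} {b : T}

namespace StableMorphism

variable {G K : BundleGerbe E M} (f : StableMorphism G K)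

/-! ### Smoothness of the actions -/

variable (J) in
/-- Smoothness at `b` of a section `l` of `L_f` along a map `(x, y) : T → X ×_M Y`. -/
abbrev Smooth {x : T → G.X} {y : T → K.X} {h : ∀ q, G.π (x q) = K.π (y q)}
    (l : ∀ q, f.fib (h q)) (b : T) : Prop :=
  SmoothAlong J f.L (fun q => ⟨(x q, y q), h q⟩) l b

theorem exists_smooth {x : T → G.X} {y : T → K.X} (hx : SmoothMapAt J G.I x b)
    (hy : SmoothMapAt J K.I y b) (h : ∀ q, G.π (x q) = K.π (y q)) :
    ∃ l : ∀ q, f.fib (h q), f.Smooth J l b :=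
  SmoothAlong.exists_along f.L (k := fun q => ⟨(x q, y q), h q⟩) (hx.prodMk hy)

variable {f}

section

variable {x x₁ x₂ : T → G.X} {y y₁ y₂ : T → K.X} {h₁ : ∀ q, G.π (x₁ q) = K.π (y₁ q)}
  {h₂ : ∀ q, G.π (x₂ q) = K.π (y₂ q)} {hx : ∀ q, G.π (x₁ q) = G.π (x₂ q)}
  {hy : ∀ q, K.π (y₁ q) = K.π (y₂ q)}

theorem Smooth.phi {l₂ : ∀ q, f.fib (h₂ q)} {l₁ : ∀ q, f.fib (h₁ q)} (hl₂ : f.Smooth J l₂ b)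
    (hl₁ : f.Smooth J l₁ b) :
    SmoothAlong J (dualTensor G K)
      (fun q => ⟨((x₁ q, y₁ q), (x₂ q, y₂ q)), h₁ q, h₂ q, hx q⟩)
      (fun q => f.phi (hx q) (l₂ q) (l₁ q)) b := by
  have hk : SmoothMapAt J ((G.I.prod K.I).prod (G.I.prod K.I))
      (fun q => ((x₁ q, y₁ q), (x₂ q, y₂ q))) b := hl₁.map.prodMk hl₂.map
  exact SmoothAlong.iso_map f.φ
    (k := fun q => (⟨((x₁ q, y₁ q), (x₂ q, y₂ q)), h₁ q, h₂ q, hx q⟩ : G.fpSq K.toLocallySplit))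
    (SmoothAlong.tmul (SmoothAlong.pullback hk hl₂) (SmoothAlong.pullback hk hl₁).dstar)

theorem smooth_dualTensor {p : ∀ q, G.fib (hx q)} {s : ∀ q, K.fib (hy q)}
    (h₁ : ∀ q, G.π (x₁ q) = K.π (y₁ q)) (hp : G.Smooth J p b) (hs : K.Smooth J s b) :
    SmoothAlong J (dualTensor G K)
      (fun q => ⟨((x₁ q, y₁ q), (x₂ q, y₂ q)), h₁ q, (hx q).symm.trans ((h₁ q).trans (hy q)), hx q⟩)
      (fun q => tmul (dstar (p q)) (s q)) b := by
  have hk : SmoothMapAt J ((G.I.prod K.I).prod (G.I.prod K.I))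
      (fun q => ((x₁ q, y₁ q), (x₂ q, y₂ q))) b :=
    (hp.map.fst.prodMk hs.map.fst).prodMk (hp.map.snd.prodMk hs.map.snd)
  exact SmoothAlong.tmul (L := (G.P.pullback (G.fpSq K.toLocallySplit) _ _ _).dual)
    (L' := K.P.pullback (G.fpSq K.toLocallySplit) _ _ _)
    (SmoothAlong.dstar (SmoothAlong.pullback hk hp)) (SmoothAlong.pullback hk hs)

/-- The map `l ↦ φ(l ⊗ a*)` reflects smoothness and sends the product to the smooth section `1* ⊗
s`. -/
theorem Smooth.lact {h : ∀ q, G.π (x q) = K.π (y₁ q)} {s : ∀ q, K.fib (hy q)}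
    {a : ∀ q, f.fib (h q)} (hs : K.Smooth J s b) (ha : f.Smooth J a b) :
    f.Smooth J (fun q => f.lact (s q) (a q)) b := by
  refine SmoothAlong.of_map (L' := dualTensor G K)
    (k' := fun q => ⟨((x q, y₁ q), (x q, y₂ q)), h q, (h q).trans (hy q), rfl⟩)
    (Φ := fun q l => f.phi rfl l (a q)) (fun q c l => f.phi_smul_left rfl c l (a q))
    (fun t ht => Smooth.phi ht ha) (ha.map.fst.prodMk hs.map.snd) ?_
  exact (smooth_dualTensor h (BundleGerbe.smooth_one ha.map.fst) hs).congr fun q =>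
    (f.phi_lact (s q) (a q)).symm

theorem Smooth.ract {h : ∀ q, G.π (x₂ q) = K.π (y q)} {a : ∀ q, f.fib (h q)}
    {p : ∀ q, G.fib (hx q)} (ha : f.Smooth J a b) (hp : G.Smooth J p b) :
    f.Smooth J (fun q => f.ract (a q) (p q)) b := by
  -- `φ` is equivariant in its second argument only when that argument is regarded as a point of the
  -- dual bundle.
  refine SmoothAlong.of_dstar (SmoothAlong.of_map (L := f.L.dual) (L' := dualTensor G K)
    (k' := fun q => ⟨((x₁ q, y q), (x₂ q, y q)), (hx q).trans (h q), h q, hx q⟩)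
    (Φ := fun q l => f.phi (hx q) (a q) l.undstar) (fun q c l => ?_)
    (fun t ht => Smooth.phi ha (SmoothAlong.of_dstar ht)) (hp.map.fst.prodMk ha.map.snd) ?_)
  · change f.phi (hx q) (a q) (c⁻¹ • l.undstar) = _
    rw [phi_smul_right, inv_inv]
  · exact (smooth_dualTensor (fun q => (hx q).trans (h q)) hp
      (BundleGerbe.smooth_one ha.map.snd)).congr fun q => (f.phi_ract (a q) (p q)).symm

end

/-! ### Transformations as maps of bimodules -/

section Transformations

variable {g k : StableMorphism G K} {x x₁ x₂ : G.X} {y y₁ y₂ : K.X}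

/-- The map `L_f(x, y) → L_g(x, y)` given by a transformation `f ⇒ g`. -/
def app (s : f ⟶ g) {h : G.π x = K.π y} (l : f.fib h) : g.fib h :=
  Classical.choose (exists_right (value s h) (dstar l))

theorem value_eq (s : f ⟶ g) {h : G.π x = K.π y} (l : f.fib h) :
    value s h = tmul (dstar l) (app s l) :=
  Classical.choose_spec (exists_right (value s h) (dstar l))

theorem value_eq_iff {s : f ⟶ g} {h : G.π x = K.π y} {l : f.fib h} {l' : g.fib h} :
    value s h = tmul (dstar l) l' ↔ app s l = l' := by
  rw [value_eq s l]
  exact ⟨tmul_left_cancel, fun e => by rw [e]⟩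

theorem app_smul (s : f ⟶ g) {h : G.π x = K.π y} (c : ℂˣ) (l : f.fib h) :
    app s (c • l) = c • app s l := by
  rw [← value_eq_iff, value_eq s l, ← smul_tmul_eq, smul_dstar, inv_smul_smul]

theorem app_id {h : G.π x = K.π y} (l : f.fib h) : app (𝟙 f) l = l :=
  value_eq_iff.1 (coev_eq l)

theorem app_comp (s : f ⟶ g) (t : g ⟶ k) {h : G.π x = K.π y} (l : f.fib h) :
    app (s ≫ t) l = app t (app s l) := by
  rw [← value_eq_iff]
  change contract (value s h) (value t h) = _
  rw [value_eq s l, value_eq t (app s l), contract_tmul]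

/-- An element `l* ⊗ k` is determined by the `k` that goes with one given `l`, so one element of
each fibre is enough. -/
theorem hom_ext {s t : f ⟶ g}
    (e : ∀ (x : G.X) (y : K.X) (h : G.π x = K.π y), ∃ l : f.fib h, app s l = app t l) :
    s = t := by
  refine Transformation.ext (CBundle.Sect.ext (funext fun ⟨⟨x, y⟩, h⟩ => ?_))
  obtain ⟨l, hl⟩ := e x y h
  exact (value_eq s l).trans (by rw [hl, ← value_eq t l]; rfl)

theorem app_phi (s : f ⟶ g) {h₁ : G.π x₁ = K.π y₁} {h₂ : G.π x₂ = K.π y₂} (hx : G.π x₁ = G.π x₂)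
    (l₂ : f.fib h₂) (l₁ : f.fib h₁) : g.phi hx (app s l₂) (app s l₁) = f.phi hx l₂ l₁ :=
  (Transformation.compat s _ _ _ _ _ _ hx _ _ _ _ (value_eq s l₁) (value_eq s l₂)).symm

/-- The action is characterised by a value of `φ`, and transformations preserve `φ`. -/
theorem app_lact (s : f ⟶ g) {h : G.π x = K.π y₁} {hy : K.π y₁ = K.π y₂} (q : K.fib hy)
    (a : f.fib h) : app s (f.lact q a) = g.lact q (app s a) :=
  g.eq_lact (by rw [app_phi, phi_lact])

theorem app_ract (s : f ⟶ g) {h : G.π x₂ = K.π y} {hx : G.π x₁ = G.π x₂} (a : f.fib h)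
    (p : G.fib hx) : app s (f.ract a p) = g.ract (app s a) p :=
  g.eq_ract (by rw [app_phi, phi_ract])

theorem Smooth.app (s : f ⟶ g) {x : T → G.X} {y : T → K.X} {h : ∀ q, G.π (x q) = K.π (y q)}
    {l : ∀ q, f.fib (h q)} (hl : f.Smooth J l b) : g.Smooth J (fun q => app s (l q)) b := by
  -- The section `l* ⊗ s(l)` is the value of the transformation along the map, which is smooth; the
  -- smooth factor `l*` can be removed.
  refine SmoothAlong.of_tmul_left hl.dstar
    ⟨hl.map, fun i hi => ?_⟩
  exact ((Transformation.θ s).smooth i ⟨(x b, y b), h b⟩ hi |>.comp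
    (k := fun q => ⟨(x q, y q), h q⟩) hl.map).congr
    fun q => congrArg (· /ₛ (f.L.dual.tensor g.L).sec i ⟨(x q, y q), h q⟩) (value_eq s (l q))

/-- The transformation given by an isomorphism of bundles that commutes with the actions. -/
def ofIso (F : CBundle.Iso f.L g.L)
    (h_lact : ∀ {x : G.X} {y₁ y₂ : K.X} (h : G.π x = K.π y₁) (hy : K.π y₁ = K.π y₂)
      (q : K.fib hy) (a : f.fib h),
      F.map ⟨(x, y₂), h.trans hy⟩ (f.lact q a) = g.lact q (F.map ⟨(x, y₁), h⟩ a))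
    (h_ract : ∀ {x₁ x₂ : G.X} {y : K.X} (h : G.π x₂ = K.π y) (hx : G.π x₁ = G.π x₂)
      (a : f.fib h) (p : G.fib hx),
      F.map ⟨(x₁, y), hx.trans h⟩ (f.ract a p) = g.ract (F.map ⟨(x₂, y), h⟩ a) p) : f ⟶ g where
  θ := F.toSect
  compat x₁ x₂ y₁ y₂ h₁ h₂ hx l₁ l₂ k₁ k₂ e₁ e₂ := by
    rw [F.toSect_val _ l₁] at e₁
    rw [F.toSect_val _ l₂] at e₂
    rw [← tmul_left_cancel e₁, ← tmul_left_cancel e₂]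
    -- By the dictionary `l₂ p = q l₁`; applying `F` gives the same relation between the images.
    obtain ⟨p, q, e⟩ := exists_tmul (f.phi hx l₂ l₁)
    obtain ⟨p⟩ := p
    rw [e]
    refine (g.phi_eq_of_ract_eq ?_).symm
    rw [← h_ract, ← h_lact, f.phi_eq_iff.1 e]

theorem app_ofIso {F : CBundle.Iso f.L g.L} (h_lact h_ract) {h : G.π x = K.π y} (l : f.fib h) :
    app (ofIso F h_lact h_ract) l = F.map ⟨(x, y), h⟩ l :=
  value_eq_iff.1 (F.toSect_val ⟨(x, y), h⟩ l)

/-- Every transformation is invertible. -/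
theorem isIso (s : f ⟶ g) : IsIso s := by
  have hs : ∀ (b : G.fp K.toLocallySplit) (l : g.L.Fib b),
      ∃ l' : f.fib (x := b.1.1) (y := b.1.2) b.2, app s l' = l := fun b l =>
    exists_of_equivariant (fun c l' => app_smul s c l') l
  -- The fibrewise inverse; injectivity of the transformation transfers equivariance and the action
  -- laws to it.
  choose m hm using hs
  have inj : ∀ {x : G.X} {y : K.X} {h : G.π x = K.π y} {l l' : f.fib h},
      app s l = app s l' → l = l' := fun e =>
    eq_of_equivariant (Φ := fun l => app s l) (fun c l => app_smul s c l) e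
  have hm' : ∀ {x : G.X} {y : K.X} {h : G.π x = K.π y} (l : g.fib h),
      app s (m ⟨(x, y), h⟩ l) = l := fun l => hm _ l
  let F : CBundle.Iso g.L f.L := .ofExists m (fun b c l => inj
      ((hm _ _).trans ((app_smul s c _).trans (congrArg (c • ·) (hm _ _))).symm))
    fun b => by
      -- The image of a smooth section `l` of `L_f` is a smooth section of `L_g` that the inverse
      -- returns to `l`.
      obtain ⟨l, hl⟩ := f.exists_smooth (J := G.I.prod K.I) (b := b) (SmoothMapAt.val.fst)
        (SmoothMapAt.val.snd) fun q => q.2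
      exact ⟨_, hl.app s, hl.congr fun q => inj (hm q _).symm⟩
  let t : g ⟶ f := ofIso F
    (fun h hy q a => inj
      ((hm' _).trans ((app_lact s q _).trans (congrArg (g.lact q ·) (hm' a))).symm))
    (fun h hx a p => inj
      ((hm' _).trans ((app_ract s _ p).trans (congrArg (g.ract · p) (hm' a))).symm))
  refine ⟨t, hom_ext fun x y h => ?_, hom_ext fun x y h => ?_⟩
  · refine ⟨Classical.arbitrary _, ?_⟩
    rw [app_comp, app_id, app_ofIso]
    exact inj (hm' _)
  · refine ⟨Classical.arbitrary _, ?_⟩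
    rw [app_comp, app_id, app_ofIso]
    exact hm' _

end Transformations

end StableMorphism

/-! ## Stable morphisms from bimodules -/

/-- A `ℂˣ`-bundle on `X ×_M Y` with commuting actions of `Q` from the left and of `P` from the
right. -/
structure Bimodule (G K : BundleGerbe E M) where
  L : CBundle (G.I.prod K.I) (G.fp K.toLocallySplit)
  lact {x : G.X} {y₁ y₂ : K.X} {h : G.π x = K.π y₁} {hy : K.π y₁ = K.π y₂} (q : K.fib hy)
    (a : L.Fib ⟨(x, y₁), h⟩) : L.Fib ⟨(x, y₂), h.trans hy⟩
  ract {x₁ x₂ : G.X} {y : K.X} {h : G.π x₂ = K.π y} {hx : G.π x₁ = G.π x₂}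
    (a : L.Fib ⟨(x₂, y), h⟩) (p : G.fib hx) : L.Fib ⟨(x₁, y), hx.trans h⟩
  lact_smul {x : G.X} {y₁ y₂ : K.X} {h : G.π x = K.π y₁} {hy : K.π y₁ = K.π y₂} (c : ℂˣ)
    (q : K.fib hy) (a : L.Fib ⟨(x, y₁), h⟩) : lact q (c • a) = c • lact q a
  smul_lact {x : G.X} {y₁ y₂ : K.X} {h : G.π x = K.π y₁} {hy : K.π y₁ = K.π y₂} (c : ℂˣ)
    (q : K.fib hy) (a : L.Fib ⟨(x, y₁), h⟩) : lact (c • q) a = c • lact q a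
  smul_ract {x₁ x₂ : G.X} {y : K.X} {h : G.π x₂ = K.π y} {hx : G.π x₁ = G.π x₂} (c : ℂˣ)
    (a : L.Fib ⟨(x₂, y), h⟩) (p : G.fib hx) : ract (c • a) p = c • ract a p
  ract_smul {x₁ x₂ : G.X} {y : K.X} {h : G.π x₂ = K.π y} {hx : G.π x₁ = G.π x₂} (c : ℂˣ)
    (a : L.Fib ⟨(x₂, y), h⟩) (p : G.fib hx) : ract a (c • p) = c • ract a p
  lact_lact {x : G.X} {y₁ y₂ y₃ : K.X} {h : G.π x = K.π y₁} {hy : K.π y₁ = K.π y₂}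
    {hy' : K.π y₂ = K.π y₃} (q' : K.fib hy') (q : K.fib hy) (a : L.Fib ⟨(x, y₁), h⟩) :
    lact q' (lact q a) = lact (K.mul q' q) a
  ract_ract {x₁ x₂ x₃ : G.X} {y : K.X} {h : G.π x₃ = K.π y} {hx : G.π x₁ = G.π x₂}
    {hx' : G.π x₂ = G.π x₃} (a : L.Fib ⟨(x₃, y), h⟩) (p' : G.fib hx') (p : G.fib hx) :
    ract (ract a p') p = ract a (G.mul p' p)
  lact_ract {x₁ x₂ : G.X} {y₁ y₂ : K.X} {h : G.π x₂ = K.π y₁} {hx : G.π x₁ = G.π x₂}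
    {hy : K.π y₁ = K.π y₂} (q : K.fib hy) (a : L.Fib ⟨(x₂, y₁), h⟩) (p : G.fib hx) :
    lact q (ract a p) = ract (lact q a) p
  one_lact {x : G.X} {y : K.X} {h : G.π x = K.π y} (a : L.Fib ⟨(x, y), h⟩) :
    lact (K.one y) a = a
  ract_one {x : G.X} {y : K.X} {h : G.π x = K.π y} (a : L.Fib ⟨(x, y), h⟩) :
    ract a (G.one x) = a
  /-- the actions are smooth -/
  smooth : ∀ (b : G.fpSq K.toLocallySplit)
    (p : ∀ q : G.fpSq K.toLocallySplit, G.fib q.2.2.2)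
    (s : ∀ q : G.fpSq K.toLocallySplit, K.fib (q.2.1.symm.trans (q.2.2.2.trans q.2.2.1))),
    G.Smooth ((G.I.prod K.I).prod (G.I.prod K.I)) p b →
    K.Smooth ((G.I.prod K.I).prod (G.I.prod K.I)) s b →
    ∃ (l₁ : ∀ q : G.fpSq K.toLocallySplit, L.Fib ⟨q.1.1, q.2.1⟩)
      (l₂ : ∀ q : G.fpSq K.toLocallySplit, L.Fib ⟨q.1.2, q.2.2.1⟩),
      SmoothAlong ((G.I.prod K.I).prod (G.I.prod K.I)) L _ l₁ b ∧
      SmoothAlong ((G.I.prod K.I).prod (G.I.prod K.I)) L _ l₂ b ∧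
      ∀ q, ract (l₂ q) (p q) = lact (s q) (l₁ q)

namespace Bimodule

variable {G K : BundleGerbe E M} (B : Bimodule G K)

/-- The map `L(x₂, y₂) ⊗ L(x₁, y₁)* → P(x₁, x₂)* ⊗ Q(y₁, y₂)` defined by the actions. -/
def phi {x₁ x₂ : G.X} {y₁ y₂ : K.X} (h₁ : G.π x₁ = K.π y₁) (h₂ : G.π x₂ = K.π y₂)
    (hx : G.π x₁ = G.π x₂) :
    TensorTorsor (B.L.Fib ⟨(x₂, y₂), h₂⟩) (DualTorsor (B.L.Fib ⟨(x₁, y₁), h₁⟩)) →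
      TensorTorsor (DualTorsor (G.fib hx)) (K.fib (h₁.symm.trans (hx.trans h₂))) :=
  let p : G.fib hx := Classical.arbitrary _
  let s : K.fib (h₁.symm.trans (hx.trans h₂)) := Classical.arbitrary _
  lift (fun l₂ l₁ => (B.ract l₂ p /ₛ B.lact s l₁.undstar) • tmul (dstar p) s) fun c l₂ l₁ => by
    change _ = (B.ract l₂ p /ₛ B.lact s (c⁻¹ • l₁.undstar)) • tmul (dstar p) s
    rw [B.smul_ract, B.lact_smul, smul_sdiv_assoc, sdiv_smul_eq_sdiv_div, div_inv_eq_mul, mul_comm]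

theorem phi_smul {x₁ x₂ : G.X} {y₁ y₂ : K.X} (h₁ : G.π x₁ = K.π y₁) (h₂ : G.π x₂ = K.π y₂)
    (hx : G.π x₁ = G.π x₂) (c : ℂˣ)
    (t : TensorTorsor (B.L.Fib ⟨(x₂, y₂), h₂⟩) (DualTorsor (B.L.Fib ⟨(x₁, y₁), h₁⟩))) :
    B.phi h₁ h₂ hx (c • t) = c • B.phi h₁ h₂ hx t := by
  obtain ⟨l₂, l₁, rfl⟩ := exists_tmul t
  rw [smul_tmul, phi, lift_tmul, lift_tmul, B.smul_ract, smul_sdiv_assoc, mul_smul]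

variable {x x₁ x₂ : G.X} {y y₁ y₂ : K.X} {h₁ : G.π x₁ = K.π y₁} {h₂ : G.π x₂ = K.π y₂}
  {hx : G.π x₁ = G.π x₂} {hy : K.π y₁ = K.π y₂}

/-- Replacing `p`, `s` by `c p`, `d s` multiplies the quotient `(l₂ p) / (s l₁)` by `c d⁻¹` and `p*
⊗ s` by `c⁻¹ d`. The choices in the definition therefore cancel, and a pair with `l₂ p = s l₁` has
quotient `1`. -/
theorem phi_eq {l₁ : B.L.Fib ⟨(x₁, y₁), h₁⟩} {l₂ : B.L.Fib ⟨(x₂, y₂), h₂⟩} {p : G.fib hx}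
    {s : K.fib hy} (e : B.ract l₂ p = B.lact s l₁) :
    B.phi h₁ h₂ hx (tmul l₂ (dstar l₁)) = tmul (dstar p) s := by
  rw [phi, lift_tmul]
  generalize Classical.arbitrary (G.fib hx) = p₀
  generalize (Classical.arbitrary (K.fib (h₁.symm.trans (hx.trans h₂)))) = s₀
  obtain ⟨c, rfl⟩ : ∃ c : ℂˣ, p₀ = c • p := ⟨_, (sdiv_smul p₀ p).symm⟩
  obtain ⟨d, rfl⟩ : ∃ d : ℂˣ, s₀ = d • s := ⟨_, (sdiv_smul s₀ s).symm⟩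
  have h : tmul (dstar (c • p)) (d • s) = (c⁻¹ * d) • tmul (dstar p) s := by
    rw [mul_smul, smul_tmul_right, smul_tmul, smul_dstar, inv_inv]
  rw [h, B.ract_smul, B.smul_lact, e, smul_sdiv_assoc, sdiv_smul_eq_sdiv_div, sdiv_self,
    ← mul_smul, mul_mul_mul_comm]
  simp

theorem exists_phi_eq (l₁ : B.L.Fib ⟨(x₁, y₁), h₁⟩) (l₂ : B.L.Fib ⟨(x₂, y₂), h₂⟩) (p : G.fib hx) :
    ∃ s : K.fib (h₁.symm.trans (hx.trans h₂)), B.ract l₂ p = B.lact s l₁ :=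
  let ⟨s, hs⟩ := exists_of_equivariant (Φ := fun s => B.lact s l₁)
    (fun c s => B.smul_lact c s l₁) (B.ract l₂ p)
  ⟨s, hs.symm⟩

theorem phi_eq_iff {l₁ : B.L.Fib ⟨(x₁, y₁), h₁⟩} {l₂ : B.L.Fib ⟨(x₂, y₂), h₂⟩} {p : G.fib hx}
    {s : K.fib hy} :
    B.phi h₁ h₂ hx (tmul l₂ (dstar l₁)) = tmul (dstar p) s ↔ B.ract l₂ p = B.lact s l₁ := by
  refine ⟨fun e => ?_, B.phi_eq⟩
  obtain ⟨s', hs'⟩ := B.exists_phi_eq l₁ l₂ p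
  rw [hs', tmul_left_cancel (e.symm.trans (B.phi_eq hs'))]

/-- The stable morphism given by a bimodule. -/
def toStableMorphism : StableMorphism G K where
  L := B.L
  φ := .ofExists (fun b => B.phi b.2.1 b.2.2.1 b.2.2.2) (fun b => B.phi_smul _ _ _) fun b => by
    have hb := SmoothMapAt.val (J := (G.I.prod K.I).prod (G.I.prod K.I)) (p := b)
    obtain ⟨p, hp⟩ := G.exists_smooth hb.fst.fst hb.snd.fst fun q => q.2.2.2
    obtain ⟨s, hs⟩ := K.exists_smooth hb.fst.snd hb.snd.snd fun q =>
      q.2.1.symm.trans (q.2.2.2.trans q.2.2.1)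
    -- One smooth pair with `l₂ p = s l₁` is enough: `φ` sends the smooth section `l₂ ⊗ l₁*` to the
    -- smooth section `p* ⊗ s`.
    obtain ⟨l₁, l₂, hl₁, hl₂, e⟩ := B.smooth b p s hp hs
    exact ⟨fun q => tmul (l₂ q) (dstar (l₁ q)),
      SmoothAlong.tmul (SmoothAlong.pullback hb hl₂) (SmoothAlong.pullback hb hl₁).dstar,
      (StableMorphism.smooth_dualTensor (fun q => q.2.1) hp hs).congr fun q =>
        (B.phi_eq (e q)).symm⟩
  φ_mul x₁ x₂ x₃ y₁ y₂ y₃ h₁ h₂ h₃ hx₁₂ hx₂₃ hy₁₂ hy₂₃ l₁ l₂ l₃ p p' q q' e e' := by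
    replace e := B.phi_eq_iff.1 e
    replace e' := B.phi_eq_iff.1 e'
    refine B.phi_eq ?_
    -- `l₃ p p' = (q l₂) p' = q (l₂ p') = q q' l₁`.
    rw [← B.ract_ract, e, ← B.lact_ract, e', B.lact_lact]

/-- The action recovered from `φ` is the original one, because `(q a) 1 = q a` gives `φ(q a ⊗ a*) =
1* ⊗ q`. -/
theorem toStableMorphism_lact {h : G.π x = K.π y₁} (q : K.fib hy) (a : B.L.Fib ⟨(x, y₁), h⟩) :
    B.toStableMorphism.lact q a = B.lact q a :=
  (B.toStableMorphism.eq_lact (q := q) (a := a) (a' := B.lact q a)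
    (B.phi_eq (B.ract_one _))).symm

theorem toStableMorphism_ract {h : G.π x₂ = K.π y} (a : B.L.Fib ⟨(x₂, y), h⟩) (p : G.fib hx) :
    B.toStableMorphism.ract a p = B.ract a p :=
  (B.toStableMorphism.eq_ract (p := p) (a := a) (a' := B.ract a p)
    (B.phi_eq (B.one_lact _).symm)).symm

end Bimodule

end

noncomputable section

variable {E M : Type u} [NormedAddCommGroup E] [NormedSpace ℝ E] [TopologicalSpace M]
  [ChartedSpace E M]
variable {E' H' N' : Type u} [NormedAddCommGroup E'] [NormedSpace ℝ E'] [TopologicalSpace H']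
  {J : ModelWithCorners ℝ E' H'} [TopologicalSpace N'] [ChartedSpace H' N'] {T : Set N'} {b : T}

namespace LocallySplit

/-- A chosen point over `m`. -/
def pt (A : LocallySplit E M) (m : M) : A.X := Function.surjInv A.surjective_π m

theorem π_pt (A : LocallySplit E M) (m : M) : A.π (A.pt m) = m := Function.surjInv_eq _ _

theorem smooth_section (A B : LocallySplit E M) {σ : M → B.X} {x : T → A.X}
    (hσ : ∀ᶠ m in 𝓝 (A.π (x b)), ContMDiffAt 𝓘(ℝ, E) B.I ∞ σ m) (hx : SmoothMapAt J A.I x b) :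
    SmoothMapAt J B.I (fun q => σ (A.π (x q))) b :=
  (hx.comp_contMDiff A.smooth_π).comp hσ

theorem exists_smooth_lift (A B : LocallySplit E M) {x : T → A.X} (hx : SmoothMapAt J A.I x b) :
    ∃ y : T → B.X, (∀ q, A.π (x q) = B.π (y q)) ∧ SmoothMapAt J B.I y b :=
  let ⟨_, e, hσ⟩ := B.exists_section (A.π (x b))
  ⟨_, fun _ => (e _).symm, smooth_section A B hσ hx⟩

end LocallySplit

namespace StableMorphism

variable {G K R : BundleGerbe E M} (f : StableMorphism G K) (g : StableMorphism K R)

theorem smooth_sec {x : T → G.X} {y : T → K.X} {h : ∀ q, G.π (x q) = K.π (y q)}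
    (hx : SmoothMapAt J G.I x b) (hy : SmoothMapAt J K.I y b) {i : f.L.Idx}
    (hi : (⟨(x b, y b), h b⟩ : G.fp K.toLocallySplit) ∈ f.L.U i) :
    f.Smooth J (fun q => f.L.sec i ⟨(x q, y q), h q⟩) b :=
  SmoothAlong.sec (hx.prodMk hy) hi

/-! ## The bundle of a composite -/

/-- The fibre of `L_(g ∘ f)` at `(x, z)`, defined by means of a chosen point of `Y`. -/
abbrev CompFib {x : G.X} {z : R.X} (h : G.π x = R.π z) : Type u :=
  TensorTorsor (f.fib (x := x) (y := K.pt (G.π x)) (K.π_pt _).symm)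
    (g.fib (x := K.pt (G.π x)) (y := z) ((K.π_pt _).trans h))

namespace CompFib

variable {f g} {x : G.X} {y y' : K.X} {z : R.X} {h₁ : G.π x = K.π y} {h₂ : K.π y = R.π z}
  {h₁' : G.π x = K.π y'} {h₂' : K.π y' = R.π z}

/-- The element of `L_(g ∘ f)(x, z)` given by elements of `L_f(x, y)` and of `L_g(y, z)`. -/
def pair (a : f.fib h₁) (c : g.fib h₂) : CompFib f g (h₁.trans h₂) :=
  -- An arrow `s` of `Q` from `y` to the chosen middle point carries `a` there, and `s⁻¹` carries
  -- `c` there.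
  let s : K.fib (h₁.symm.trans (K.π_pt (G.π x)).symm) := Classical.arbitrary _
  tmul (f.lact s a) (g.ract c (K.inv s))

theorem pair_smul (d : ℂˣ) (a : f.fib h₁) (c : g.fib h₂) : pair a (d • c) = d • pair a c := by
  rw [pair, pair, smul_ract, smul_tmul_right]

theorem smul_pair (d : ℂˣ) (a : f.fib h₁) (c : g.fib h₂) : pair (d • a) c = d • pair a c := by
  rw [pair, pair, lact_smul, smul_tmul]

/-- Rescaling `s` scales the two factors inversely, so any transporting arrow gives the same
element. -/
theorem pair_eq (s : K.fib (h₁.symm.trans (K.π_pt (G.π x)).symm)) (a : f.fib h₁) (c : g.fib h₂) :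
    pair a c = tmul (f.lact s a) (g.ract c (K.inv s)) := by
  rw [pair]
  generalize Classical.arbitrary (K.fib (h₁.symm.trans (K.π_pt (G.π x)).symm)) = s'
  rw [← sdiv_smul s' s, smul_lact, K.inv_smul, ract_smul, smul_tmul_inv_smul]

/-- The relation of the tensor product over `Q`. If `s` transports from `y'`, use `s q` to transport
from `y`; then `c q (s q)⁻¹ = c s⁻¹`. -/
theorem pair_lact {hy : K.π y = K.π y'} (q : K.fib hy) (a : f.fib h₁) (c : g.fib h₂') :
    pair (f.lact q a) c = pair a (g.ract c q) := by
  let s : K.fib ((h₁.trans hy).symm.trans (K.π_pt (G.π x)).symm) := Classical.arbitrary _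
  rw [pair_eq s, pair_eq (K.mul s q) a, lact_lact, ract_ract, K.inv_mul_rev, ← K.mul_assoc, K.mul_inv,
    K.one_mul]

theorem exists_pair (a : f.fib h₁) (t : CompFib f g (h₁.trans h₂)) :
    ∃ c : g.fib h₂, t = pair a c :=
  let ⟨c, hc⟩ := exists_of_equivariant (Φ := fun c : g.fib h₂ => pair a c)
    (fun d c => pair_smul d a c) t
  ⟨c, hc.symm⟩

/-- This separates the quotient into one factor from each bundle after moving `a` to the other
middle point; smoothness of the transition functions of the composite bundle rests on it. -/
theorem pair_sdiv_pair (s : K.fib (h₁.symm.trans h₁')) (a : f.fib h₁) (c : g.fib h₂)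
    (a' : f.fib h₁') (c' : g.fib h₂') :
    pair a c /ₛ pair a' c' = (f.lact s a /ₛ a') * (c /ₛ g.ract c' s) := by
  obtain ⟨d, hd⟩ : ∃ d : ℂˣ, c = d • g.ract c' s := ⟨_, (sdiv_smul _ _).symm⟩
  obtain ⟨e, he⟩ : ∃ e : ℂˣ, f.lact s a = e • a' := ⟨_, (sdiv_smul _ _).symm⟩
  rw [hd, pair_smul, ← pair_lact, he, smul_pair, smul_sdiv, smul_sdiv, smul_sdiv_assoc, smul_sdiv,
    mul_comm]

/-- The map out of `L_(g ∘ f)(x, z)` given by a balanced family of maps. -/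
def desc {C : Type v} (h : G.π x = R.π z)
    (F : ∀ {y : K.X} (h₁ : G.π x = K.π y) (h₂ : K.π y = R.π z), f.fib h₁ → g.fib h₂ → C)
    (hF : ∀ {y : K.X} (h₁ : G.π x = K.π y) (h₂ : K.π y = R.π z) (d : ℂˣ) (a : f.fib h₁)
      (c : g.fib h₂), F h₁ h₂ (d • a) c = F h₁ h₂ a (d • c)) : CompFib f g h → C :=
  TensorTorsor.lift (F (K.π_pt _).symm ((K.π_pt _).trans h)) (hF _ _)

/-- Balance over `Q` removes the chosen middle point: `F(s a, c s⁻¹) = F(a, c s⁻¹ s) = F(a, c)`. -/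
theorem desc_pair {C : Type v}
    {F : ∀ {y : K.X} (h₁ : G.π x = K.π y) (h₂ : K.π y = R.π z), f.fib h₁ → g.fib h₂ → C}
    (hF : ∀ {y : K.X} (h₁ : G.π x = K.π y) (h₂ : K.π y = R.π z) (d : ℂˣ) (a : f.fib h₁)
      (c : g.fib h₂), F h₁ h₂ (d • a) c = F h₁ h₂ a (d • c))
    (hF' : ∀ {y y' : K.X} (h₁ : G.π x = K.π y) (hy : K.π y = K.π y') (h₂ : K.π y' = R.π z)
      (q : K.fib hy) (a : f.fib h₁) (c : g.fib h₂),
      F (h₁.trans hy) h₂ (f.lact q a) c = F h₁ (hy.trans h₂) a (g.ract c q))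
    (a : f.fib h₁) (c : g.fib h₂) : desc (h₁.trans h₂) F hF (pair a c) = F h₁ h₂ a c := by
  let s : K.fib (h₁.symm.trans (K.π_pt (G.π x)).symm) := Classical.arbitrary _
  rw [pair_eq s, desc, lift_tmul, hF' h₁, ract_ract, K.inv_mul, ract_one]

theorem exists_eq_pair {h : G.π x = R.π z} (t : CompFib f g h) :
    ∃ (y : K.X) (h₁ : G.π x = K.π y) (h₂ : K.π y = R.π z) (a : f.fib h₁) (c : g.fib h₂),
      t = pair a c :=
  ⟨_, (K.π_pt (G.π x)).symm, (K.π_pt _).trans h, Classical.arbitrary _, exists_pair _ t⟩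

/-- The left action on `L_(g ∘ f)`. -/
def lact {z' : R.X} {h : G.π x = R.π z} {hz : R.π z = R.π z'} (r : R.fib hz)
    (t : CompFib f g h) : CompFib f g (h.trans hz) :=
  desc h (fun _ _ a c => (pair a (g.lact r c) : CompFib f g (h.trans hz)))
    (fun _ _ d a c => by rw [smul_pair, StableMorphism.lact_smul, pair_smul]) t

/-- The right action on `L_(g ∘ f)`. -/
def ract {x' : G.X} {h : G.π x = R.π z} {hx : G.π x' = G.π x} (t : CompFib f g h)
    (p : G.fib hx) : CompFib f g (hx.trans h) :=
  desc h (fun _ _ a c => (pair (f.ract a p) c : CompFib f g (hx.trans h)))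
    (fun _ _ d a c => by rw [pair_smul, StableMorphism.smul_ract, smul_pair]) t

theorem lact_pair {z' : R.X} {hz : R.π z = R.π z'} (r : R.fib hz) (a : f.fib h₁)
    (c : g.fib h₂) : lact r (pair a c) = pair a (g.lact r c) :=
  desc_pair (fun _ _ d a c => by rw [smul_pair, StableMorphism.lact_smul, pair_smul])
    (fun _ _ _ q a c => by rw [pair_lact, lact_ract]) a c

theorem pair_ract {x' : G.X} {hx : G.π x' = G.π x} (a : f.fib h₁) (c : g.fib h₂)
    (p : G.fib hx) : ract (pair a c) p = pair (f.ract a p) c :=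
  desc_pair (fun _ _ d a c => by rw [pair_smul, StableMorphism.smul_ract, smul_pair])
    (fun _ _ _ q a c => by rw [← lact_ract, pair_lact]) a c

theorem lact_smul {z' : R.X} {h : G.π x = R.π z} {hz : R.π z = R.π z'} (d : ℂˣ) (r : R.fib hz)
    (t : CompFib f g h) : lact r (d • t) = d • lact r t := by
  obtain ⟨y, h₁, h₂, a, c, rfl⟩ := exists_eq_pair t
  rw [← smul_pair, lact_pair, lact_pair, smul_pair]

theorem smul_lact {z' : R.X} {h : G.π x = R.π z} {hz : R.π z = R.π z'} (d : ℂˣ) (r : R.fib hz)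
    (t : CompFib f g h) : lact (d • r) t = d • lact r t := by
  obtain ⟨y, h₁, h₂, a, c, rfl⟩ := exists_eq_pair t
  rw [lact_pair, lact_pair, g.smul_lact, pair_smul]

theorem smul_ract {x' : G.X} {h : G.π x = R.π z} {hx : G.π x' = G.π x} (d : ℂˣ)
    (t : CompFib f g h) (p : G.fib hx) : ract (d • t) p = d • ract t p := by
  obtain ⟨y, h₁, h₂, a, c, rfl⟩ := exists_eq_pair t
  rw [← pair_smul, pair_ract, pair_ract, pair_smul]

theorem ract_smul {x' : G.X} {h : G.π x = R.π z} {hx : G.π x' = G.π x} (d : ℂˣ)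
    (t : CompFib f g h) (p : G.fib hx) : ract t (d • p) = d • ract t p := by
  obtain ⟨y, h₁, h₂, a, c, rfl⟩ := exists_eq_pair t
  rw [pair_ract, pair_ract, f.ract_smul, smul_pair]

theorem lact_lact {z' z'' : R.X} {h : G.π x = R.π z} {hz : R.π z = R.π z'}
    {hz' : R.π z' = R.π z''} (r' : R.fib hz') (r : R.fib hz) (t : CompFib f g h) :
    lact r' (lact r t) = lact (R.mul r' r) t := by
  obtain ⟨y, h₁, h₂, a, c, rfl⟩ := exists_eq_pair t
  rw [lact_pair, lact_pair, lact_pair, g.lact_lact]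

theorem ract_ract {x' x'' : G.X} {h : G.π x = R.π z} {hx : G.π x' = G.π x}
    {hx' : G.π x'' = G.π x'} (t : CompFib f g h) (p' : G.fib hx) (p : G.fib hx') :
    ract (ract t p') p = ract t (G.mul p' p) := by
  obtain ⟨y, h₁, h₂, a, c, rfl⟩ := exists_eq_pair t
  rw [pair_ract, pair_ract, pair_ract, f.ract_ract]

theorem lact_ract {x' : G.X} {z' : R.X} {h : G.π x = R.π z} {hx : G.π x' = G.π x}
    {hz : R.π z = R.π z'} (r : R.fib hz) (t : CompFib f g h) (p : G.fib hx) :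
    lact r (ract t p) = ract (lact r t) p := by
  obtain ⟨y, h₁, h₂, a, c, rfl⟩ := exists_eq_pair t
  rw [pair_ract, lact_pair, lact_pair, pair_ract]

theorem one_lact {h : G.π x = R.π z} (t : CompFib f g h) : lact (R.one z) t = t := by
  obtain ⟨y, h₁, h₂, a, c, rfl⟩ := exists_eq_pair t
  rw [lact_pair, g.one_lact]

theorem ract_one {h : G.π x = R.π z} (t : CompFib f g h) : ract t (G.one x) = t := by
  obtain ⟨y, h₁, h₂, a, c, rfl⟩ := exists_eq_pair t
  rw [pair_ract, f.ract_one]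

end CompFib

open CompFib (pair pair_lact pair_smul smul_pair exists_pair exists_eq_pair lact_pair pair_ract
  desc_pair pair_sdiv_pair)

theorem smooth_pair_sdiv_pair {x : T → G.X} {y y' : T → K.X} {z : T → R.X}
    {h₁ : ∀ q, G.π (x q) = K.π (y q)} {h₂ : ∀ q, K.π (y q) = R.π (z q)}
    {h₁' : ∀ q, G.π (x q) = K.π (y' q)} {h₂' : ∀ q, K.π (y' q) = R.π (z q)}
    {a : ∀ q, f.fib (h₁ q)} {c : ∀ q, g.fib (h₂ q)} {a' : ∀ q, f.fib (h₁' q)}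
    {c' : ∀ q, g.fib (h₂' q)} (ha : f.Smooth J a b) (hc : g.Smooth J c b)
    (ha' : f.Smooth J a' b) (hc' : g.Smooth J c' b) :
    SmoothAtOn J T (fun q => pair (a q) (c q) /ₛ pair (a' q) (c' q)) b := by
  obtain ⟨s, hs⟩ := K.exists_smooth hc.map.fst hc'.map.fst fun q => (h₁ q).symm.trans (h₁' q)
  exact (((Smooth.lact hs ha).sdiv ha').mul (hc.sdiv (Smooth.ract hc' hs))).congr fun q =>
    (pair_sdiv_pair (s q) (a q) (c q) (a' q) (c' q)).symm

/-- The bundle `L_(g ∘ f)` on `X ×_M Z`. -/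
def compL : CBundle (G.I.prod R.I) (G.fp R.toLocallySplit) where
  Fib b := CompFib f g (x := b.1.1) (z := b.1.2) b.2
  -- The section `σ` is merely set-theoretic; `U` retains the pairs `(x, z)` for which `σ` is smooth
  -- near `π(x)`, an open condition. The trivialising section passes through the middle point
  -- `σ(π(x))`.
  Idx := {σ : M → K.X // ∀ m, K.π (σ m) = m} × f.L.Idx × g.L.Idx
  U i := {b | (∀ᶠ m in 𝓝 (G.π b.1.1), ContMDiffAt 𝓘(ℝ, E) K.I ∞ i.1.1 m) ∧
    (⟨(b.1.1, i.1.1 (G.π b.1.1)), (i.1.2 _).symm⟩ : G.fp K.toLocallySplit) ∈ f.L.U i.2.1 ∧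
    (⟨(i.1.1 (G.π b.1.1), b.1.2), (i.1.2 _).trans b.2⟩ : K.fp R.toLocallySplit) ∈ g.L.U i.2.2}
  isOpen_U := by
    rintro ⟨⟨σ, e⟩, i, j⟩
    refine isOpen_iff_mem_nhds.2 fun b ⟨h₁, h₂, h₃⟩ => ?_
    have hb := SmoothMapAt.val (J := G.I.prod R.I) (p := b)
    have hσ := LocallySplit.smooth_section G.toLocallySplit K.toLocallySplit h₁ hb.fst
    have hk : ContinuousAt (fun q : G.fp R.toLocallySplit =>
        (⟨(q.1.1, σ (G.π q.1.1)), (e _).symm⟩ : G.fp K.toLocallySplit)) b :=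
      Topology.IsInducing.subtypeVal.continuousAt_iff.2 (hb.fst.prodMk hσ).continuousAt
    have hk' : ContinuousAt (fun q : G.fp R.toLocallySplit =>
        (⟨(σ (G.π q.1.1), q.1.2), (e _).trans q.2⟩ : K.fp R.toLocallySplit)) b :=
      Topology.IsInducing.subtypeVal.continuousAt_iff.2 (hσ.prodMk hb.snd).continuousAt
    filter_upwards [(hb.fst.comp_contMDiff G.smooth_π).continuousAt.eventually
      (eventually_eventually_nhds.2 h₁), hk.eventually ((f.L.isOpen_U i).mem_nhds h₂),
      hk'.eventually ((g.L.isOpen_U j).mem_nhds h₃)] with q q₁ q₂ q₃ using ⟨q₁, q₂, q₃⟩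
  cover b := by
    obtain ⟨σ, e, hσ⟩ := K.exists_section (G.π b.1.1)
    obtain ⟨i, hi⟩ := f.L.cover ⟨(b.1.1, σ (G.π b.1.1)), (e _).symm⟩
    obtain ⟨j, hj⟩ := g.L.cover ⟨(σ (G.π b.1.1), b.1.2), (e _).trans b.2⟩
    exact ⟨(⟨σ, e⟩, i, j), hσ, hi, hj⟩
  sec i b := pair (f.L.sec i.2.1 ⟨(b.1.1, i.1.1 (G.π b.1.1)), (i.1.2 _).symm⟩)
    (g.L.sec i.2.2 ⟨(i.1.1 (G.π b.1.1), b.1.2), (i.1.2 _).trans b.2⟩)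
  smooth_transition i j b hi hj := by
    have hb := SmoothMapAt.val (J := G.I.prod R.I) (p := b)
    have hσ := LocallySplit.smooth_section G.toLocallySplit K.toLocallySplit hi.1 hb.fst
    have hτ := LocallySplit.smooth_section G.toLocallySplit K.toLocallySplit hj.1 hb.fst
    exact smooth_pair_sdiv_pair f g (J := G.I.prod R.I)
      (f.smooth_sec hb.fst hσ hi.2.1) (g.smooth_sec hσ hb.snd hi.2.2)
      (f.smooth_sec hb.fst hτ hj.2.1) (g.smooth_sec hτ hb.snd hj.2.2)

variable {f g} in
theorem smooth_compL_pair {x : T → G.X} {y : T → K.X} {z : T → R.X}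
    {h₁ : ∀ q, G.π (x q) = K.π (y q)} {h₂ : ∀ q, K.π (y q) = R.π (z q)}
    {a : ∀ q, f.fib (h₁ q)} {c : ∀ q, g.fib (h₂ q)}
    (ha : f.Smooth J a b) (hc : g.Smooth J c b) :
    SmoothAlong J (compL f g) (fun q => ⟨(x q, z q), (h₁ q).trans (h₂ q)⟩)
      (fun q => pair (a q) (c q)) b := by
  refine ⟨ha.map.fst.prodMk hc.map.snd, fun i hi => ?_⟩
  have hσ := LocallySplit.smooth_section G.toLocallySplit K.toLocallySplit hi.1 ha.map.fst
  exact smooth_pair_sdiv_pair f g ha hc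
    (f.smooth_sec ha.map.fst hσ hi.2.1) (g.smooth_sec hσ hc.map.snd hi.2.2)

/-- The bimodule of the composite. -/
def compBimodule : Bimodule G R where
  L := compL f g
  lact {_ _ _ h _} r t := CompFib.lact (h := h) r t
  ract {_ _ _ h _} t p := CompFib.ract (h := h) t p
  lact_smul {_ _ _ h _} d r t := CompFib.lact_smul (h := h) d r t
  smul_lact {_ _ _ h _} d r t := CompFib.smul_lact (h := h) d r t
  smul_ract {_ _ _ h _} d t p := CompFib.smul_ract (h := h) d t p
  ract_smul {_ _ _ h _} d t p := CompFib.ract_smul (h := h) d t p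
  lact_lact {_ _ _ _ h _ _} r' r t := CompFib.lact_lact (h := h) r' r t
  ract_ract {_ _ _ _ h _ _} t p' p := CompFib.ract_ract (h := h) t p' p
  lact_ract {_ _ _ _ h _ _} r t p := CompFib.lact_ract (h := h) r t p
  one_lact {_ _ h} t := CompFib.one_lact (h := h) t
  ract_one {_ _ h} t := CompFib.ract_one (h := h) t
  smooth b p s hp hs := by
    obtain ⟨y, e, hy⟩ := G.exists_smooth_lift K.toLocallySplit hp.map.fst
    obtain ⟨a, ha⟩ := f.exists_smooth hp.map.fst hy e
    obtain ⟨c, hc⟩ := g.exists_smooth hy hs.map.fst fun q => (e q).symm.trans q.2.1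
    -- With `l₁ = a ⊗ c` and `l₂ = (a p⁻¹) ⊗ (s c)`, both `l₂ p` and `s l₁` equal `a ⊗ (s c)`.
    refine ⟨fun q => pair (a q) (c q), fun q => pair (f.ract (a q) (G.inv (p q))) (g.lact (s q) (c q)),
      smooth_compL_pair ha hc, smooth_compL_pair (ha.ract hp.inv) (Smooth.lact hs hc), fun q => ?_⟩
    refine (pair_ract _ _ _).trans (Eq.trans ?_ (lact_pair (s q) (a q) (c q)).symm)
    rw [f.ract_ract, G.inv_mul, f.ract_one]

/-- The composite `g ∘ f` of stable morphisms. -/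
def comp : StableMorphism G R := (compBimodule f g).toStableMorphism

/-! ### Elements of the composite -/

section Elements

variable {f g} {x : G.X} {y y' : K.X} {z : R.X} {h₁ : G.π x = K.π y} {h₂ : K.π y = R.π z}

/-- The element of `L_(g ∘ f)(x, z)` given by elements of `L_f(x, y)` and of `L_g(y, z)`. -/
def compMk (a : f.fib h₁) (c : g.fib h₂) : (comp f g).fib (h₁.trans h₂) := pair a c

theorem compMk_smul (d : ℂˣ) (a : f.fib h₁) (c : g.fib h₂) :
    compMk a (d • c) = d • compMk a c := pair_smul d a c

theorem smul_compMk (d : ℂˣ) (a : f.fib h₁) (c : g.fib h₂) :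
    compMk (d • a) c = d • compMk a c := smul_pair d a c

theorem compMk_lact {hy : K.π y = K.π y'} {h₂ : K.π y' = R.π z} (q : K.fib hy) (a : f.fib h₁)
    (c : g.fib h₂) : compMk (f.lact q a) c = compMk a (g.ract c q) := pair_lact q a c

theorem exists_eq_compMk {h : G.π x = R.π z} (t : (comp f g).fib h) :
    ∃ (y : K.X) (h₁ : G.π x = K.π y) (h₂ : K.π y = R.π z) (a : f.fib h₁) (c : g.fib h₂),
      t = compMk a c := exists_eq_pair (h := h) t

theorem lact_compMk {z' : R.X} {hz : R.π z = R.π z'} (r : R.fib hz) (a : f.fib h₁)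
    (c : g.fib h₂) : (comp f g).lact r (compMk a c) = compMk a (g.lact r c) :=
  ((compBimodule f g).toStableMorphism_lact r _).trans (lact_pair r a c)

theorem ract_compMk {x' : G.X} {hx : G.π x' = G.π x} (a : f.fib h₁) (c : g.fib h₂)
    (p : G.fib hx) : (comp f g).ract (compMk a c) p = compMk (f.ract a p) c :=
  ((compBimodule f g).toStableMorphism_ract _ p).trans (pair_ract a c p)

theorem Smooth.compMk {x : T → G.X} {y : T → K.X} {z : T → R.X}
    {h₁ : ∀ q, G.π (x q) = K.π (y q)} {h₂ : ∀ q, K.π (y q) = R.π (z q)}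
    {a : ∀ q, f.fib (h₁ q)} {c : ∀ q, g.fib (h₂ q)}
    (ha : f.Smooth J a b) (hc : g.Smooth J c b) :
    (comp f g).Smooth J (fun q => compMk (a q) (c q)) b :=
  smooth_compL_pair ha hc

end Elements

/-! ### Transformations out of a composite -/

/-- A map out of the fibres of `L_(g ∘ f)` that commutes with the actions. -/
structure Balanced (k : StableMorphism G R) where
  map {x : G.X} {y : K.X} {z : R.X} {h₁ : G.π x = K.π y} {h₂ : K.π y = R.π z} (a : f.fib h₁)
    (c : g.fib h₂) : k.fib (h₁.trans h₂)
  smul_map {x : G.X} {y : K.X} {z : R.X} {h₁ : G.π x = K.π y} {h₂ : K.π y = R.π z} (d : ℂˣ)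
    (a : f.fib h₁) (c : g.fib h₂) : map (d • a) c = d • map a c
  map_smul {x : G.X} {y : K.X} {z : R.X} {h₁ : G.π x = K.π y} {h₂ : K.π y = R.π z} (d : ℂˣ)
    (a : f.fib h₁) (c : g.fib h₂) : map a (d • c) = d • map a c
  map_lact {x : G.X} {y y' : K.X} {z : R.X} {h₁ : G.π x = K.π y} {hy : K.π y = K.π y'}
    {h₂ : K.π y' = R.π z} (q : K.fib hy) (a : f.fib h₁) (c : g.fib h₂) :
    map (f.lact q a) c = map a (g.ract c q)
  lact_map {x : G.X} {y : K.X} {z z' : R.X} {h₁ : G.π x = K.π y} {h₂ : K.π y = R.π z}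
    {hz : R.π z = R.π z'} (r : R.fib hz) (a : f.fib h₁) (c : g.fib h₂) :
    map a (g.lact r c) = k.lact r (map a c)
  ract_map {x x' : G.X} {y : K.X} {z : R.X} {h₁ : G.π x = K.π y} {h₂ : K.π y = R.π z}
    {hx : G.π x' = G.π x} (a : f.fib h₁) (c : g.fib h₂) (p : G.fib hx) :
    map (f.ract a p) c = k.ract (map a c) p
  smooth {x : G.fp R.toLocallySplit → G.X} {y : G.fp R.toLocallySplit → K.X}
    {z : G.fp R.toLocallySplit → R.X} {h₁ : ∀ q, G.π (x q) = K.π (y q)}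
    {h₂ : ∀ q, K.π (y q) = R.π (z q)} {a : ∀ q, f.fib (h₁ q)} {c : ∀ q, g.fib (h₂ q)}
    {b : G.fp R.toLocallySplit} : f.Smooth (G.I.prod R.I) a b → g.Smooth (G.I.prod R.I) c b →
    k.Smooth (G.I.prod R.I) (fun q => map (a q) (c q)) b

variable {f g} {k : StableMorphism G R}

theorem Balanced.smul_map_comm (F : Balanced f g k) {x : G.X} {y : K.X} {z : R.X}
    (h₁ : G.π x = K.π y) (h₂ : K.π y = R.π z) (d : ℂˣ) (a : f.fib h₁) (c : g.fib h₂) :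
    F.map (d • a) c = F.map a (d • c) := by
  rw [F.smul_map, F.map_smul]

/-- The map on fibres given by a balanced map. -/
def Balanced.descMap (F : Balanced f g k) {x : G.X} {z : R.X} (h : G.π x = R.π z)
    (t : (comp f g).fib h) : k.fib h :=
  CompFib.desc h (fun h₁ h₂ a c => F.map (h₁ := h₁) (h₂ := h₂) a c) F.smul_map_comm t

theorem Balanced.descMap_compMk (F : Balanced f g k) {x : G.X} {y : K.X} {z : R.X}
    {h₁ : G.π x = K.π y} {h₂ : K.π y = R.π z} (a : f.fib h₁) (c : g.fib h₂) :
    F.descMap (h₁.trans h₂) (compMk a c) = F.map a c :=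
  desc_pair (C := k.fib (h₁.trans h₂)) (f := f) (g := g)
    (F := fun h₁ h₂ a c => F.map (h₁ := h₁) (h₂ := h₂) a c) F.smul_map_comm
    (fun _ _ _ q a c => F.map_lact q a c) a c

theorem Balanced.descMap_smul (F : Balanced f g k) {x : G.X} {z : R.X} (h : G.π x = R.π z)
    (d : ℂˣ) (t : (comp f g).fib h) : F.descMap h (d • t) = d • F.descMap h t := by
  obtain ⟨y, h₁, h₂, a, c, rfl⟩ := exists_eq_compMk t
  rw [← compMk_smul, F.descMap_compMk, F.descMap_compMk, F.map_smul]

/-- The transformation `g ∘ f ⇒ k` given by a balanced map. -/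
def Balanced.desc (F : Balanced f g k) : comp f g ⟶ k :=
  ofIso (.ofExists (fun b => F.descMap b.2) (fun b => F.descMap_smul b.2)
    fun b => by
      have hb := SmoothMapAt.val (J := G.I.prod R.I) (p := b)
      obtain ⟨y, e, hy⟩ := G.exists_smooth_lift K.toLocallySplit hb.fst
      obtain ⟨a, ha⟩ := f.exists_smooth hb.fst hy e
      obtain ⟨c, hc⟩ := g.exists_smooth hy hb.snd fun q => (e q).symm.trans q.2
      -- A section `a ⊗ c` through a smooth choice of middle points is the one smooth section to be
      -- tested.
      exact ⟨_, ha.compMk hc, (F.smooth ha hc).congr fun q => (F.descMap_compMk _ _).symm⟩)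
    (fun h hz r t => by
      change F.descMap _ _ = k.lact r (F.descMap _ _)
      obtain ⟨y, h₁, h₂, a, c, rfl⟩ := exists_eq_compMk t
      rw [lact_compMk, F.descMap_compMk, F.descMap_compMk, F.lact_map])
    (fun h hx t p => by
      change F.descMap _ _ = k.ract (F.descMap _ _) p
      obtain ⟨y, h₁, h₂, a, c, rfl⟩ := exists_eq_compMk t
      rw [ract_compMk, F.descMap_compMk, F.descMap_compMk, F.ract_map])

theorem Balanced.app_desc (F : Balanced f g k) {x : G.X} {y : K.X} {z : R.X} {h₁ : G.π x = K.π y}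
    {h₂ : K.π y = R.π z} (a : f.fib h₁) (c : g.fib h₂) :
    app F.desc (compMk a c) = F.map a c :=
  (app_ofIso _ _ (compMk a c)).trans (F.descMap_compMk a c)

/-- Transformations out of a composite agree if they agree on elements of the form `a ⊗ c`. -/
theorem comp_hom_ext {s t : comp f g ⟶ k} (e : ∀ {x : G.X} {y : K.X} {z : R.X}
    {h₁ : G.π x = K.π y} {h₂ : K.π y = R.π z} (a : f.fib h₁) (c : g.fib h₂),
    app s (compMk a c) = app t (compMk a c)) : s = t :=
  hom_ext fun _ _ h =>
    -- The arbitrary element only supplies a middle point and elements `a`, `c` of the two fibres.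
    let ⟨_, _, _, a, c, _⟩ := exists_eq_compMk (Classical.arbitrary ((comp f g).fib h))
    ⟨compMk a c, e a c⟩

end StableMorphism

end

noncomputable section

variable {E M : Type u} [NormedAddCommGroup E] [NormedSpace ℝ E] [TopologicalSpace M]
  [ChartedSpace E M]
variable {E' H' N' : Type u} [NormedAddCommGroup E'] [NormedSpace ℝ E'] [TopologicalSpace H']
  {J : ModelWithCorners ℝ E' H'} [TopologicalSpace N'] [ChartedSpace H' N'] {T : Set N'} {b : T}

namespace StableMorphism

/-! ## Identities -/

/-- The bimodule `P` of the identity. -/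
def idBimodule (G : BundleGerbe E M) : Bimodule G G where
  L := G.P
  lact q a := G.mul q a
  ract a p := G.mul a p
  lact_smul c q a := G.mul_smul c q a
  smul_lact c q a := G.smul_mul c q a
  smul_ract c a p := G.smul_mul c a p
  ract_smul c a p := G.mul_smul c a p
  lact_lact q' q a := (G.mul_assoc q' q a).symm
  ract_ract a p' p := G.mul_assoc a p' p
  lact_ract q a p := (G.mul_assoc q a p).symm
  one_lact a := G.one_mul a
  ract_one a := G.mul_one a
  smooth b p s hp hs := by
    obtain ⟨v, hv⟩ := G.exists_smooth hp.map.fst hs.map.fst fun q => q.2.1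
    -- The second section solves `l₂ p = s v`.
    refine ⟨v, fun q => G.mul (G.mul (s q) (v q)) (G.inv (p q)), hv, (hs.mul hv).mul hp.inv,
      fun q => ?_⟩
    rw [G.mul_assoc, G.inv_mul, G.mul_one]

/-- The identity stable morphism. -/
def identity (G : BundleGerbe E M) : StableMorphism G G := (idBimodule G).toStableMorphism

/-- An element of `P` as an element of the bundle of the identity. -/
def idMk {G : BundleGerbe E M} {x y : G.X} {h : G.π x = G.π y} (v : G.fib h) :
    (identity G).fib h := v

/-- The element of `P` underlying an element of the bundle of the identity. -/
def idVal {G : BundleGerbe E M} {x y : G.X} {h : G.π x = G.π y} (v : (identity G).fib h) :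
    G.fib h := v

theorem idVal_idMk {G : BundleGerbe E M} {x y : G.X} {h : G.π x = G.π y}
    (v : G.fib h) : idVal (idMk v) = v := rfl

theorem idMk_smul {G : BundleGerbe E M} {x y : G.X} {h : G.π x = G.π y} (c : ℂˣ)
    (v : G.fib h) : idMk (c • v) = c • idMk v := rfl

theorem idVal_smul {G : BundleGerbe E M} {x y : G.X} {h : G.π x = G.π y} (c : ℂˣ)
    (v : (identity G).fib h) : idVal (c • v) = c • idVal v := rfl

theorem identity_lact {G : BundleGerbe E M} {x y y' : G.X} {h : G.π x = G.π y}
    {hy : G.π y = G.π y'} (q : G.fib hy) (v : (identity G).fib h) :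
    (identity G).lact q v = idMk (G.mul q (idVal v)) :=
  (idBimodule G).toStableMorphism_lact q v

theorem identity_ract {G : BundleGerbe E M} {x x' y : G.X} {h : G.π x = G.π y}
    {hx : G.π x' = G.π x} (v : (identity G).fib h) (p : G.fib hx) :
    (identity G).ract v p = idMk (G.mul (idVal v) p) :=
  (idBimodule G).toStableMorphism_ract v p

theorem Smooth.idVal {G : BundleGerbe E M} {x y : T → G.X} {h : ∀ q, G.π (x q) = G.π (y q)}
    {v : ∀ q, (identity G).fib (h q)} (hv : (identity G).Smooth J v b) :
    G.Smooth J (fun q => idVal (v q)) b := hv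

theorem smooth_idMk {G : BundleGerbe E M} {x y : T → G.X} {h : ∀ q, G.π (x q) = G.π (y q)}
    {v : ∀ q, G.fib (h q)} (hv : G.Smooth J v b) :
    (identity G).Smooth J (fun q => idMk (v q)) b := hv

variable {G K R Q : BundleGerbe E M}

/-! ## Whiskering, associators and unitors -/

/-- Horizontal composition with an identity on the left. -/
def whiskerLeft (f : StableMorphism G K) {g g' : StableMorphism K R} (ρ : g ⟶ g') :
    comp f g ⟶ comp f g' :=
  Balanced.desc
    { map := fun a c => compMk a (app ρ c)
      smul_map := fun d a c => smul_compMk d a _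
      map_smul := fun d a c => by rw [app_smul, compMk_smul]
      map_lact := fun q a c => by rw [compMk_lact, app_ract]
      lact_map := fun r a c => by rw [app_lact, lact_compMk]
      ract_map := fun a c p => by rw [ract_compMk]
      smooth := fun ha hc => ha.compMk (hc.app ρ) }

/-- Horizontal composition with an identity on the right. -/
def whiskerRight {f f' : StableMorphism G K} (θ : f ⟶ f') (g : StableMorphism K R) :
    comp f g ⟶ comp f' g :=
  Balanced.desc
    { map := fun a c => compMk (app θ a) c
      smul_map := fun d a c => by rw [app_smul, smul_compMk]
      map_smul := fun d a c => compMk_smul d _ c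
      map_lact := fun q a c => by rw [app_lact, compMk_lact]
      lact_map := fun r a c => by rw [lact_compMk]
      ract_map := fun a c p => by rw [app_ract, ract_compMk]
      smooth := fun ha hc => (ha.app θ).compMk hc }

theorem app_whiskerLeft (f : StableMorphism G K) {g g' : StableMorphism K R} (ρ : g ⟶ g')
    {x : G.X} {y : K.X} {z : R.X} {h₁ : G.π x = K.π y} {h₂ : K.π y = R.π z} (a : f.fib h₁)
    (c : g.fib h₂) : app (whiskerLeft f ρ) (compMk a c) = compMk a (app ρ c) :=
  Balanced.app_desc _ a c

theorem app_whiskerRight {f f' : StableMorphism G K} (θ : f ⟶ f') (g : StableMorphism K R)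
    {x : G.X} {y : K.X} {z : R.X} {h₁ : G.π x = K.π y} {h₂ : K.π y = R.π z} (a : f.fib h₁)
    (c : g.fib h₂) : app (whiskerRight θ g) (compMk a c) = compMk (app θ a) c :=
  Balanced.app_desc _ a c

section Associator

variable {f : StableMorphism G K} {g : StableMorphism K R} {k : StableMorphism R Q}
  {x : G.X} {y : K.X} {z : R.X} {t : Q.X}

/-- The map `(a ⊗ b) ⊗ c ↦ a ⊗ (b ⊗ c)`. -/
def assocMap {h₁ : G.π x = R.π z} {h₂ : R.π z = Q.π t} (l : (comp f g).fib h₁) (c : k.fib h₂) :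
    (comp f (comp g k)).fib (h₁.trans h₂) :=
  CompFib.desc (C := (comp f (comp g k)).fib (h₁.trans h₂)) (f := f) (g := g) h₁
    (fun _ _ a b => compMk a (compMk b c))
    (fun _ _ d a b => by rw [smul_compMk, smul_compMk, compMk_smul]) l

theorem assocMap_compMk {h₁ : G.π x = K.π y} {h₂ : K.π y = R.π z} {h₃ : R.π z = Q.π t}
    (a : f.fib h₁) (b : g.fib h₂) (c : k.fib h₃) :
    assocMap (compMk a b) c = compMk a (compMk b c) :=
  CompFib.desc_pair (C := (comp f (comp g k)).fib (h₁.trans (h₂.trans h₃))) (f := f) (g := g)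
    (F := fun _ _ a b => compMk a (compMk b c))
    (fun _ _ d a b => by rw [smul_compMk, smul_compMk, compMk_smul])
    (fun _ _ _ q a b => by rw [compMk_lact, ract_compMk]) a b

theorem assocMap_smul_left {h₁ : G.π x = R.π z} {h₂ : R.π z = Q.π t} (d : ℂˣ)
    (l : (comp f g).fib h₁) (c : k.fib h₂) : assocMap (d • l) c = d • assocMap l c := by
  obtain ⟨y, k₁, k₂, a, b, rfl⟩ := exists_eq_compMk l
  rw [← smul_compMk, assocMap_compMk, assocMap_compMk, smul_compMk]

/-- A smooth `l` need not be given as `a ⊗ m`. For fixed `c` the map is equivariant in `l`, so the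
case of one smooth section `a ⊗ m` suffices. -/
theorem smooth_assocMap {x : T → G.X} {z : T → R.X} {t : T → Q.X}
    {h₁ : ∀ q, G.π (x q) = R.π (z q)} {h₂ : ∀ q, R.π (z q) = Q.π (t q)}
    {l : ∀ q, (comp f g).fib (h₁ q)} {c : ∀ q, k.fib (h₂ q)} (hl : (comp f g).Smooth J l b)
    (hc : k.Smooth J c b) : (comp f (comp g k)).Smooth J (fun q => assocMap (l q) (c q)) b := by
  obtain ⟨y, e, hy⟩ := G.exists_smooth_lift K.toLocallySplit hl.map.fst
  obtain ⟨a, ha⟩ := f.exists_smooth hl.map.fst hy e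
  obtain ⟨m, hm⟩ := g.exists_smooth hy hl.map.snd fun q => (e q).symm.trans (h₁ q)
  exact SmoothAlong.map_of_exists (L' := (comp f (comp g k)).L)
    (Φ := fun q l => assocMap l (c q)) (fun q d l => assocMap_smul_left d l (c q))
    (ha.compMk hm) ((ha.compMk (hm.compMk hc)).congr fun q => (assocMap_compMk _ _ _).symm) hl

variable (f g k) in
/-- The associativity transformation. -/
def assocHom : comp (comp f g) k ⟶ comp f (comp g k) :=
  Balanced.desc
    { map := fun l c => assocMap l c
      smul_map := assocMap_smul_left
      map_smul := fun d l c => by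
        obtain ⟨y, k₁, k₂, a, b, rfl⟩ := exists_eq_compMk l
        rw [assocMap_compMk, assocMap_compMk, compMk_smul, compMk_smul]
      map_lact := fun q l c => by
        obtain ⟨y, k₁, k₂, a, b, rfl⟩ := exists_eq_compMk l
        rw [lact_compMk, assocMap_compMk, assocMap_compMk, compMk_lact]
      lact_map := fun r l c => by
        obtain ⟨y, k₁, k₂, a, b, rfl⟩ := exists_eq_compMk l
        rw [assocMap_compMk, assocMap_compMk, lact_compMk, lact_compMk]
      ract_map := fun l c p => by
        obtain ⟨y, k₁, k₂, a, b, rfl⟩ := exists_eq_compMk l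
        rw [ract_compMk, assocMap_compMk, assocMap_compMk, ract_compMk]
      smooth := smooth_assocMap }

theorem app_assocHom {h₁ : G.π x = K.π y} {h₂ : K.π y = R.π z} {h₃ : R.π z = Q.π t}
    (a : f.fib h₁) (b : g.fib h₂) (c : k.fib h₃) :
    app (assocHom f g k) (compMk (compMk a b) c) = compMk a (compMk b c) :=
  (Balanced.app_desc _ _ c).trans (assocMap_compMk a b c)

end Associator

/-- The transformation `f ∘ 1 ⇒ f`. -/
def leftUnitHom (f : StableMorphism G K) : comp (identity G) f ⟶ f :=
  Balanced.desc
    { map := fun v c => f.ract c (idVal v)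
      smul_map := fun d v c => by rw [idVal_smul, ract_smul]
      map_smul := fun d v c => f.smul_ract d c _
      map_lact := fun q v c => by rw [identity_lact, idVal_idMk, ract_ract]
      lact_map := fun r v c => (f.lact_ract r c _).symm
      ract_map := fun v c p => by rw [identity_ract, idVal_idMk, ract_ract]
      smooth := fun hv hc => hc.ract hv.idVal }

/-- The transformation `1 ∘ f ⇒ f`. -/
def rightUnitHom (f : StableMorphism G K) : comp f (identity K) ⟶ f :=
  Balanced.desc
    { map := fun a v => f.lact (idVal v) a
      smul_map := fun d a v => f.lact_smul d _ a
      map_smul := fun d a v => by rw [idVal_smul, smul_lact]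
      map_lact := fun q a v => by rw [identity_ract, idVal_idMk, lact_lact]
      lact_map := fun r a v => by rw [identity_lact, idVal_idMk, lact_lact]
      ract_map := fun a v p => f.lact_ract _ a p
      smooth := fun ha hv => Smooth.lact hv.idVal ha }

theorem app_leftUnitHom (f : StableMorphism G K) {x x' : G.X} {y : K.X} {h₁ : G.π x = G.π x'}
    {h₂ : G.π x' = K.π y} (v : (identity G).fib h₁) (c : f.fib h₂) :
    app (leftUnitHom f) (compMk v c) = f.ract c (idVal v) :=
  Balanced.app_desc _ v c

theorem app_rightUnitHom (f : StableMorphism G K) {x : G.X} {y y' : K.X} {h₁ : G.π x = K.π y}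
    {h₂ : K.π y = K.π y'} (a : f.fib h₁) (v : (identity K).fib h₂) :
    app (rightUnitHom f) (compMk a v) = f.lact (idVal v) a :=
  Balanced.app_desc _ a v

/-- A transformation as an isomorphism. -/
def toIso {f g : StableMorphism G K} (s : f ⟶ g) : f ≅ g := @asIso _ _ _ _ s (isIso s)

theorem toIso_hom {f g : StableMorphism G K} (s : f ⟶ g) : (toIso s).hom = s := rfl

end StableMorphism

/-! ### The bicategory axioms, checked on elements -/

open StableMorphism

/-- The bicategory of bundle gerbes, stable morphisms and transformations. -/
def stableBicategory (E M : Type u) [NormedAddCommGroup E] [NormedSpace ℝ E] [TopologicalSpace M]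
    [ChartedSpace E M] : BicategoryOn (StableMorphism (E := E) (M := M)) where
  id := identity
  comp := comp
  whiskerLeft := whiskerLeft
  whiskerRight := whiskerRight
  associator f g k := toIso (assocHom f g k)
  leftUnitor f := toIso (leftUnitHom f)
  rightUnitor f := toIso (rightUnitHom f)
  whiskerLeft_id f g := comp_hom_ext fun a c => by rw [app_whiskerLeft, app_id, app_id]
  whiskerLeft_comp f _ _ _ η θ := comp_hom_ext fun a c => by
    rw [app_comp, app_whiskerLeft, app_whiskerLeft, app_whiskerLeft, app_comp]
  id_whiskerLeft η := by
    -- Formulas on elements are available for the structural 2-arrows but not for their inverses, so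
    -- the inverse is first moved to the other side.
    rw [← Category.assoc, Iso.eq_comp_inv]
    refine comp_hom_ext fun a c => ?_
    rw [toIso_hom, toIso_hom, app_comp, app_comp, app_whiskerLeft, app_leftUnitHom,
      app_leftUnitHom, app_ract]
  comp_whiskerLeft f g _ _ η := by
    rw [← Category.assoc, Iso.eq_comp_inv]
    refine comp_hom_ext fun l c => ?_
    obtain ⟨y, k₁, k₂, a, b, rfl⟩ := exists_eq_compMk l
    rw [toIso_hom, toIso_hom, app_comp, app_comp, app_whiskerLeft, app_assocHom, app_assocHom,
      app_whiskerLeft, app_whiskerLeft]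
  id_whiskerRight f g := comp_hom_ext fun a c => by rw [app_whiskerRight, app_id, app_id]
  comp_whiskerRight η θ i := comp_hom_ext fun a c => by
    rw [app_comp, app_whiskerRight, app_whiskerRight, app_whiskerRight, app_comp]
  whiskerRight_id η := by
    rw [← Category.assoc, Iso.eq_comp_inv]
    refine comp_hom_ext fun a c => ?_
    rw [toIso_hom, toIso_hom, app_comp, app_comp, app_whiskerRight, app_rightUnitHom,
      app_rightUnitHom, app_lact]
  whiskerRight_comp η g h := by
    rw [Iso.eq_inv_comp]
    refine comp_hom_ext fun l c => ?_
    obtain ⟨y, k₁, k₂, a, b, rfl⟩ := exists_eq_compMk l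
    rw [toIso_hom, toIso_hom, app_comp, app_comp, app_whiskerRight, app_assocHom,
      app_whiskerRight, app_whiskerRight, app_assocHom]
  whisker_assoc f _ _ η h := by
    rw [← Category.assoc, Iso.eq_comp_inv]
    refine comp_hom_ext fun l c => ?_
    obtain ⟨y, k₁, k₂, a, b, rfl⟩ := exists_eq_compMk l
    rw [toIso_hom, toIso_hom, app_comp, app_comp, app_whiskerRight, app_whiskerLeft,
      app_assocHom, app_assocHom, app_whiskerLeft, app_whiskerRight]
  whisker_exchange η θ := comp_hom_ext fun a c => by
    rw [app_comp, app_comp, app_whiskerLeft, app_whiskerRight, app_whiskerRight, app_whiskerLeft]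
  pentagon f g h i := by
    refine comp_hom_ext fun l d => ?_
    obtain ⟨z, k₁, k₂, l, c, rfl⟩ := exists_eq_compMk l
    obtain ⟨y, k₃, k₄, a, b, rfl⟩ := exists_eq_compMk l
    simp only [toIso_hom, app_comp, app_whiskerRight, app_whiskerLeft, app_assocHom]
  triangle f g := by
    refine comp_hom_ext fun l c => ?_
    obtain ⟨y, k₃, k₄, a, b, rfl⟩ := exists_eq_compMk l
    rw [toIso_hom, toIso_hom, toIso_hom, app_comp, app_assocHom, app_whiskerRight,
      app_whiskerLeft, app_leftUnitHom, app_rightUnitHom, compMk_lact]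

end

noncomputable section

variable {E M : Type u} [NormedAddCommGroup E] [NormedSpace ℝ E] [TopologicalSpace M]
  [ChartedSpace E M]

namespace StableMorphism

variable {G K R : BundleGerbe E M}

/-! ## The descent isomorphism of a composite -/

section Glue

variable (f : StableMorphism G K) (g : StableMorphism K R)

/-- The map `L_f(x, y₁) ⊗ L_g(y₂, z) ⊗ Q(y₁, y₂) → L_(g ∘ f)(x, z)`. -/
def glueMap {x : G.X} {y₁ y₂ : K.X} {z : R.X} (h₁ : G.π x = K.π y₁) (h₂ : K.π y₁ = K.π y₂)
    (h₃ : K.π y₂ = R.π z) :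
    TensorTorsor (TensorTorsor (f.fib h₁) (g.fib h₃)) (K.fib h₂) →
      (comp f g).fib (h₁.trans (h₂.trans h₃)) :=
  TensorTorsor.lift
    (fun t q => TensorTorsor.lift (fun a c => compMk (f.lact q a) c)
      (fun d a c => by rw [lact_smul, smul_compMk, compMk_smul]) t)
    (fun d t q => by
      obtain ⟨a, c, rfl⟩ := exists_tmul t
      rw [smul_tmul, lift_tmul, lift_tmul, lact_smul, smul_lact])

theorem glueMap_tmul {x : G.X} {y₁ y₂ : K.X} {z : R.X} {h₁ : G.π x = K.π y₁}
    {h₂ : K.π y₁ = K.π y₂} {h₃ : K.π y₂ = R.π z} (a : f.fib h₁) (c : g.fib h₃) (q : K.fib h₂) :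
    glueMap f g h₁ h₂ h₃ (tmul (tmul a c) q) = compMk (f.lact q a) c := rfl

theorem glueMap_smul {x : G.X} {y₁ y₂ : K.X} {z : R.X} (h₁ : G.π x = K.π y₁)
    (h₂ : K.π y₁ = K.π y₂) (h₃ : K.π y₂ = R.π z) (d : ℂˣ)
    (t : TensorTorsor (TensorTorsor (f.fib h₁) (g.fib h₃)) (K.fib h₂)) :
    glueMap f g h₁ h₂ h₃ (d • t) = d • glueMap f g h₁ h₂ h₃ t := by
  obtain ⟨t, q, rfl⟩ := exists_tmul t
  obtain ⟨a, c, rfl⟩ := exists_tmul t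
  rw [smul_tmul, smul_tmul, glueMap_tmul, glueMap_tmul, lact_smul, smul_compMk]

/-- `comp f g` is a composite of `f` and `g`. -/
def compComposite : Composite f g (comp f g) where
  κ := .ofExists (fun b => glueMap f g b.2.1 b.2.2.1 b.2.2.2)
    (fun b => glueMap_smul f g b.2.1 b.2.2.1 b.2.2.2) fun b => by
    have hb := SmoothMapAt.val (J := G.I.prod (R.I.prod (K.I.prod K.I))) (p := b)
    obtain ⟨a, ha⟩ := f.exists_smooth hb.fst hb.snd.snd.fst fun q => q.2.1
    obtain ⟨c, hc⟩ := g.exists_smooth hb.snd.snd.snd hb.snd.fst fun q => q.2.2.2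
    obtain ⟨s, hs⟩ := K.exists_smooth hb.snd.snd.fst hb.snd.snd.snd fun q => q.2.2.1
    exact ⟨fun q => tmul (tmul (a q) (c q)) (s q),
      SmoothAlong.tmul (SmoothAlong.tmul (SmoothAlong.pullback hb ha) (SmoothAlong.pullback hb hc))
        (SmoothAlong.pullback hb hs),
      SmoothAlong.pullback hb ((Smooth.lact hs ha).compMk hc)⟩
  phi_glue x x' y₁ y₂ y₁' y₂' z z' h₁ h₂ h₃ h₁' h₂' h₃' hx hy₁ hy₂ hz a c q a' c' q' p s t r
      e₁ e₂ e₃ := by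
    replace e₁ := f.phi_eq_iff.1 e₁
    replace e₂ := g.phi_eq_iff.1 e₂
    refine (comp f g).phi_eq_of_ract_eq
      (l₁ := compMk (f.lact q a) c) (l₂ := compMk (f.lact q' a') c') ?_
    rw [ract_compMk, lact_compMk, ← lact_ract, e₁, lact_lact, e₃, ← e₂, ← lact_lact, compMk_lact]

end Glue

/-- `identity G` is an identity of `G`. -/
def identityOn (G : BundleGerbe E M) : IdentityOn G (identity G) where
  ι :=
    { map := fun _ v => v
      map_smul := fun _ _ _ => rfl
      smooth := G.P.smooth_transition }
  phi_ι x₁ x₂ y₁ y₂ h₁ h₂ hx hy v₁ v₂ p q e :=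
    (identity G).phi_eq_of_ract_eq (l₁ := idMk v₁) (l₂ := idMk v₂) (by
      rw [identity_ract, identity_lact, idVal_idMk, idVal_idMk, e])

/-! ## Inverses -/

section Inverse

variable (f : StableMorphism G K)

/-- The bimodule inverse to `L_f`. -/
def invBimodule : Bimodule K G where
  L := (f.L.pullback (K.fp G.toLocallySplit) (fun p => (p.2, p.1))
    (contMDiff_snd.prodMk contMDiff_fst) fun _ h => Eq.symm h).dual
  lact {_ _ _ h _} p l := dstar (f.ract (h := h.symm) l.undstar (G.inv p))
  ract {_ _ _ h _} l q := dstar (f.lact (h := h.symm) (K.inv q) l.undstar)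
  lact_smul {_ _ _ h _} c p l := congrArg dstar (f.smul_ract (h := h.symm) c⁻¹ l.undstar _)
  smul_lact {_ _ _ h _} c p l := congrArg dstar (by rw [G.inv_smul, f.ract_smul (h := h.symm)])
  smul_ract {_ _ _ h _} c l q := congrArg dstar (f.lact_smul (h := h.symm) c⁻¹ _ l.undstar)
  ract_smul {_ _ _ h _} c l q := congrArg dstar (by rw [K.inv_smul, f.smul_lact (h := h.symm)])
  lact_lact {_ _ _ _ h _ _} p' p l := congrArg dstar (by
    rw [f.ract_ract (h := h.symm), G.inv_mul_rev])
  ract_ract {_ _ _ _ h _ _} l q' q := congrArg dstar (by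
    rw [f.lact_lact (h := h.symm), K.inv_mul_rev])
  lact_ract {_ _ _ _ h _ _} p l q := congrArg dstar
    (f.lact_ract (h := h.symm) _ l.undstar _).symm
  one_lact {_ _ h} l := congrArg dstar (by rw [G.inv_one, f.ract_one (h := h.symm)])
  ract_one {_ _ h} l := congrArg dstar (by rw [K.inv_one, f.one_lact (h := h.symm)])
  smooth b q p hq hp := by
    obtain ⟨a, ha⟩ := f.exists_smooth hp.map.fst hq.map.fst fun t => t.2.1.symm
    refine ⟨fun t => dstar (a t), fun t => dstar (f.lact (q t) (f.ract (a t) (G.inv (p t)))),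
      (SmoothAlong.pullback (hq.map.fst.prodMk hp.map.fst) ha).dstar,
      (SmoothAlong.pullback (hq.map.snd.prodMk hp.map.snd)
        (Smooth.lact hq (ha.ract hp.inv))).dstar, fun t => congrArg dstar ?_⟩
    change f.lact (K.inv (q t)) (f.lact (q t) (f.ract (a t) (G.inv (p t)))) =
      f.ract (a t) (G.inv (p t))
    rw [lact_lact, K.inv_mul, one_lact]

/-- The stable morphism inverse to `f`. -/
def inverse : StableMorphism K G := (invBimodule f).toStableMorphism

variable {f} {x x' : G.X} {y y' : K.X}

/-- The element of `L_f` underlying an element of the inverse of `f`. -/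
def invVal {h : K.π y = G.π x} (l : (inverse f).fib h) : f.fib h.symm := l.undstar

theorem invVal_smul {h : K.π y = G.π x} (c : ℂˣ) (l : (inverse f).fib h) :
    invVal (c • l) = c⁻¹ • invVal l := rfl

theorem invVal_lact {h : K.π y = G.π x} {hx : G.π x = G.π x'} (p : G.fib hx)
    (l : (inverse f).fib h) : invVal ((inverse f).lact p l) = f.ract (invVal l) (G.inv p) :=
  congrArg undstar ((invBimodule f).toStableMorphism_lact p l)

theorem invVal_ract {h : K.π y = G.π x} {hy : K.π y' = K.π y} (l : (inverse f).fib h)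
    (q : K.fib hy) : invVal ((inverse f).ract l q) = f.lact (K.inv q) (invVal l) :=
  congrArg undstar ((invBimodule f).toStableMorphism_ract l q)

variable {E' H' N' : Type u} [NormedAddCommGroup E'] [NormedSpace ℝ E'] [TopologicalSpace H']
  {J : ModelWithCorners ℝ E' H'} [TopologicalSpace N'] [ChartedSpace H' N'] {T : Set N'} {b : T}

theorem Smooth.invVal {x : T → G.X} {y : T → K.X} {h : ∀ q, K.π (y q) = G.π (x q)}
    {l : ∀ q, (inverse f).fib (h q)} (hl : (inverse f).Smooth J l b) :
    f.Smooth J (fun q => invVal (l q)) b := by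
  have hl' := SmoothAlong.of_dstar
    (L := f.L.pullback (K.fp G.toLocallySplit) (fun p => (p.2, p.1))
      (contMDiff_snd.prodMk contMDiff_fst) fun _ h => Eq.symm h)
    (k := fun q => ⟨(y q, x q), h q⟩) (s := fun q => StableMorphism.invVal (l q)) hl
  exact hl'.of_pullback

/-- The element `p` of `P(x, x')` with `a' p = a`. -/
def rdiv {h : G.π x = K.π y} {h' : G.π x' = K.π y} (a : f.fib h) (a' : f.fib h') :
    G.fib (h.trans h'.symm) :=
  Classical.choose (f.exists_ract_eq (h.trans h'.symm) a a')

theorem ract_rdiv {h : G.π x = K.π y} {h' : G.π x' = K.π y} (a : f.fib h) (a' : f.fib h') :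
    f.ract a' (rdiv a a') = a :=
  Classical.choose_spec (f.exists_ract_eq (h.trans h'.symm) a a')

theorem eq_rdiv {h : G.π x = K.π y} {h' : G.π x' = K.π y} {a : f.fib h} {a' : f.fib h'}
    {p : G.fib (h.trans h'.symm)} (e : f.ract a' p = a) : p = rdiv a a' :=
  f.ract_left_cancel (e.trans (ract_rdiv a a').symm)

/-- The element `q` of `Q(y, y')` with `q a = a'`. -/
def ldiv {h : G.π x = K.π y} {h' : G.π x = K.π y'} (a : f.fib h) (a' : f.fib h') :
    K.fib (h.symm.trans h') :=
  Classical.choose (f.exists_lact_eq (h.symm.trans h') a a')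

theorem ldiv_lact {h : G.π x = K.π y} {h' : G.π x = K.π y'} (a : f.fib h) (a' : f.fib h') :
    f.lact (ldiv a a') a = a' :=
  Classical.choose_spec (f.exists_lact_eq (h.symm.trans h') a a')

theorem eq_ldiv {h : G.π x = K.π y} {h' : G.π x = K.π y'} {a : f.fib h} {a' : f.fib h'}
    {q : K.fib (h.symm.trans h')} (e : f.lact q a = a') : q = ldiv a a' :=
  f.lact_right_cancel (e.trans (ldiv_lact a a').symm)

theorem Smooth.rdiv {x x' : T → G.X} {y : T → K.X} {h : ∀ q, G.π (x q) = K.π (y q)}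
    {h' : ∀ q, G.π (x' q) = K.π (y q)} {a : ∀ q, f.fib (h q)} {a' : ∀ q, f.fib (h' q)}
    (ha : f.Smooth J a b) (ha' : f.Smooth J a' b) :
    G.Smooth J (fun q => rdiv (a q) (a' q)) b := by
  refine SmoothAlong.of_map (L' := f.L) (Φ := fun q p => f.ract (a' q) p)
    (fun q c p => f.ract_smul c (a' q) p) (fun t ht => Smooth.ract ha' ht)
    (ha.map.fst.prodMk ha'.map.fst) ?_
  exact ha.congr fun q => (ract_rdiv (a q) (a' q)).symm

theorem Smooth.ldiv {x : T → G.X} {y y' : T → K.X} {h : ∀ q, G.π (x q) = K.π (y q)}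
    {h' : ∀ q, G.π (x q) = K.π (y' q)} {a : ∀ q, f.fib (h q)} {a' : ∀ q, f.fib (h' q)}
    (ha : f.Smooth J a b) (ha' : f.Smooth J a' b) :
    K.Smooth J (fun q => ldiv (a q) (a' q)) b := by
  refine SmoothAlong.of_map (L' := f.L) (Φ := fun q p => f.lact p (a q))
    (fun q c p => f.smul_lact c p (a q)) (fun t ht => Smooth.lact ht ha)
    (ha.map.snd.prodMk ha'.map.snd) ?_
  exact ha'.congr fun q => (ldiv_lact (a q) (a' q)).symm

variable (f)

/-- The transformation `f⁻¹ ∘ f ⇒ 1`. -/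
def compInverseHom : comp f (inverse f) ⟶ identity G :=
  Balanced.desc
    { map := fun a l => idMk (rdiv a (invVal l))
      smul_map := fun d a l => by
        rw [← idMk_smul]
        exact congrArg idMk (eq_rdiv (by rw [ract_smul, ract_rdiv])).symm
      map_smul := fun d a l => by
        rw [← idMk_smul, invVal_smul]
        exact congrArg idMk (eq_rdiv (by
          rw [ract_smul, smul_ract, ract_rdiv, smul_inv_smul])).symm
      map_lact := fun q a l => by
        refine congrArg idMk (eq_rdiv ?_).symm
        have e := congrArg (f.lact q) (ract_rdiv a (invVal ((inverse f).ract l q)))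
        rwa [invVal_ract, lact_ract, lact_lact, K.mul_inv, one_lact, ← invVal_ract] at e
      lact_map := fun r a l => by
        rw [identity_lact, idVal_idMk]
        refine congrArg idMk (eq_rdiv ?_).symm
        rw [invVal_lact, ract_ract, G.inv_mul_cancel_left, ract_rdiv]
      ract_map := fun a l p => by
        rw [identity_ract, idVal_idMk]
        refine congrArg idMk (eq_rdiv ?_).symm
        rw [← ract_ract, ract_rdiv]
      smooth := fun ha hl => smooth_idMk (Smooth.rdiv ha hl.invVal) }

/-- The transformation `f ∘ f⁻¹ ⇒ 1`. -/
def inverseCompHom : comp (inverse f) f ⟶ identity K :=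
  Balanced.desc
    { map := fun l a => idMk (ldiv (invVal l) a)
      smul_map := fun d l a => by
        rw [← idMk_smul, invVal_smul]
        exact congrArg idMk (eq_ldiv (by
          rw [smul_lact, lact_smul, ldiv_lact, smul_inv_smul])).symm
      map_smul := fun d l a => by
        rw [← idMk_smul]
        exact congrArg idMk (eq_ldiv (by rw [smul_lact, ldiv_lact])).symm
      map_lact := fun p l a => by
        refine congrArg idMk (eq_ldiv ?_)
        have e := congrArg (f.ract · p) (ldiv_lact (invVal ((inverse f).lact p l)) a)
        rwa [← lact_ract, invVal_lact, ract_ract, G.inv_mul, ract_one, ← invVal_lact] at e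
      lact_map := fun r l a => by
        rw [identity_lact, idVal_idMk]
        refine congrArg idMk (eq_ldiv ?_).symm
        rw [← lact_lact, ldiv_lact]
      ract_map := fun l a q => by
        rw [identity_ract, idVal_idMk]
        refine congrArg idMk (eq_ldiv ?_).symm
        rw [invVal_ract, lact_lact, K.mul_assoc, K.mul_inv, K.mul_one, ldiv_lact]
      smooth := fun hl ha => smooth_idMk (Smooth.ldiv hl.invVal ha) }

variable {f}

theorem app_compInverseHom {h : G.π x = K.π y} {h' : K.π y = G.π x'} (a : f.fib h)
    (l : (inverse f).fib h') : app (compInverseHom f) (compMk a l) = idMk (rdiv a (invVal l)) :=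
  Balanced.app_desc _ a l

theorem app_inverseCompHom {h : K.π y = G.π x} {h' : G.π x = K.π y'} (l : (inverse f).fib h)
    (a : f.fib h') : app (inverseCompHom f) (compMk l a) = idMk (ldiv (invVal l) a) :=
  Balanced.app_desc _ l a

variable (f)

theorem inverse_coherence : whiskerRight (compInverseHom f) f ≫ leftUnitHom f =
    assocHom f (inverse f) f ≫ whiskerLeft f (inverseCompHom f) ≫ rightUnitHom f := by
  refine comp_hom_ext fun l c => ?_
  obtain ⟨y, k₁, k₂, a, l, rfl⟩ := exists_eq_compMk l
  rw [app_comp, app_comp, app_comp, app_assocHom, app_whiskerRight, app_whiskerLeft,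
    app_compInverseHom, app_inverseCompHom, app_leftUnitHom, app_rightUnitHom, idVal_idMk,
    idVal_idMk]
  conv_lhs => rw [← ldiv_lact (invVal l) c]
  rw [← lact_ract, ract_rdiv]

end Inverse

end StableMorphism

open StableMorphism

/-- The operations of `stableBicategory` are the ones of the theory of bundle gerbes. -/
def stableOperations (E M : Type u) [NormedAddCommGroup E] [NormedSpace ℝ E] [TopologicalSpace M]
    [ChartedSpace E M] : StableOperations (stableBicategory E M) where
  composite f g := compComposite f g
  identity G := identityOn G
  whiskerLeft_value f g g' ρ x y₁ y₂ z h₁ h₂ h₃ a c c' q e := by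
    refine value_eq_iff.2 ((app_whiskerLeft f ρ (f.lact q a) c).trans ?_)
    rw [value_eq_iff.1 e]
    rfl
  whiskerRight_value f f' g θ x y₁ y₂ z h₁ h₂ h₃ a a' c q e := by
    refine value_eq_iff.2 ((app_whiskerRight θ g (f.lact q a) c).trans ?_)
    rw [app_lact, value_eq_iff.1 e]
    rfl
  associator_value f g k x y₁ y₂ z₁ z₂ t h₁ h₂ h₃ h₄ h₅ a b c q r := by
    refine value_eq_iff.2 ?_
    change app (assocHom f g k) (compMk ((comp f g).lact r (compMk (f.lact q a) b)) c) =
      compMk (f.lact q a) (compMk (g.lact r b) c)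
    rw [lact_compMk, app_assocHom]
  leftUnitor_value {G K} f x x₁ x₂ y h₁ h₂ h₃ v c q a e he e₁ := by
    refine value_eq_iff.2 ?_
    change app (leftUnitHom f) (compMk ((identity G).lact q (idMk v)) c) = a
    rw [app_leftUnitHom, identity_lact, idVal_idMk, idVal_idMk, f.phi_eq_iff.1 e₁, K.eq_one he,
      one_lact]
  rightUnitor_value {G K} f x y₁ y₂ y h₁ h₂ h₃ a v q a' e he e₁ := by
    refine value_eq_iff.2 ?_
    change app (rightUnitHom f) (compMk (f.lact q a) (idMk v)) = a'
    rw [app_rightUnitHom, idVal_idMk, lact_lact, ← f.phi_eq_iff.1 e₁, G.eq_one he, ract_one]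

theorem isBigroupoid_stableBicategory (E M : Type u) [NormedAddCommGroup E] [NormedSpace ℝ E]
    [TopologicalSpace M] [ChartedSpace E M] :
    @IsBigroupoid (BundleGerbe E M) (stableBicategory E M).toBicategory := by
  refine ⟨fun G K f g s => isIso (f := f) (g := g) s, fun G K f =>
    ⟨inverse f, compInverseHom f, inverseCompHom f, ?_⟩⟩
  exact ((toIso (assocHom f (inverse f) f)).inv_comp_eq).2 (inverse_coherence f)

end

theorem mainTheorem10 (E M : Type u) [NormedAddCommGroup E] [NormedSpace ℝ E] [TopologicalSpace M]
    [ChartedSpace E M] [IsManifold 𝓘(ℝ, E) ∞ M] :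
    ∃ 𝔅 : BicategoryOn (StableMorphism (E := E) (M := M)),
      Nonempty (StableOperations 𝔅) ∧ @IsBigroupoid (BundleGerbe E M) 𝔅.toBicategory :=
  ⟨stableBicategory E M, ⟨stableOperations E M⟩, isBigroupoid_stableBicategory E M⟩
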